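/- Let $d\in\{1,2\}$, $H,g,T>0$, $s\ge 0$, $\mathcal S=\mathbb R^d\times(-H,0)$ with points $(X,z)$; $\nabla,\nabla\cdot,\Delta$ act on $X\in\mathbb R^d$. Let $\rho_{\rm eq}\in W^{1,\infty}(-H,0)$ with $\inf\rho_{\rm eq}>0$, and assume that $N^2=-g\,\rho_{\rm eq}'/\rho_{\rm eq}$, which may depend on $z$, is strictly positive (almost everywhere) on $(-H,0)$. Let $(f_n)_{n\ge1}$ be an orthonormal basis of $L^2((-H,0),\rho_{\rm eq}N^2dz)$ formed by solutions of $$(\rho_{\rm eq}f_n')'+\frac{\rho_{\rm eq}N^2}{c_n^2}f_n=0,\qquad f_n(-H)=f_n(0)=0,\qquad c_1>c_2>\dots>0,$$ and put $g_0=\big(\int_{-H}^0\rho_{\rm eq}^{-1}\big)^{-1/2}\rho_{\rm eq}^{-1}$, $g_n=c_nf_n'$ for $n\ge1$, and $\alpha_{mn}=(f_m,f_n)_{L^2_{\rho_{\rm eq}}}=\int_{-H}^0f_mf_n\rho_{\rm eq}\,dz$. Let $U=(V,w)$ and $\rho$ belong to $C([0,T];H^{s,0}(\mathcal S))$, $H^{s,0}(\mathcal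 S)=L^2((-H,0);H^s(\mathbb R^d))$, and solve, with a pressure $P$ that is locally integrable on $(0,T)\times\mathbb R^d\times[-H,0]$, in the sense of distributions, $$\partial_tV+\frac1{\rho_{\rm eq}}\nabla P=0,\quad \partial_tw+\frac1{\rho_{\rm eq}}\partial_zP+\frac{\rho}{\rho_{\rm eq}}g=0,\quad \partial_t\rho+w\rho_{\rm eq}'=0,\quad \nabla\cdot V+\partial_zw=0,\qquad w_{|z=-H}=w_{|z=0}=0,$$ with initial data $V^0,\rho^0$ for $V,\rho$, and assume that the vertical vorticity $\nabla^\perp\cdot V$ is zero. Consider the coefficients $V_n,w_n,\rho_n,P_n$ (functions of $(t,X)$) of the expansions $$V=\sum_{n\ge0}V_ng_n,\quad w=\sum_{n\ge1}w_nf_n,\quad \rho=\sum_{n\ge1}\tfrac1g\rho_n\,\rho_{\rm eq}N^2f_n,\quad P=\sum_{n\ge0}P_n\,\rho_{\rm eq}g_n,$$ that is, $V_n=\int_{-H}^0Vg_n\rho_{\rm eq}dz$, $w_n=\int_{-H}^0wf_n\rho_{\rm eq}N^2dz$, $\rho_n=\int_{-H}^0g\rho f_ndz$, $P_n=\int_{-H}^0Pg_ndz$.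 Then for all $n\ge1$ one has $V_n,w_n,\rho_n\in C([0,T];H^s(\mathbb R^d))$, the initial values of $V_n$ and $\rho_n$ are the corresponding coefficients of $V^0$ and $\rho^0$, and, in the sense of distributions (with convergent series), $$\partial_tV_n-\sum_{m=1}^\infty c_mc_n\alpha_{mn}\Delta\partial_tV_m+c_n\nabla\rho_n=0,\qquad \partial_t\rho_n+c_n\nabla\cdot V_n=0,$$ $$w_n=-c_n\nabla\cdot V_n,\qquad P_n=c_n\rho_n+c_n\sum_{m=1}^\infty\alpha_{mn}\partial_tw_m.$$ Moreover $V_0=0$, and $P_0$ depends on $t$ only; if the pressure, which the equations determine only up to the addition of a function of $t$, is normalized by $P(t,\cdot)\in L^2(\mathcal S)$ for almost every $t$, then $P_0=0$. -/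

import Mathlib

open MeasureTheory Set Filter Topology
open scoped ContDiff ENNReal

noncomputable section

namespace Strat

/-- The horizontal space `ℝ^d`. -/
abbrev Hor (d : ℕ) : Type := EuclideanSpace ℝ (Fin d)

/-- Lebesgue measure on the vertical interval `(-H, 0)`. -/
def vertMeasure (H : ℝ) : Measure ℝ := volume.restrict (Ioo (-H) 0)

/-- Lebesgue measure on the strip `S = ℝ^d × (-H, 0)`. -/
def stripMeasure (d : ℕ) (H : ℝ) : Measure (Hor d × ℝ) :=
  volume.restrict (univ ×ˢ Ioo (-H) 0)

/-! ### Test functions and weak formulations -/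

/-- `φ` is smooth with compact support contained in `O`. -/
def IsTest {F : Type*} [NormedAddCommGroup F] [NormedSpace ℝ F] (O : Set F) (φ : F → ℝ) : Prop :=
  ContDiff ℝ ∞ φ ∧ HasCompactSupport φ ∧ tsupport φ ⊆ O

/-- Derivative of `φ` in the direction `v`. -/
def pd {F : Type*} [NormedAddCommGroup F] [NormedSpace ℝ F] (v : F) (φ : F → ℝ) : F → ℝ :=
  fun p => fderiv ℝ φ p v

/-- The horizontal unit vectors. -/
def e {d : ℕ} (i : Fin d) : Hor d := EuclideanSpace.single i 1

/-- The time direction, for functions of `(t, x)`. -/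
def dirT {F : Type*} [NormedAddCommGroup F] : ℝ × F := (1, 0)

/-- The space direction `v`, for functions of `(t, x)`. -/
def dirX {F : Type*} [NormedAddCommGroup F] (v : F) : ℝ × F := (0, v)

/-- Horizontal Laplacian of a function of `(t, X)`. -/
def lapX {d : ℕ} (φ : ℝ × Hor d → ℝ) : ℝ × Hor d → ℝ :=
  fun p => ∑ i : Fin d, pd (dirX (e i)) (pd (dirX (e i)) φ) p

/-- The space-time pairing `∫₀ᵀ ∫ u(t, x) ψ(t, x) dμ(x) dt`. With `ψ` a test function `φ` this is
`⟨u, φ⟩`; thus `⟨∂_t u, φ⟩ = - pair T μ u (pd dirT φ)`, and likewise for the other derivatives. -/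
def pair {F : Type*} [MeasurableSpace F] (T : ℝ) (μ : Measure F)
    (u : ℝ → F → ℝ) (ψ : ℝ × F → ℝ) : ℝ :=
  ∫ t in Ioo 0 T, ∫ x, u t x * ψ (t, x) ∂μ

/-! ### Function spaces -/

/-- `v` is the Bessel potential `(1 + |D|²)^{s/2} u` of `u`, both `u` and `v` being square
integrable on `ℝ^d`. In particular `u ∈ H^s(ℝ^d)` with norm `|v|₂` (`s ≥ 0`). -/
def IsBessel {d : ℕ} (s : ℝ) (u v : Hor d → ℝ) : Prop :=
  ∃ (hu : MemLp (fun X => (u X : ℂ)) 2 volume) (hv : MemLp (fun X => (v X : ℂ)) 2 volume),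
    TemperedDistribution.besselPotential (Hor d) ℂ s
        (Lp.toTemperedDistribution (hu.toLp (fun X => (u X : ℂ)))) =
      Lp.toTemperedDistribution (hv.toLp (fun X => (v X : ℂ)))

/-- `u ∈ C([0, T]; H^s(ℝ^d))`. -/
def ContHs {d : ℕ} (T s : ℝ) (u : ℝ → Hor d → ℝ) : Prop :=
  ∃ v : ℝ → Hor d → ℝ,
    (∀ t ∈ Icc 0 T, IsBessel s (u t) (v t)) ∧
    ∀ t₀ ∈ Icc 0 T,
      Tendsto (fun t => eLpNorm (v t - v t₀) 2 volume) (𝓝[Icc 0 T] t₀) (𝓝 0)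

/-- `u ∈ C([0, T]; H^{s,0}(S))` where `H^{s,0}(S) = L²((-H, 0); H^s(ℝ^d))`: the function
`v = Λ^s u`, where `Λ^s` acts on the horizontal variable, is continuous in time with values in
`L²(S)`. -/
def ContHs0 {d : ℕ} (T H s : ℝ) (u : ℝ → Hor d × ℝ → ℝ) : Prop :=
  ∃ v : ℝ → Hor d × ℝ → ℝ,
    (∀ t ∈ Icc 0 T, MemLp (u t) 2 (stripMeasure d H) ∧ MemLp (v t) 2 (stripMeasure d H) ∧
      ∀ᵐ z ∂(vertMeasure H), IsBessel s (fun X => u t (X, z)) (fun X => v t (X, z))) ∧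
    ∀ t₀ ∈ Icc 0 T,
      Tendsto (fun t => eLpNorm (v t - v t₀) 2 (stripMeasure d H)) (𝓝[Icc 0 T] t₀) (𝓝 0)

/-! ### The stratification and the Sturm-Liouville modes -/

/-- The square `N² = - g ρ_eq' / ρ_eq` of the Brunt-Väisälä frequency. -/
def bruntSq (g : ℝ) (ρeq : ℝ → ℝ) (z : ℝ) : ℝ := -(deriv ρeq z / ρeq z) * g

/-- `f` solves `(ρ_eq f')' + (ρ_eq N² / c²) f = 0` on `(-H, 0)` with `f(-H) = f(0) = 0`. As `N²` is
only a bounded function, the flux `ρ_eq f'` is absolutely continuous and the equation holds almost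
everywhere. -/
structure SolvesSL (H g : ℝ) (ρeq : ℝ → ℝ) (c : ℝ) (f : ℝ → ℝ) : Prop where
  diff : DifferentiableOn ℝ f (Icc (-H) 0)
  flux_ac : AbsolutelyContinuousOnInterval
    (fun z => ρeq z * derivWithin f (Icc (-H) 0) z) (-H) 0
  eqn : ∀ᵐ z ∂(vertMeasure H),
    HasDerivAt (fun y => ρeq y * derivWithin f (Icc (-H) 0) y)
      (-(ρeq z * bruntSq g ρeq z / c ^ 2 * f z)) z
  bot : f (-H) = 0
  top : f 0 = 0

/-- The measure `ρ_eq N² dz` on `(-H, 0)`. -/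
def weightMeasure (H g : ℝ) (ρeq : ℝ → ℝ) : Measure ℝ :=
  (vertMeasure H).withDensity (fun z => ENNReal.ofReal (ρeq z * bruntSq g ρeq z))

/-- `(f_n)_{n ≥ 1}` is an orthonormal basis of `L²((-H, 0), ρ_eq N² dz)` formed by eigenfunctions
of the Sturm-Liouville problem, with eigenvalues `1 / c_n²`, `c_1 > c_2 > ⋯ > 0`.
The values `c 0` and `f 0` are not used. -/
structure IsModes (H g : ℝ) (ρeq : ℝ → ℝ) (c : ℕ → ℝ) (f : ℕ → ℝ → ℝ) : Prop where
  pos : ∀ n, 1 ≤ n → 0 < c n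
  decr : ∀ m n, 1 ≤ m → m < n → c n < c m
  eigen : ∀ n, 1 ≤ n → SolvesSL H g ρeq (c n) (f n)
  basis : ∃ b : HilbertBasis ℕ ℝ (Lp ℝ 2 (weightMeasure H g ρeq)),
    ∀ n : ℕ, (b n : ℝ → ℝ) =ᵐ[weightMeasure H g ρeq] f (n + 1)

/-- The functions `g_0 = (∫ ρ_eq⁻¹)^{-1/2} ρ_eq⁻¹` and `g_n = c_n f_n'` for `n ≥ 1`. -/
def gMode (H : ℝ) (ρeq : ℝ → ℝ) (c : ℕ → ℝ) (f : ℕ → ℝ → ℝ) (n : ℕ) (z : ℝ) : ℝ :=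
  if n = 0 then (∫ y, (ρeq y)⁻¹ ∂(vertMeasure H)) ^ (-(1 / 2) : ℝ) * (ρeq z)⁻¹
  else c n * deriv (f n) z

/-- The interaction coefficients `α_{mn} = (f_m, f_n)_{L²_{ρ_eq}}`. -/
def interaction (H : ℝ) (ρeq : ℝ → ℝ) (f : ℕ → ℝ → ℝ) (m n : ℕ) : ℝ :=
  ∫ z, f m z * f n z * ρeq z ∂(vertMeasure H)

/-! ### Modal coefficients of a field on the strip -/

section coefficients

variable {d : ℕ} (H g : ℝ) (ρeq : ℝ → ℝ) (c : ℕ → ℝ) (f : ℕ → ℝ → ℝ)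

/-- Coefficient `v_n` of `v = ∑_{n ≥ 0} v_n g_n`, the scalar product of `v` and `g_n` in
`L²(ρ_eq dz)`; it is used for each component of the horizontal velocity. -/
def velCoeff (n : ℕ) (v : Hor d × ℝ → ℝ) (X : Hor d) : ℝ :=
  ∫ z, v (X, z) * gMode H ρeq c f n z * ρeq z ∂(vertMeasure H)

/-- Coefficient `w_n` of `w = ∑_{n ≥ 1} w_n f_n`, the scalar product of `w` and `f_n` in
`L²(ρ_eq N² dz)`. -/
def vertCoeff (n : ℕ) (w : Hor d × ℝ → ℝ) (X : Hor d) : ℝ :=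
  ∫ z, w (X, z) * f n z * (ρeq z * bruntSq g ρeq z) ∂(vertMeasure H)

/-- Coefficient `ρ_n` of `ρ = ∑_{n ≥ 1} g⁻¹ ρ_n ρ_eq N² f_n`: the scalar product of `g ρ` and
`ρ_eq N² f_n` in `L²((ρ_eq N²)⁻¹ dz)`, that is, `∫ g ρ f_n dz`. -/
def densCoeff (n : ℕ) (r : Hor d × ℝ → ℝ) (X : Hor d) : ℝ :=
  ∫ z, g * r (X, z) * f n z ∂(vertMeasure H)

/-- Coefficient `P_n` of `P = ∑_{n ≥ 0} P_n ρ_eq g_n`: the scalar product of `P` and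
`ρ_eq g_n` in `L²(ρ_eq⁻¹ dz)`, that is, `∫ P g_n dz`. -/
def presCoeff (n : ℕ) (P : Hor d × ℝ → ℝ) (X : Hor d) : ℝ :=
  ∫ z, P (X, z) * gMode H ρeq c f n z ∂(vertMeasure H)

end coefficients

/-! ### The linearized Euler equations -/

/-- `(V, w, ρ)`, with pressure `P`, solves on `[0, T]` the linearized Euler equations
`∂_t V + ρ_eq⁻¹ ∇P = 0`, `∂_t w + ρ_eq⁻¹ ∂_z P + ρ_eq⁻¹ ρ g = 0`, `∂_t ρ + w ρ_eq' = 0`,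
`∇·V + ∂_z w = 0` in the strip, with `w = 0` at `z = -H` and `z = 0`.
The equations are understood in the sense of distributions, the first two being multiplied by
`ρ_eq`. In `div`, the test functions do not have to vanish at the boundary of the strip: this
expresses at once the vanishing of the divergence and of the normal trace `w`. -/
structure IsLinearSolution {d : ℕ} (T H g : ℝ) (ρeq : ℝ → ℝ)
    (V : ℝ → Fin d → Hor d × ℝ → ℝ) (w ρ P : ℝ → Hor d × ℝ → ℝ) : Prop where
  pressure_integrable : LocallyIntegrableOn (fun q : ℝ × (Hor d × ℝ) => P q.1 q.2)
    (Ioo 0 T ×ˢ (univ ×ˢ Icc (-H) 0)) volume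
  horizontal : ∀ φ : ℝ × (Hor d × ℝ) → ℝ, IsTest (Ioo 0 T ×ˢ (univ ×ˢ Ioo (-H) 0)) φ →
    ∀ i : Fin d,
      -pair T (stripMeasure d H) (fun t x => ρeq x.2 * V t i x) (pd dirT φ)
        - pair T (stripMeasure d H) P (pd (dirX (e i, 0)) φ) = 0
  vertical : ∀ φ : ℝ × (Hor d × ℝ) → ℝ, IsTest (Ioo 0 T ×ˢ (univ ×ˢ Ioo (-H) 0)) φ →
      -pair T (stripMeasure d H) (fun t x => ρeq x.2 * w t x) (pd dirT φ)
        - pair T (stripMeasure d H) P (pd (dirX (0, 1)) φ)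
        + pair T (stripMeasure d H) (fun t x => ρ t x * g) φ = 0
  density : ∀ φ : ℝ × (Hor d × ℝ) → ℝ, IsTest (Ioo 0 T ×ˢ (univ ×ˢ Ioo (-H) 0)) φ →
      -pair T (stripMeasure d H) ρ (pd dirT φ)
        + pair T (stripMeasure d H) (fun t x => w t x * deriv ρeq x.2) φ = 0
  div : ∀ t ∈ Icc 0 T, ∀ φ : Hor d × ℝ → ℝ, IsTest univ φ →
      ∫ x, ((∑ i : Fin d, V t i x * pd (e i, 0) φ x) + w t x * pd (0, 1) φ x)
        ∂(stripMeasure d H) = 0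

/-- The vertical vorticity `∇^⊥·V` vanishes at all times of `[0, T]`, in the sense of
distributions: `∂_i V_j = ∂_j V_i` for all `i, j` (for `d = 1` this is no condition). -/
def ZeroVerticalVorticity {d : ℕ} (T H : ℝ) (V : ℝ → Fin d → Hor d × ℝ → ℝ) : Prop :=
  ∀ t ∈ Icc 0 T, ∀ φ : Hor d × ℝ → ℝ, IsTest (univ ×ˢ Ioo (-H) 0) φ → ∀ i j : Fin d,
    ∫ x, (V t j x * pd (e i, 0) φ x - V t i x * pd (e j, 0) φ x) ∂(stripMeasure d H) = 0

end Strat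

end

noncomputable section

namespace Strat

/-! ### Square integrable functions on products -/

section products

variable {α β : Type*} [MeasurableSpace α] [MeasurableSpace β]

/-! The modes are neither smooth nor compactly supported in `(-H, 0)`, so they cannot be inserted
directly in the weak equations. The way around is to separate variables. For a fixed test function
`Φ(t, X)`, the pairing of a field with `Φ(t, X) k(z)` is `∫ r k dz` with one function `r` of `z`
alone: square integrable, by Riesz, for `V`, `w`, `ρ` (`ContL2.exists_repr`), and integrable, by
Fubini, for the pressure (`PressureIntegrable.exists_repr`). Each Euler equation then becomes an
identity or a weak first order ODE in `z`, which can be integrated against any bounded `k`.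

The horizontal and density equations become identities almost everywhere in `z`, and one takes `k =
g_n` and `k = g f_n` (`IsLinearSolution.horizontal_pint`, `IsLinearSolution.density_pint`). The
vertical equation says that the function of `z` representing `P` is absolutely continuous with known
derivative; integration by parts against `f_n'`, where `f_n` vanishes at both ends, gives `P_n`
without any boundary condition on `P` (`IsLinearSolution.vertical_pint`). Incompressibility, tested
up to the boundary, says that `w` is the primitive of `-∇·V` vanishing at both ends
(`IsLinearSolution.slice_eq`); integration by parts against the flux `ρ_eq f_n'` and the
Sturm-Liouville equation give `w_n = -c_n ∇·V_n`. Zero vorticity then turns `∇(∇·V_m)` into `ΔV_m`.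

The series is the expansion of `∫ w f_n ρ_eq dz` in the `w_m`. Since `N²` may come arbitrarily close
to zero, `f_n / N²` need not lie in `L²(ρ_eq N² dz)`, and expanding `w` on `(f_m)` is not enough.
The derivative of `w` is expanded instead, on `(g_m)`, which is a Hilbert basis of `L²(ρ_eq dz)`
(`IsModes.exists_basis`); Parseval against a primitive of `f_n ρ_eq` yields the series, with bounds
uniform in time that allow it to be integrated in `t` (`IsModes.hasSum_interaction`,
`IsLinearSolution.hasSum_pair`).

For the mode zero, `ρ_eq g_0` is constant and `∇·V` has zero mean in `z`, so `V_0` is square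
integrable, divergence free and curl free; on the Fourier side `|ξ|²` times its transform is zero
(`eq_zero_of_div_curl`). Hence `∇P_0 = 0`, and mollification shows that `P_0` depends on time only
(`exists_eq_time_function`); a square integrable constant on `ℝ^d` is zero. Regularity in `H^s`
passes to the coefficients because the Bessel potential acts on `X` only and commutes with
integration in `z` (`IsBessel.pint`). -/

theorem eLpNorm_two_sq {μ : Measure α} (u : α → ℝ) :
    eLpNorm u 2 μ ^ 2 = ∫⁻ x, ‖u x‖ₑ ^ 2 ∂μ := by
  have h := eLpNorm_nnreal_pow_eq_lintegral (f := u) (μ := μ) (p := 2) (by norm_num)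
  simpa using h

theorem enorm_integral_mul_le {μ : Measure α} {u v : α → ℝ} (hu : AEStronglyMeasurable u μ)
    (hv : AEStronglyMeasurable v μ) :
    ‖∫ x, u x * v x ∂μ‖ₑ ≤ eLpNorm u 2 μ * eLpNorm v 2 μ := by
  refine (enorm_integral_le_lintegral_enorm _).trans ?_
  have h := eLpNorm_smul_le_mul_eLpNorm (p := 2) (q := 2) (r := 1) hv hu
  rw [eLpNorm_one_eq_lintegral_enorm] at h
  simpa using h

theorem memLp_mul_prod {μ : Measure α} {ν : Measure β} [SFinite μ] [SFinite ν] {η : α → ℝ}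
    {k : β → ℝ} (hη : MemLp η 2 μ) (hk : MemLp k 2 ν) :
    MemLp (fun p : α × β => η p.1 * k p.2) 2 (μ.prod ν) := by
  have h1 : AEStronglyMeasurable (fun p : α × β => η p.1 * k p.2) (μ.prod ν) :=
    hη.1.comp_fst.mul hk.1.comp_snd
  refine (memLp_two_iff_integrable_sq h1).2 ?_
  simp_rw [mul_pow]
  exact hη.integrable_sq.mul_prod hk.integrable_sq

/-- The partial integral of `u` against `k` in the second variable. -/
def pint (ν : Measure β) (k : β → ℝ) (u : α × β → ℝ) (x : α) : ℝ := ∫ y, u (x, y) * k y ∂ν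

/-- The partial integral of `u` against `η` in the first variable. -/
def slice (μ : Measure α) (η : α → ℝ) (u : α × β → ℝ) (y : β) : ℝ := ∫ x, u (x, y) * η x ∂μ

/-- Cauchy-Schwarz in the second variable for almost every value of the first, then Tonelli. -/
theorem eLpNorm_pint_le {μ : Measure α} {ν : Measure β} [SFinite μ] [SFinite ν]
    {u : α × β → ℝ} {k : β → ℝ} (hu : AEStronglyMeasurable u (μ.prod ν))
    (hk : AEStronglyMeasurable k ν) :
    eLpNorm (pint ν k u) 2 μ ≤ eLpNorm u 2 (μ.prod ν) * eLpNorm k 2 ν := by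
  have h2 : ∀ a b : ℝ≥0∞, a ^ 2 ≤ b ^ 2 → a ≤ b := fun a b h =>
    (ENNReal.pow_right_strictMono (n := 2) (by norm_num)).le_iff_le.1 h
  apply h2
  rw [mul_pow, eLpNorm_two_sq, eLpNorm_two_sq u, lintegral_prod _ (by fun_prop)]
  rw [← lintegral_mul_const'' _ (by
    exact AEMeasurable.lintegral_prod_right' (f := fun p : α × β => ‖u p‖ₑ ^ 2) (by fun_prop))]
  refine lintegral_mono_ae ?_
  filter_upwards [hu.prodMk_left] with x hx
  rw [← eLpNorm_two_sq, ← mul_pow]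
  exact pow_le_pow_left₀ (by simp) (enorm_integral_mul_le hx hk) 2

theorem memLp_pint {μ : Measure α} {ν : Measure β} [SFinite μ] [SFinite ν]
    {u : α × β → ℝ} {k : β → ℝ} (hu : MemLp u 2 (μ.prod ν)) (hk : MemLp k 2 ν) :
    MemLp (pint ν k u) 2 μ := by
  refine ⟨?_, (eLpNorm_pint_le hu.1 hk.1).trans_lt (ENNReal.mul_lt_top hu.2 hk.2)⟩
  exact (hu.1.mul hk.1.comp_snd).integral_prod_right'

omit [MeasurableSpace β] in
theorem slice_eq_pint_swap {μ : Measure α} (η : α → ℝ) (u : α × β → ℝ) :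
    slice μ η u = pint μ η (u ∘ Prod.swap) := rfl

theorem memLp_swap {μ : Measure α} {ν : Measure β} [SFinite μ] [SFinite ν]
    {u : α × β → ℝ} (hu : MemLp u 2 (μ.prod ν)) : MemLp (u ∘ Prod.swap) 2 (ν.prod μ) :=
  hu.comp_measurePreserving Measure.measurePreserving_swap

theorem memLp_slice {μ : Measure α} {ν : Measure β} [SFinite μ] [SFinite ν]
    {u : α × β → ℝ} {η : α → ℝ} (hu : MemLp u 2 (μ.prod ν)) (hη : MemLp η 2 μ) :
    MemLp (slice μ η u) 2 ν := by
  rw [slice_eq_pint_swap]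
  exact memLp_pint (memLp_swap hu) hη

theorem integrable_mul_mul {μ : Measure α} {ν : Measure β} [SFinite μ] [SFinite ν]
    {u : α × β → ℝ} {η : α → ℝ} {k : β → ℝ} (hu : MemLp u 2 (μ.prod ν)) (hη : MemLp η 2 μ)
    (hk : MemLp k 2 ν) : Integrable (fun p => u p * (η p.1 * k p.2)) (μ.prod ν) :=
  hu.integrable_mul (memLp_mul_prod hη hk)

/-- Fubini, under integrability of the product alone and not square integrability, so that it also
serves for the pressure. -/
theorem integral_pint_mul {μ : Measure α} {ν : Measure β} [SFinite μ] [SFinite ν]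
    {u : α × β → ℝ} {η : α → ℝ} {k : β → ℝ}
    (h : Integrable (fun p => u p * (η p.1 * k p.2)) (μ.prod ν)) :
    ∫ x, pint ν k u x * η x ∂μ = ∫ p, u p * (η p.1 * k p.2) ∂(μ.prod ν) := by
  rw [integral_prod _ h]
  refine integral_congr_ae (.of_forall fun x => ?_)
  simp only [pint]
  rw [← integral_mul_const]
  exact integral_congr_ae (.of_forall fun y => by ring)

theorem integral_slice_mul {μ : Measure α} {ν : Measure β} [SFinite μ] [SFinite ν]
    {u : α × β → ℝ} {η : α → ℝ} {k : β → ℝ}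
    (h : Integrable (fun p => u p * (η p.1 * k p.2)) (μ.prod ν)) :
    ∫ y, slice μ η u y * k y ∂ν = ∫ p, u p * (η p.1 * k p.2) ∂(μ.prod ν) := by
  rw [integral_prod_symm _ h]
  refine integral_congr_ae (.of_forall fun y => ?_)
  simp only [slice]
  rw [← integral_mul_const]
  exact integral_congr_ae (.of_forall fun x => by ring)

end products

/-! ### Paths that are continuous in time with values in `L²` -/

/-- `u` is continuous on `[0, T]` with values in `L²(μ)`. -/
def ContL2 {α : Type*} [MeasurableSpace α] (T : ℝ) (μ : Measure α) (u : ℝ → α → ℝ) : Prop :=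
  (∀ t ∈ Icc 0 T, MemLp (u t) 2 μ) ∧ ∀ t₀ ∈ Icc 0 T,
    Tendsto (fun t => eLpNorm (u t - u t₀) 2 μ) (𝓝[Icc 0 T] t₀) (𝓝 0)

section paths

variable {α : Type*} [MeasurableSpace α] {T : ℝ} {μ : Measure α} {u : ℝ → α → ℝ}

/-- `ψ` is continuous in `t`, measurable in `x`, with a common square integrable majorant. -/
structure TestFamily (μ : Measure α) (ψ : ℝ → α → ℝ) (G : α → ℝ) : Prop where
  memLp : MemLp G 2 μ
  meas : ∀ t, AEStronglyMeasurable (ψ t) μ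
  le : ∀ t x, |ψ t x| ≤ G x
  cont : ∀ x, Continuous fun t => ψ t x

theorem TestFamily.memLp' {ψ : ℝ → α → ℝ} {G : α → ℝ} (h : TestFamily μ ψ G) (t : ℝ) :
    MemLp (ψ t) 2 μ :=
  h.memLp.mono' (h.meas t) (.of_forall fun x => h.le t x)

theorem TestFamily.eLpNorm_le {ψ : ℝ → α → ℝ} {G : α → ℝ} (h : TestFamily μ ψ G) (t : ℝ) :
    eLpNorm (ψ t) 2 μ ≤ eLpNorm G 2 μ :=
  eLpNorm_mono_real fun x => h.le t x

/-- The increment splits in two: `u t - u t₀` against `ψ t` is small by Cauchy-Schwarz and the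
common majorant, and `u t₀` against `ψ t` is continuous in `t` by dominated convergence. -/
theorem ContL2.continuousOn_integral (hu : ContL2 T μ u) {ψ : ℝ → α → ℝ} {G : α → ℝ}
    (hψ : TestFamily μ ψ G) : ContinuousOn (fun t => ∫ x, u t x * ψ t x ∂μ) (Icc 0 T) := by
  intro t₀ ht₀
  have h1 : Tendsto (fun t => ∫ x, (u t - u t₀) x * ψ t x ∂μ) (𝓝[Icc 0 T] t₀) (𝓝 0) := by
    have h2 : Tendsto (fun t => eLpNorm (u t - u t₀) 2 μ * eLpNorm G 2 μ)
        (𝓝[Icc 0 T] t₀) (𝓝 0) := by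
      have := ENNReal.Tendsto.mul_const (b := eLpNorm G 2 μ) (hu.2 t₀ ht₀) (Or.inr hψ.memLp.2.ne)
      simpa using this
    rw [tendsto_iff_enorm_sub_tendsto_zero]
    refine tendsto_of_tendsto_of_tendsto_of_le_of_le' tendsto_const_nhds h2
      (.of_forall fun _ => by simp) ?_
    filter_upwards [self_mem_nhdsWithin] with t ht
    rw [sub_zero]
    exact (enorm_integral_mul_le ((hu.1 t ht).1.sub (hu.1 t₀ ht₀).1) (hψ.meas t)).trans
      (by gcongr; exact hψ.eLpNorm_le t)
  have h3 : Tendsto (fun t => ∫ x, u t₀ x * ψ t x ∂μ) (𝓝[Icc 0 T] t₀)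
      (𝓝 (∫ x, u t₀ x * ψ t₀ x ∂μ)) := by
    refine Tendsto.mono_left ?_ nhdsWithin_le_nhds
    refine Continuous.tendsto (continuous_of_dominated (bound := fun x => |u t₀ x| * G x)
      (fun t => (hu.1 t₀ ht₀).1.mul (hψ.meas t)) (fun t => .of_forall fun x => ?_)
      ((hu.1 t₀ ht₀).abs.integrable_mul hψ.memLp) (.of_forall fun x => ?_)) t₀
    · rw [Real.norm_eq_abs, Pi.mul_apply, abs_mul]
      exact mul_le_mul_of_nonneg_left (hψ.le t x) (abs_nonneg _)
    · exact continuous_const.mul (hψ.cont x)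
  have h4 := h1.add h3
  rw [zero_add] at h4
  refine h4.congr' ?_
  filter_upwards [self_mem_nhdsWithin] with t ht
  rw [← integral_add]
  · exact integral_congr_ae (.of_forall fun x => by simp; ring)
  · exact ((hu.1 t ht).sub (hu.1 t₀ ht₀)).integrable_mul (hψ.memLp' t)
  · exact (hu.1 t₀ ht₀).integrable_mul (hψ.memLp' t)

theorem ContL2.integrableOn_integral (hu : ContL2 T μ u) {ψ : ℝ → α → ℝ} {G : α → ℝ}
    (hψ : TestFamily μ ψ G) :
    IntegrableOn (fun t => ∫ x, u t x * ψ t x ∂μ) (Ioo 0 T) :=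
  ((hu.continuousOn_integral hψ).integrableOn_compact isCompact_Icc).mono_set Ioo_subset_Icc_self

theorem ContL2.exists_bound (hu : ContL2 T μ u) :
    ∃ C : ℝ, 0 ≤ C ∧ ∀ t ∈ Icc 0 T, (eLpNorm (u t) 2 μ).toReal ≤ C := by
  have h : ContinuousOn (fun t => (eLpNorm (u t) 2 μ).toReal) (Icc 0 T) := by
    intro t₀ ht₀
    have h1 := (ENNReal.tendsto_toReal (ENNReal.zero_ne_top)).comp (hu.2 t₀ ht₀)
    rw [ContinuousWithinAt, tendsto_iff_dist_tendsto_zero]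
    refine tendsto_of_tendsto_of_tendsto_of_le_of_le' tendsto_const_nhds h1
      (.of_forall fun _ => dist_nonneg) ?_
    filter_upwards [self_mem_nhdsWithin] with t ht
    have e1 : ∀ s (hs : s ∈ Icc 0 T), (eLpNorm (u s) 2 μ).toReal = ‖(hu.1 s hs).toLp (u s)‖ :=
      fun s hs => (Lp.norm_toLp _ _).symm
    rw [e1 t ht, e1 t₀ ht₀, Real.dist_eq]
    refine (abs_norm_sub_norm_le _ _).trans ?_
    rw [← MemLp.toLp_sub, Lp.norm_toLp]
    rfl
  obtain ⟨C, hC⟩ := isCompact_Icc.exists_bound_of_continuousOn h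
  -- The sign of `T` is not known here; on an empty interval the bound `C` could be negative.
  refine ⟨max C 0, le_max_right _ _, fun t ht => le_trans (le_abs_self _) ?_⟩
  exact (hC t ht).trans (le_max_left _ _)

theorem ContL2.pint {β : Type*} [MeasurableSpace β] {ν : Measure β} [SFinite μ] [SFinite ν]
    {u : ℝ → α × β → ℝ} (hu : ContL2 T (μ.prod ν) u) {k : β → ℝ} (hk : MemLp k 2 ν) :
    ContL2 T μ (fun t => Strat.pint ν k (u t)) := by
  refine ⟨fun t ht => memLp_pint (hu.1 t ht) hk, fun t₀ ht₀ => ?_⟩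
  have h2 : Tendsto (fun t => eLpNorm (u t - u t₀) 2 (μ.prod ν) * eLpNorm k 2 ν)
      (𝓝[Icc 0 T] t₀) (𝓝 0) := by
    have := ENNReal.Tendsto.mul_const (b := eLpNorm k 2 ν) (hu.2 t₀ ht₀) (Or.inr hk.2.ne)
    simpa using this
  refine tendsto_of_tendsto_of_tendsto_of_le_of_le' tendsto_const_nhds h2
    (.of_forall fun _ => by simp) ?_
  filter_upwards [self_mem_nhdsWithin] with t ht
  refine le_trans (le_of_eq ?_) (eLpNorm_pint_le ((hu.1 t ht).1.sub (hu.1 t₀ ht₀).1) hk.1)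
  refine eLpNorm_congr_ae ?_
  have hh : ∀ s ∈ Icc 0 T, ∀ᵐ x ∂μ, Integrable (fun y => u s (x, y) * k y) ν := by
    intro s hs
    have h5 : AEStronglyMeasurable (u s) (μ.prod ν) := (hu.1 s hs).1
    have h6 : Integrable (fun p => u s p ^ 2) (μ.prod ν) := (hu.1 s hs).integrable_sq
    filter_upwards [h5.prodMk_left, h6.prod_right_ae] with x hx1 hx2
    exact ((memLp_two_iff_integrable_sq hx1).2 hx2).integrable_mul hk
  filter_upwards [hh t ht, hh t₀ ht₀] with x h1 h2
  simp only [Strat.pint, Pi.sub_apply, sub_mul]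
  rw [integral_sub h1 h2]

/-- Integrated in time against a family of test functions with a separated variable, a path in
`L²` is represented by a square integrable function of that variable. -/
theorem ContL2.exists_repr {β : Type*} [MeasurableSpace β] {ν : Measure β} [SFinite μ] [SFinite ν]
    {u : ℝ → α × β → ℝ} (hu : ContL2 T (μ.prod ν) u) {η : ℝ → α → ℝ} {G : α → ℝ}
    (hη : TestFamily μ η G) : ∃ r : β → ℝ, MemLp r 2 ν ∧ ∀ k : β → ℝ, MemLp k 2 ν →
      (∫ t in Ioo 0 T, ∫ x, u t x * (η t x.1 * k x.2) ∂(μ.prod ν) = ∫ y, r y * k y ∂ν) ∧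
      ∫ t in Ioo 0 T, ∫ x, Strat.pint ν k (u t) x * η t x ∂μ = ∫ y, r y * k y ∂ν := by
  have hfam : ∀ k : β → ℝ, MemLp k 2 ν →
      TestFamily (μ.prod ν) (fun t x => η t x.1 * k x.2) (fun x => G x.1 * |k x.2|) := by
    intro k hk
    refine ⟨memLp_mul_prod hη.memLp hk.abs, fun t => (hη.meas t).comp_fst.mul hk.1.comp_snd,
      fun t x => ?_, fun x => (hη.cont x.1).mul continuous_const⟩
    rw [abs_mul]
    exact mul_le_mul_of_nonneg_right (hη.le t x.1) (abs_nonneg _)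
  obtain ⟨C, hC0, hC⟩ := hu.exists_bound
  -- `J` depends only on the class of `k` modulo null sets, is linear, and is bounded for the
  -- `L²(ν)` norm: `C` controls `u t`, `G` controls `η t`, and the time interval has finite length.
  -- Hence it descends to a continuous functional on `L²(ν)`.
  let J : (β → ℝ) → ℝ := fun k => ∫ t in Ioo 0 T, ∫ x, u t x * (η t x.1 * k x.2) ∂(μ.prod ν)
  have hcongr : ∀ k k' : β → ℝ, k =ᵐ[ν] k' → J k = J k' := by
    intro k k' h
    have h' : ∀ᵐ x ∂(μ.prod ν), k x.2 = k' x.2 := Measure.quasiMeasurePreserving_snd.ae h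
    refine integral_congr_ae (.of_forall fun t => integral_congr_ae ?_)
    filter_upwards [h'] with x hx
    rw [hx]
  have hint : ∀ k, MemLp k 2 ν → ∀ t ∈ Ioo 0 T,
      Integrable (fun x => u t x * (η t x.1 * k x.2)) (μ.prod ν) := fun k hk t ht =>
    integrable_mul_mul (hu.1 t (Ioo_subset_Icc_self ht)) (hη.memLp' t) hk
  have hadd : ∀ k k', MemLp k 2 ν → MemLp k' 2 ν → J (k + k') = J k + J k' := by
    intro k k' hk hk'
    simp only [J]
    rw [← integral_add (hu.integrableOn_integral (hfam k hk))
      (hu.integrableOn_integral (hfam k' hk'))]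
    refine setIntegral_congr_fun measurableSet_Ioo fun t ht => ?_
    rw [← integral_add (hint k hk t ht) (hint k' hk' t ht)]
    refine integral_congr_ae (.of_forall fun x => ?_)
    simp only [Pi.add_apply]; ring
  have hsmul : ∀ (a : ℝ) (k), J (a • k) = a * J k := by
    intro a k
    simp only [J]
    simp_rw [← integral_const_mul]
    refine integral_congr_ae (.of_forall fun t => integral_congr_ae (.of_forall fun x => ?_))
    simp only [Pi.smul_apply, smul_eq_mul]; ring
  have hbound : ∀ k (hk : MemLp k 2 ν),
      ‖J k‖ ≤ (C * (eLpNorm G 2 μ).toReal * (volume.real (Ioo 0 T))) * ‖hk.toLp k‖ := by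
    intro k hk
    rw [Lp.norm_toLp]
    have := norm_setIntegral_le_of_norm_le_const (μ := volume) (s := Ioo 0 T)
      (f := fun t => ∫ x, u t x * (η t x.1 * k x.2) ∂(μ.prod ν))
      (C := C * ((eLpNorm G 2 μ).toReal * (eLpNorm k 2 ν).toReal)) (by simp) (fun t ht => ?_)
    · calc ‖J k‖ ≤ _ := this
        _ = _ := by ring
    · have ht' := Ioo_subset_Icc_self ht
      rw [← integral_pint_mul (hint k hk t ht)]
      have h1 := enorm_integral_mul_le (memLp_pint (hu.1 t ht') hk).1 (hη.meas t)
      have h2 := h1.trans (mul_le_mul' (eLpNorm_pint_le (hu.1 t ht').1 hk.1) (hη.eLpNorm_le t))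
      rw [← toReal_enorm]
      refine (ENNReal.toReal_mono (ENNReal.mul_ne_top (ENNReal.mul_ne_top (hu.1 t ht').2.ne
        hk.2.ne) hη.memLp.2.ne) h2).trans ?_
      rw [ENNReal.toReal_mul, ENNReal.toReal_mul]
      have h3 := hC t ht'
      have h4 : 0 ≤ (eLpNorm k 2 ν).toReal * (eLpNorm G 2 μ).toReal := by positivity
      nlinarith
  let L : Lp ℝ 2 ν →ₗ[ℝ] ℝ :=
    { toFun := fun k => J k
      map_add' := fun k k' => by
        rw [hcongr _ _ (Lp.coeFn_add k k'), hadd _ _ (Lp.memLp k) (Lp.memLp k')]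
      map_smul' := fun a k => by
        rw [hcongr _ _ (Lp.coeFn_smul a k), hsmul]; rfl }
  let L' : StrongDual ℝ (Lp ℝ 2 ν) := L.mkContinuous
    (C * (eLpNorm G 2 μ).toReal * (volume.real (Ioo 0 T))) (fun k => by
      have := hbound k (Lp.memLp k)
      rwa [Lp.toLp_coeFn] at this)
  -- Riesz representation of the functional.
  let r := (InnerProductSpace.toDual ℝ (Lp ℝ 2 ν)).symm L'
  refine ⟨r, Lp.memLp r, fun k hk => ?_⟩
  have h1 : J k = ∫ y, r y * k y ∂ν := by
    have h2 : inner ℝ r (hk.toLp k) = L' (hk.toLp k) :=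
      InnerProductSpace.toDual_symm_apply
    have h3 : L' (hk.toLp k) = J k := hcongr _ _ hk.coeFn_toLp
    rw [← h3, ← h2, L2.inner_def]
    refine integral_congr_ae ?_
    filter_upwards [hk.coeFn_toLp] with y hy
    rw [hy]; simp [mul_comm]
  refine ⟨h1, ?_⟩
  rw [← h1]
  exact setIntegral_congr_fun measurableSet_Ioo fun t ht => integral_pint_mul (hint k hk t ht)

end paths

end Strat

end

noncomputable section

namespace Strat

/-! ### Absolutely continuous functions and weak derivatives on the vertical interval -/

instance (H : ℝ) : IsFiniteMeasure (vertMeasure H) := by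
  unfold vertMeasure; infer_instance

theorem stripMeasure_eq (d : ℕ) (H : ℝ) :
    stripMeasure d H = (volume : Measure (Hor d)).prod (vertMeasure H) := by
  rw [stripMeasure, vertMeasure, Measure.volume_eq_prod, ← Measure.prod_restrict,
    Measure.restrict_univ]

theorem ae_vert_mem (H : ℝ) : ∀ᵐ z ∂(vertMeasure H), z ∈ Ioo (-H) 0 :=
  ae_restrict_mem measurableSet_Ioo

theorem integral_vert {H : ℝ} (hH : 0 < H) (a : ℝ → ℝ) :
    ∫ z, a z ∂(vertMeasure H) = ∫ z in (-H)..0, a z := by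
  rw [intervalIntegral.integral_of_le (by linarith), integral_Ioc_eq_integral_Ioo]; rfl

theorem intervalIntegrable_of_vert {H : ℝ} (hH : 0 < H) {a : ℝ → ℝ}
    (ha : Integrable a (vertMeasure H)) : IntervalIntegrable a volume (-H) 0 := by
  rw [intervalIntegrable_iff_integrableOn_Ioo_of_le (by linarith)]; exact ha

theorem ae_vert_of_continuousOn {H : ℝ} {F : ℝ → ℝ} (hF : ContinuousOn F (Icc (-H) 0)) :
    AEStronglyMeasurable F (vertMeasure H) :=
  (hF.mono Ioo_subset_Icc_self).aestronglyMeasurable measurableSet_Ioo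

/-- A function that vanishes against all test functions vanishes. -/
theorem ae_eq_zero_of_forall_test {H : ℝ} {R : ℝ → ℝ} (hR : Integrable R (vertMeasure H))
    (h : ∀ χ, IsTest (Ioo (-H) 0) χ → ∫ z, R z * χ z ∂(vertMeasure H) = 0) :
    R =ᵐ[vertMeasure H] 0 := by
  have h1 := isOpen_Ioo.ae_eq_zero_of_integral_contDiff_smul_eq_zero (μ := volume)
    (IntegrableOn.locallyIntegrableOn hR) (fun χ h1 h2 h3 => by
      have h4 := h χ ⟨h1, h2, h3⟩
      rw [vertMeasure, setIntegral_eq_integral_of_forall_compl_eq_zero] at h4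
      · simpa [mul_comm] using h4
      · intro x hx
        rw [image_eq_zero_of_notMem_tsupport (fun hx' => hx (h3 hx')), mul_zero])
  exact (ae_restrict_iff' measurableSet_Ioo).2 h1

/-- `F` is absolutely continuous on `[-H, 0]`, with derivative `a`. -/
structure Prim (H : ℝ) (F a : ℝ → ℝ) : Prop where
  ac : AbsolutelyContinuousOnInterval F (-H) 0
  deriv : ∀ᵐ z ∂(vertMeasure H), HasDerivAt F (a z) z

section prim

variable {H : ℝ} {F G a b : ℝ → ℝ}

theorem Prim.continuousOn (hH : 0 < H) (h : Prim H F a) : ContinuousOn F (Icc (-H) 0) := by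
  have := h.ac.continuousOn
  rwa [uIcc_of_le (by linarith)] at this

theorem Prim.ae_deriv (h : Prim H F a) : _root_.deriv F =ᵐ[vertMeasure H] a := by
  filter_upwards [h.deriv] with z hz using hz.deriv

theorem Prim.ibp (hH : 0 < H) (hF : Prim H F a) (hG : Prim H G b) :
    ∫ z, F z * b z ∂(vertMeasure H) =
      F 0 * G 0 - F (-H) * G (-H) - ∫ z, a z * G z ∂(vertMeasure H) := by
  have h := hF.ac.integral_mul_deriv_eq_deriv_mul hG.ac
  rw [← integral_vert hH, ← integral_vert hH] at h
  rw [integral_congr_ae (g := fun z => F z * b z)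
      (by filter_upwards [hG.ae_deriv] with z hz; rw [hz]),
    integral_congr_ae (f := fun z => _root_.deriv F z * G z) (g := fun z => a z * G z)
      (by filter_upwards [hF.ae_deriv] with z hz; rw [hz])] at h
  exact h

theorem prim_integral (hH : 0 < H) (ha : Integrable a (vertMeasure H)) (C : ℝ) :
    Prim H (fun z => C + ∫ y in (-H)..z, a y) a := by
  have hi := intervalIntegrable_of_vert hH ha
  constructor
  · have h1 := hi.absolutelyContinuousOnInterval_intervalIntegral (c := -H) left_mem_uIcc
    have h2 : AbsolutelyContinuousOnInterval (fun _ : ℝ => C) (-H) 0 :=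
      (LipschitzWith.const C).lipschitzOnWith.absolutelyContinuousOnInterval
    exact h2.add h1
  · rw [vertMeasure, ae_restrict_iff' measurableSet_Ioo]
    filter_upwards [hi.ae_hasDerivAt_integral] with z hz hzm
    have hz1 : z ∈ uIcc (-H) 0 := by
      rw [uIcc_of_le (by linarith)]; exact Ioo_subset_Icc_self hzm
    exact (hz hz1 (-H) left_mem_uIcc).const_add C

theorem prim_of_contDiff {χ : ℝ → ℝ} (hχ : ContDiff ℝ ∞ χ) : Prim H χ (_root_.deriv χ) := by
  constructor
  · have h1 : ContDiff ℝ 1 χ := hχ.of_le (by norm_cast)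
    obtain ⟨K, hK⟩ := h1.contDiffOn.exists_lipschitzOnWith (s := uIcc (-H) 0) (by simp)
      (convex_uIcc _ _) isCompact_uIcc
    exact hK.absolutelyContinuousOnInterval
  · exact .of_forall fun z => (hχ.differentiable (by simp) z).hasDerivAt

end prim

theorem exists_test_integral_eq_one {H : ℝ} (hH : 0 < H) :
    ∃ η, IsTest (Ioo (-H) 0) η ∧ ∫ z, η z = 1 := by
  let β : ContDiffBump (-H / 2) := ⟨H / 8, H / 4, by linarith, by linarith⟩
  refine ⟨β.normed volume, ⟨β.contDiff_normed, β.hasCompactSupport_normed, ?_⟩,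
    β.integral_normed⟩
  rw [β.tsupport_normed_eq, Real.closedBall_eq_Icc]
  have : β.rOut = H / 4 := rfl
  rw [this]
  exact Icc_subset_Ioo (by linarith) (by linarith)

theorem IsTest.eq_zero {F : Type*} [NormedAddCommGroup F] [NormedSpace ℝ F] {O : Set F}
    {φ : F → ℝ} (h : IsTest O φ) {x : F} (hx : x ∉ O) : φ x = 0 :=
  image_eq_zero_of_notMem_tsupport fun hx' => hx (h.2.2 hx')

theorem integral_vert_of_test {H : ℝ} {φ : ℝ → ℝ} (h : IsTest (Ioo (-H) 0) φ) :
    ∫ z, φ z ∂(vertMeasure H) = ∫ z, φ z := by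
  rw [vertMeasure, setIntegral_eq_integral_of_forall_compl_eq_zero]
  exact fun x hx => h.eq_zero hx

/-- A test function with vanishing integral is the derivative of a test function. -/
theorem exists_test_primitive {H : ℝ} {φ : ℝ → ℝ} (h : IsTest (Ioo (-H) 0) φ)
    (h0 : ∫ z, φ z = 0) : ∃ χ, IsTest (Ioo (-H) 0) χ ∧ deriv χ = φ := by
  have hc : Continuous φ := h.1.continuous
  have hd : ∀ z, HasDerivAt (fun z => ∫ y in (-H)..z, φ y) (φ z) z := fun z =>
    intervalIntegral.integral_hasDerivAt_right (hc.intervalIntegrable _ _)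
      hc.aestronglyMeasurable.stronglyMeasurableAtFilter hc.continuousAt
  -- The primitive based at `-H` is the candidate. The least and greatest points `p`, `q` of the
  -- support exist only if it is nonempty, hence the separate case.
  have hd' : deriv (fun z => ∫ y in (-H)..z, φ y) = φ := funext fun z => (hd z).deriv
  rcases (tsupport φ).eq_empty_or_nonempty with he | hne
  · rw [tsupport_eq_empty_iff] at he
    exact ⟨0, ⟨contDiff_const, HasCompactSupport.zero, by simp [tsupport]⟩, by ext; simp [he]⟩
  obtain ⟨p, hp, hpl⟩ := IsCompact.exists_isLeast h.2.1 hne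
  obtain ⟨q, hq, hql⟩ := IsCompact.exists_isGreatest h.2.1 hne
  have hz : ∀ z, z ∉ Icc p q → φ z = 0 := fun z hz =>
    image_eq_zero_of_notMem_tsupport fun hz' => hz ⟨hpl hz', hql hz'⟩
  have hp' := h.2.2 hp
  have hq' := h.2.2 hq
  -- To the left of `p` the integrand vanishes; to the right of `q` the integral is already the
  -- total one, which is zero.
  have hsupp : ∀ z, z ∉ Icc p q → ∫ y in (-H)..z, φ y = 0 := by
    intro z hzn
    by_cases hzp : z < p
    · rw [intervalIntegral.integral_zero_ae]
      refine .of_forall fun y hy => hz y fun hy' => ?_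
      rcases le_total (-H) z with hle | hle
      · rw [uIoc_of_le hle] at hy; linarith [hy.2, hy'.1]
      · rw [uIoc_of_ge hle] at hy; linarith [hy.2, hy'.1, hp'.1]
    · have hqz : q < z := by
        by_contra hqz
        exact hzn ⟨not_lt.1 hzp, not_lt.1 hqz⟩
      rw [intervalIntegral.integral_of_le (by linarith [hq'.1]),
        setIntegral_eq_integral_of_forall_compl_eq_zero, h0]
      intro y hy
      refine hz y fun hy' => hy ⟨?_, ?_⟩
      · linarith [hp'.1, hy'.1]
      · linarith [hy'.2]
  have hts : tsupport (fun z => ∫ y in (-H)..z, φ y) ⊆ Icc p q := by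
    refine closure_minimal (fun z hz' => ?_) isClosed_Icc
    by_contra hzn
    exact hz' (hsupp z hzn)
  refine ⟨fun z => ∫ y in (-H)..z, φ y, ⟨?_, ?_, ?_⟩, hd'⟩
  · rw [contDiff_infty_iff_deriv, hd']
    exact ⟨fun z => (hd z).differentiableAt, h.1⟩
  · exact HasCompactSupport.of_support_subset_isCompact isCompact_Icc
      ((subset_tsupport _).trans hts)
  · exact hts.trans (Icc_subset_Ioo hp'.1 hq'.2)

theorem Integrable.mul_test {H : ℝ} {A χ : ℝ → ℝ} (hA : Integrable A (vertMeasure H))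
    (hχ : Continuous χ) : Integrable (fun z => A z * χ z) (vertMeasure H) := by
  obtain ⟨C, hC⟩ := (isCompact_Icc (a := -H) (b := 0)).exists_bound_of_continuousOn
    hχ.continuousOn
  refine hA.mul_bdd (c := C) hχ.aestronglyMeasurable ?_
  filter_upwards [ae_vert_mem H] with z hz using hC z (Ioo_subset_Icc_self hz)

/-- If the weak derivative of `B` is `A`, then `B` is a primitive of `A`. -/
theorem eq_primitive_of_weak_deriv {H : ℝ} (hH : 0 < H) {A B : ℝ → ℝ}
    (hA : Integrable A (vertMeasure H)) (hB : Integrable B (vertMeasure H))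
    (h : ∀ χ, IsTest (Ioo (-H) 0) χ →
      ∫ z, A z * χ z ∂(vertMeasure H) + ∫ z, B z * deriv χ z ∂(vertMeasure H) = 0) :
    ∃ C, B =ᵐ[vertMeasure H] fun z => C + ∫ y in (-H)..z, A y := by
  obtain ⟨η, hη, hη1⟩ := exists_test_integral_eq_one hH
  -- Du Bois-Reymond: `F` is one primitive of `A`, so `B - F` has zero weak derivative and must be a
  -- constant. The summand `0` matches the form of `prim_integral`.
  set F : ℝ → ℝ := fun z => 0 + ∫ y in (-H)..z, A y with hF
  have hP : Prim H F A := prim_integral hH hA 0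
  have hFi : Integrable F (vertMeasure H) := by
    have := (hP.continuousOn hH).integrableOn_compact (μ := volume) isCompact_Icc
    exact this.mono_set Ioo_subset_Icc_self
  have hD : Integrable (fun z => B z - F z) (vertMeasure H) := hB.sub hFi
  have key : ∀ χ, IsTest (Ioo (-H) 0) χ →
      ∫ z, (B z - F z) * deriv χ z ∂(vertMeasure H) = 0 := by
    intro χ hχ
    have h1 := hP.ibp hH (prim_of_contDiff (H := H) hχ.1)
    have h2 := h χ hχ
    have hdc : Continuous (deriv χ) := hχ.1.continuous_deriv (by simp)
    simp_rw [sub_mul]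
    rw [integral_sub (Integrable.mul_test hB hdc) (Integrable.mul_test hFi hdc), h1,
      hχ.eq_zero (x := 0) (by simp), hχ.eq_zero (x := -H) (by simp)]
    linarith
  -- As `η` has integral one, the constant value of `B - F` can only be its average against `η`.
  set C := ∫ z, (B z - F z) * η z ∂(vertMeasure H) with hC
  refine ⟨C, ?_⟩
  have h3 : (fun z => B z - F z - C) =ᵐ[vertMeasure H] 0 := by
    refine ae_eq_zero_of_forall_test (hD.sub (integrable_const C)) fun φ hφ => ?_
    have hφi : ∀ {φ : ℝ → ℝ}, IsTest (Ioo (-H) 0) φ → Integrable φ (volume : Measure ℝ) :=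
      fun hφ => hφ.1.continuous.integrable_of_hasCompactSupport hφ.2.1
    -- Subtracting this multiple of `η` makes the integral vanish, so the result is the derivative
    -- of a test function.
    have htest : IsTest (Ioo (-H) 0) (fun z => φ z - (∫ y, φ y) * η z) := by
      refine ⟨hφ.1.sub (contDiff_const.mul hη.1), ?_, ?_⟩
      · exact hφ.2.1.sub (hη.2.1.mul_left (f := fun _ => ∫ y, φ y))
      · refine (tsupport_sub _ _).trans (union_subset hφ.2.2 ?_)
        exact (tsupport_mul_subset_right (f := fun _ => ∫ y, φ y)).trans hη.2.2
    obtain ⟨χ, hχ, hχd⟩ := exists_test_primitive htest (by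
      rw [integral_sub (hφi hφ) ((hφi hη).const_mul _), integral_const_mul, hη1]; ring)
    have h4 := key χ hχ
    rw [hχd] at h4
    have e1 : ∀ z, (B z - F z) * (φ z - (∫ y, φ y) * η z)
      = (B z - F z) * φ z - (∫ y, φ y) * ((B z - F z) * η z) := fun z => by ring
    simp_rw [e1] at h4
    rw [integral_sub (Integrable.mul_test hD hφ.1.continuous)
      ((Integrable.mul_test hD hη.1.continuous).const_mul _), integral_const_mul, ← hC] at h4
    have e2 : ∀ z, (B z - F z - C) * φ z = (B z - F z) * φ z - C * φ z := fun z => by ring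
    simp_rw [e2]
    rw [integral_sub (Integrable.mul_test hD hφ.1.continuous)
      ((hφi hφ).restrict.const_mul _), integral_const_mul, integral_vert_of_test hφ]
    linarith
  filter_upwards [h3] with z hz
  simp only [hF, Pi.zero_apply] at hz ⊢
  linarith

/-- If `B' = A` weakly up to the boundary of the interval, then `B` vanishes at the boundary. -/
theorem eq_primitive_of_weak_deriv_boundary {H : ℝ} (hH : 0 < H) {A B : ℝ → ℝ}
    (hA : Integrable A (vertMeasure H)) (hB : Integrable B (vertMeasure H))
    (h : ∀ χ : ℝ → ℝ, ContDiff ℝ ∞ χ → HasCompactSupport χ →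
      ∫ z, A z * χ z ∂(vertMeasure H) + ∫ z, B z * deriv χ z ∂(vertMeasure H) = 0) :
    (B =ᵐ[vertMeasure H] fun z => ∫ y in (-H)..z, A y) ∧ ∫ z, A z ∂(vertMeasure H) = 0 := by
  obtain ⟨C, hC⟩ := eq_primitive_of_weak_deriv hH hA hB fun χ hχ => h χ hχ.1 hχ.2.1
  -- This cutoff equals one near every point of `(-H, 0)`, so the support condition on `χ` can be
  -- dropped and `χ` can be a polynomial.
  let β : ContDiffBump (0 : ℝ) := ⟨H + 1, H + 2, by linarith, by linarith⟩
  have hβ1 : ∀ z ∈ Ioo (-H) 0, β =ᶠ[𝓝 z] fun _ => 1 := fun z hz =>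
    β.eventuallyEq_one_of_mem_ball (by
      rw [Metric.mem_ball, Real.dist_eq, sub_zero, abs_of_neg hz.2]
      show -z < H + 1
      linarith [hz.1])
  have hint : ∀ χ : ℝ → ℝ, ContDiff ℝ ∞ χ →
      ∫ z, A z * χ z ∂(vertMeasure H) + ∫ z, B z * deriv χ z ∂(vertMeasure H) = 0 := by
    intro χ hχ
    have h1 := h (fun z => χ z * β z) (hχ.mul β.contDiff)
      (β.hasCompactSupport.mul_left (f := χ))
    rw [← h1]
    congr 1
    · refine integral_congr_ae ?_
      filter_upwards [ae_vert_mem H] with z hz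
      rw [(hβ1 z hz).eq_of_nhds, mul_one]
    · refine integral_congr_ae ?_
      filter_upwards [ae_vert_mem H] with z hz
      have : (fun z => χ z * β z) =ᶠ[𝓝 z] χ := by
        filter_upwards [hβ1 z hz] with y hy
        rw [hy, mul_one]
      rw [this.deriv_eq]
  have h1 : ∫ z, A z ∂(vertMeasure H) = 0 := by
    -- Testing with `1` gives zero mean for `A`.
    have := hint (fun _ => 1) contDiff_const
    simpa using this
  have hP := prim_integral hH hA C
  have h2 : C = 0 := by
    -- Testing with `z` isolates the constant: after integration by parts only `C * H = 0` remains.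
    have h3 := hint (fun z => z) contDiff_id
    have h4 := hP.ibp hH (prim_of_contDiff (H := H) (χ := fun z => z) contDiff_id)
    have h5 : ∫ z, B z * deriv (fun z => z) z ∂(vertMeasure H)
        = ∫ z, (C + ∫ y in (-H)..z, A y) * deriv (fun z => z) z ∂(vertMeasure H) := by
      refine integral_congr_ae ?_
      filter_upwards [hC] with z hz
      rw [hz]
    rw [h5, h4] at h3
    simp at h3
    exact h3.resolve_right hH.ne'
  subst h2
  exact ⟨by simpa using hC, h1⟩

end Strat

end

noncomputable section

namespace Strat

/-! ### Bounded functions of the vertical variable -/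

/-- `k` is measurable and essentially bounded on `(-H, 0)`. -/
def BddVert (H : ℝ) (k : ℝ → ℝ) : Prop :=
  AEStronglyMeasurable k (vertMeasure H) ∧ ∃ C, ∀ᵐ z ∂(vertMeasure H), |k z| ≤ C

section bdd

variable {H : ℝ} {k l : ℝ → ℝ}

theorem BddVert.mul (hk : BddVert H k) (hl : BddVert H l) : BddVert H fun z => k z * l z := by
  obtain ⟨hk1, C, hC⟩ := hk
  obtain ⟨hl1, D, hD⟩ := hl
  refine ⟨hk1.mul hl1, C * D, ?_⟩
  filter_upwards [hC, hD] with z h1 h2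
  rw [abs_mul]
  exact mul_le_mul h1 h2 (abs_nonneg _) ((abs_nonneg _).trans h1)

theorem BddVert.const_mul (hk : BddVert H k) (a : ℝ) : BddVert H fun z => a * k z :=
  BddVert.mul ⟨aestronglyMeasurable_const, |a|, .of_forall fun _ => le_rfl⟩ hk

theorem BddVert.congr (hk : BddVert H k) (h : k =ᵐ[vertMeasure H] l) : BddVert H l := by
  obtain ⟨h1, C, hC⟩ := hk
  refine ⟨h1.congr h, C, ?_⟩
  filter_upwards [hC, h] with z h2 h3
  rwa [← h3]

theorem bddVert_of_continuousOn (hk : ContinuousOn k (Icc (-H) 0)) : BddVert H k := by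
  refine ⟨ae_vert_of_continuousOn hk, ?_⟩
  obtain ⟨C, hC⟩ := isCompact_Icc.exists_bound_of_continuousOn hk
  refine ⟨C, ?_⟩
  filter_upwards [ae_vert_mem H] with z hz using hC z (Ioo_subset_Icc_self hz)

theorem Prim.bddVert (hH : 0 < H) {F a : ℝ → ℝ} (h : Prim H F a) : BddVert H F :=
  bddVert_of_continuousOn (h.continuousOn hH)

theorem BddVert.memLp (hk : BddVert H k) {p : ℝ≥0∞} : MemLp k p (vertMeasure H) := by
  obtain ⟨h1, C, hC⟩ := hk
  exact MemLp.of_bound h1 C hC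

theorem BddVert.integrable (hk : BddVert H k) : Integrable k (vertMeasure H) :=
  memLp_one_iff_integrable.1 hk.memLp

theorem BddVert.integrable_mul (hk : BddVert H k) {A : ℝ → ℝ} (hA : Integrable A (vertMeasure H)) :
    Integrable (fun z => A z * k z) (vertMeasure H) := by
  obtain ⟨h1, C, hC⟩ := hk
  exact hA.mul_bdd h1 hC

theorem BddVert.memLp_mul (hk : BddVert H k) {A : ℝ → ℝ} (hA : MemLp A 2 (vertMeasure H)) :
    MemLp (fun z => A z * k z) 2 (vertMeasure H) := by
  obtain ⟨h1, C, hC⟩ := hk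
  refine (hA.const_mul C).mono (hA.1.mul h1) ?_
  filter_upwards [hC] with z h2
  rw [norm_mul, Real.norm_eq_abs (k z), norm_mul, mul_comm]
  exact mul_le_mul_of_nonneg_right (h2.trans (le_abs_self C)) (norm_nonneg _)

end bdd

theorem integrable_of_memLp_two {H : ℝ} {A : ℝ → ℝ} (hA : MemLp A 2 (vertMeasure H)) :
    Integrable A (vertMeasure H) := hA.integrable (by norm_num)

/-! ### The stratification -/

/-- The assumptions on the stratification. -/
structure IsStratified (H g : ℝ) (ρeq : ℝ → ℝ) : Prop where
  hH : 0 < H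
  hg : 0 < g
  lip : ∃ K, LipschitzOnWith K ρeq (Icc (-H) 0)
  pos : ∃ ρmin > 0, ∀ z ∈ Icc (-H) 0, ρmin ≤ ρeq z
  stable : ∀ᵐ z ∂(vertMeasure H), 0 < bruntSq g ρeq z

section stratified

variable {H g : ℝ} {ρeq : ℝ → ℝ}

theorem IsStratified.continuousOn (h : IsStratified H g ρeq) : ContinuousOn ρeq (Icc (-H) 0) := by
  obtain ⟨K, hK⟩ := h.lip
  exact hK.continuousOn

theorem IsStratified.pos' (h : IsStratified H g ρeq) {z : ℝ} (hz : z ∈ Icc (-H) 0) :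
    0 < ρeq z := by
  obtain ⟨r, hr, h1⟩ := h.pos
  exact hr.trans_le (h1 z hz)

theorem IsStratified.ae_pos (h : IsStratified H g ρeq) :
    ∀ᵐ z ∂(vertMeasure H), 0 < ρeq z := by
  filter_upwards [ae_vert_mem H] with z hz using h.pos' (Ioo_subset_Icc_self hz)

theorem IsStratified.bdd (h : IsStratified H g ρeq) : BddVert H ρeq :=
  bddVert_of_continuousOn h.continuousOn

theorem IsStratified.continuousOn_inv (h : IsStratified H g ρeq) :
    ContinuousOn (fun z => (ρeq z)⁻¹) (Icc (-H) 0) :=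
  h.continuousOn.inv₀ fun _ hz => (h.pos' hz).ne'

theorem IsStratified.bdd_deriv (h : IsStratified H g ρeq) : BddVert H (deriv ρeq) := by
  refine ⟨(measurable_deriv ρeq).aestronglyMeasurable, ?_⟩
  obtain ⟨K, hK⟩ := h.lip
  refine ⟨K, ?_⟩
  filter_upwards [ae_vert_mem H] with z hz
  exact norm_deriv_le_of_lipschitzOn (Icc_mem_nhds hz.1 hz.2) hK

theorem IsStratified.weight_eq (h : IsStratified H g ρeq) :
    ∀ᵐ z ∂(vertMeasure H), ρeq z * bruntSq g ρeq z = -g * deriv ρeq z := by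
  filter_upwards [h.ae_pos] with z hz
  rw [bruntSq]
  field_simp

theorem IsStratified.bdd_weight (h : IsStratified H g ρeq) :
    BddVert H fun z => ρeq z * bruntSq g ρeq z :=
  (h.bdd_deriv.const_mul (-g)).congr (by
    filter_upwards [h.weight_eq] with z hz using hz.symm)

theorem IsStratified.weight_pos (h : IsStratified H g ρeq) :
    ∀ᵐ z ∂(vertMeasure H), 0 < ρeq z * bruntSq g ρeq z := by
  filter_upwards [h.ae_pos, h.stable] with z h1 h2 using mul_pos h1 h2

theorem IsStratified.aemeasurable_weight (h : IsStratified H g ρeq) :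
    AEMeasurable (fun z => ENNReal.ofReal (ρeq z * bruntSq g ρeq z)) (vertMeasure H) :=
  h.bdd_weight.1.aemeasurable.ennreal_ofReal

theorem IsStratified.integral_weight (h : IsStratified H g ρeq) (a : ℝ → ℝ) :
    ∫ z, a z ∂(weightMeasure H g ρeq)
      = ∫ z, a z * (ρeq z * bruntSq g ρeq z) ∂(vertMeasure H) := by
  rw [weightMeasure, integral_withDensity_eq_integral_toReal_smul₀ h.aemeasurable_weight
    (.of_forall fun _ => ENNReal.ofReal_lt_top)]
  refine integral_congr_ae ?_
  filter_upwards [h.weight_pos] with z hz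
  rw [ENNReal.toReal_ofReal hz.le, smul_eq_mul, mul_comm]

/-- Positivity of `N²` almost everywhere gives both measures the same null sets. This is what
converts vanishing in `L²(ρ_eq N² dz)` into vanishing almost everywhere on `(-H, 0)`. -/
theorem IsStratified.ae_weight_iff (h : IsStratified H g ρeq) {p : ℝ → Prop} :
    (∀ᵐ z ∂(weightMeasure H g ρeq), p z) ↔ ∀ᵐ z ∂(vertMeasure H), p z := by
  rw [weightMeasure, ae_withDensity_iff' h.aemeasurable_weight]
  constructor
  · intro h1
    filter_upwards [h1, h.weight_pos] with z h2 h3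
    exact h2 (by simpa using h3)
  · intro h1
    filter_upwards [h1] with z h2 _ using h2

theorem IsStratified.memLp_weight (h : IsStratified H g ρeq) {k : ℝ → ℝ} (hk : BddVert H k) :
    MemLp k 2 (weightMeasure H g ρeq) := by
  obtain ⟨h1, C, hC⟩ := hk
  have hfin : IsFiniteMeasure (weightMeasure H g ρeq) := by
    refine isFiniteMeasure_withDensity_ofReal ?_
    exact (h.bdd_weight.integrable).2
  exact MemLp.of_bound (h1.mono_ac (withDensity_absolutelyContinuous _ _)) C
    (h.ae_weight_iff.2 hC)

/-! ### The modes -/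

variable {c : ℕ → ℝ} {f : ℕ → ℝ → ℝ} {n m : ℕ}

/-- The flux `ρ_eq f_n'`. -/
def flux (H : ℝ) (ρeq : ℝ → ℝ) (f : ℕ → ℝ → ℝ) (n : ℕ) (z : ℝ) : ℝ :=
  ρeq z * derivWithin (f n) (Icc (-H) 0) z

theorem IsModes.prim_flux (hm : IsModes H g ρeq c f) (hn : 1 ≤ n) :
    Prim H (flux H ρeq f n) (fun z => -(ρeq z * bruntSq g ρeq z / c n ^ 2 * f n z)) :=
  ⟨(hm.eigen n hn).flux_ac, (hm.eigen n hn).eqn⟩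

theorem IsModes.hasDerivAt (hm : IsModes H g ρeq c f) (hn : 1 ≤ n) {z : ℝ}
    (hz : z ∈ Ioo (-H) 0) : HasDerivAt (f n) (derivWithin (f n) (Icc (-H) 0) z) z := by
  rw [derivWithin_of_mem_nhds (Icc_mem_nhds hz.1 hz.2)]
  exact ((hm.eigen n hn).diff.differentiableAt (Icc_mem_nhds hz.1 hz.2)).hasDerivAt

/-- The derivative is the flux, which is absolutely continuous, divided by the continuous positive
function `ρ_eq`. Boundedness of the modes `g_n` follows from this. -/
theorem IsModes.continuousOn_deriv (h : IsStratified H g ρeq) (hm : IsModes H g ρeq c f)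
    (hn : 1 ≤ n) : ContinuousOn (derivWithin (f n) (Icc (-H) 0)) (Icc (-H) 0) := by
  refine (h.continuousOn_inv.mul ((hm.prim_flux hn).continuousOn h.hH)).congr fun z hz => ?_
  have := (h.pos' hz).ne'
  change _ = (ρeq z)⁻¹ * (ρeq z * _)
  field_simp

theorem IsModes.prim (h : IsStratified H g ρeq) (hm : IsModes H g ρeq c f) (hn : 1 ≤ n) :
    Prim H (f n) (derivWithin (f n) (Icc (-H) 0)) := by
  constructor
  · obtain ⟨C, hC⟩ := isCompact_Icc.exists_bound_of_continuousOn
      (IsModes.continuousOn_deriv h hm hn)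
    refine LipschitzOnWith.absolutelyContinuousOnInterval (K := C.toNNReal) ?_
    rw [uIcc_of_le (by linarith [h.hH])]
    refine (convex_Icc _ _).lipschitzOnWith_of_nnnorm_derivWithin_le (hm.eigen n hn).diff
      fun z hz => ?_
    rw [← NNReal.coe_le_coe, coe_nnnorm]
    exact (hC z hz).trans (Real.le_coe_toNNReal C)
  · filter_upwards [ae_vert_mem H] with z hz using hm.hasDerivAt hn hz

theorem IsModes.bdd (h : IsStratified H g ρeq) (hm : IsModes H g ρeq c f) (hn : 1 ≤ n) :
    BddVert H (f n) := (IsModes.prim h hm hn).bddVert h.hH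

theorem IsModes.gMode_eq (hm : IsModes H g ρeq c f) (hn : 1 ≤ n) :
    ∀ᵐ z ∂(vertMeasure H), gMode H ρeq c f n z = c n * derivWithin (f n) (Icc (-H) 0) z := by
  filter_upwards [ae_vert_mem H] with z hz
  rw [gMode, if_neg (by omega), (hm.hasDerivAt hn hz).deriv]

theorem gMode_zero (z : ℝ) : gMode H ρeq c f 0 z =
    (∫ y, (ρeq y)⁻¹ ∂(vertMeasure H)) ^ (-(1 / 2) : ℝ) * (ρeq z)⁻¹ := by
  rw [gMode, if_pos rfl]

theorem IsModes.bdd_gMode (h : IsStratified H g ρeq) (hm : IsModes H g ρeq c f) (n : ℕ) :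
    BddVert H (gMode H ρeq c f n) := by
  rcases Nat.eq_zero_or_pos n with rfl | hn
  · refine ((bddVert_of_continuousOn h.continuousOn_inv).const_mul _).congr
      (.of_forall fun z => (gMode_zero z).symm)
  · refine ((bddVert_of_continuousOn (IsModes.continuousOn_deriv h hm hn)).const_mul (c n)).congr ?_
    filter_upwards [hm.gMode_eq hn] with z hz using hz.symm

theorem IsModes.orthonormal (h : IsStratified H g ρeq) (hm : IsModes H g ρeq c f)
    (hn : 1 ≤ n) (hm' : 1 ≤ m) :
    ∫ z, f m z * f n z * (ρeq z * bruntSq g ρeq z) ∂(vertMeasure H) = if m = n then 1 else 0 := by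
  obtain ⟨b, hb⟩ := hm.basis
  -- The Hilbert basis is indexed from `0`, the modes from `1`.
  obtain ⟨n, rfl⟩ := Nat.exists_eq_add_of_le' hn
  obtain ⟨m, rfl⟩ := Nat.exists_eq_add_of_le' hm'
  have h1 := orthonormal_iff_ite.1 b.orthonormal m n
  rw [L2.inner_def] at h1
  rw [← h.integral_weight (fun z => f (m + 1) z * f (n + 1) z)]
  simp only [add_left_inj]
  rw [← h1]
  refine integral_congr_ae ?_
  filter_upwards [hb n, hb m] with z h2 h3
  simp [h2, h3, mul_comm]

theorem IsModes.eq_zero_of_forall (h : IsStratified H g ρeq) (hm : IsModes H g ρeq c f)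
    {A : ℝ → ℝ} (hA : BddVert H A)
    (h0 : ∀ n, 1 ≤ n → ∫ z, A z * f n z * (ρeq z * bruntSq g ρeq z) ∂(vertMeasure H) = 0) :
    A =ᵐ[vertMeasure H] 0 := by
  obtain ⟨b, hb⟩ := hm.basis
  have hA2 := h.memLp_weight hA
  have h1 : hA2.toLp A = 0 := by
    refine (b.repr.map_eq_zero_iff).1 ?_
    refine lp.ext (funext fun n => ?_)
    change b.repr _ n = 0
    rw [b.repr_apply_apply, L2.inner_def, ← h0 (n + 1) (by omega),
      ← h.integral_weight (fun z => A z * f (n + 1) z)]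
    refine integral_congr_ae ?_
    filter_upwards [hb n, hA2.coeFn_toLp] with z h2 h3
    simp [h2, h3]
  have h2 := hA2.coeFn_toLp
  rw [h1] at h2
  exact h.ae_weight_iff.1 (h2.symm.trans (Lp.coeFn_zero _ _ _))

theorem IsModes.integral_gMode (hm : IsModes H g ρeq c f)
    (hn : 1 ≤ n) (A : ℝ → ℝ) : ∫ z, A z * gMode H ρeq c f n z * ρeq z ∂(vertMeasure H)
      = c n * ∫ z, A z * flux H ρeq f n z ∂(vertMeasure H) := by
  rw [← integral_const_mul]
  refine integral_congr_ae ?_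
  filter_upwards [hm.gMode_eq hn] with z hz
  rw [hz, flux]; ring

/-- `ρ_eq g_0` is constant, so the mode zero sees only the mean in `z`. -/
theorem integral_gMode_zero (h : IsStratified H g ρeq) (A : ℝ → ℝ) :
    ∫ z, A z * gMode H ρeq c f 0 z * ρeq z ∂(vertMeasure H)
      = (∫ y, (ρeq y)⁻¹ ∂(vertMeasure H)) ^ (-(1 / 2) : ℝ) * ∫ z, A z ∂(vertMeasure H) := by
  rw [← integral_const_mul]
  refine integral_congr_ae ?_
  filter_upwards [h.ae_pos] with z hz
  rw [gMode_zero]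
  field_simp

theorem IsStratified.integral_inv_pos (h : IsStratified H g ρeq) :
    0 < ∫ y, (ρeq y)⁻¹ ∂(vertMeasure H) := by
  rw [integral_pos_iff_support_of_nonneg_ae]
  · have h1 : Ioo (-H) 0 ⊆ Function.support fun y => (ρeq y)⁻¹ := fun z hz =>
      (inv_pos.2 (h.pos' (Ioo_subset_Icc_self hz))).ne'
    refine lt_of_lt_of_le ?_ (measure_mono h1)
    rw [vertMeasure, Measure.restrict_apply_self, Real.volume_Ioo]
    simpa using h.hH
  · filter_upwards [h.ae_pos] with z hz using (inv_pos.2 hz).le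
  · exact (bddVert_of_continuousOn h.continuousOn_inv).integrable

/-- With `∫ A = 0` and `B` the primitive of `A`, `∫ A ρ_eq f_n' = c_n⁻² ∫ B f_n ρ_eq N²`. -/
theorem IsModes.integral_mul_flux (h : IsStratified H g ρeq) (hm : IsModes H g ρeq c f)
    (hn : 1 ≤ n) {A : ℝ → ℝ} (hA : Integrable A (vertMeasure H))
    (hA0 : ∫ z, A z ∂(vertMeasure H) = 0) :
    ∫ z, A z * flux H ρeq f n z ∂(vertMeasure H) = (c n ^ 2)⁻¹ *
      ∫ z, (∫ y in (-H)..z, A y) * f n z * (ρeq z * bruntSq g ρeq z) ∂(vertMeasure H) := by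
  have hP := prim_integral h.hH hA 0
  have h1 := hP.ibp h.hH (hm.prim_flux hn)
  rw [integral_vert h.hH] at hA0
  -- The boundary terms disappear because the primitive of `A` vanishes at both ends; the flux
  -- itself need not.
  simp only [zero_add, hA0, intervalIntegral.integral_same, zero_mul, sub_zero] at h1
  rw [zero_sub] at h1
  rw [← neg_neg (∫ z, A z * flux H ρeq f n z ∂(vertMeasure H)), ← h1, ← integral_neg,
    ← integral_const_mul]
  refine integral_congr_ae (.of_forall fun z => ?_)
  simp only
  ring

/-- For positive indices, integration by parts moves the derivative from `f_m` onto the flux of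
`f_n`, and the Sturm-Liouville equation reduces the integral to the orthonormality of the `f_n`.
Against the mode zero only `∫ f_n' = 0` is needed. -/
theorem IsModes.gMode_orthonormal (h : IsStratified H g ρeq) (hm : IsModes H g ρeq c f)
    (m n : ℕ) : ∫ z, gMode H ρeq c f m z * gMode H ρeq c f n z * ρeq z ∂(vertMeasure H)
      = if m = n then 1 else 0 := by
  have key0 : ∀ n, 1 ≤ n → ∫ z, gMode H ρeq c f n z ∂(vertMeasure H) = 0 := by
    intro n hn
    rw [integral_congr_ae (hm.gMode_eq hn), integral_const_mul]
    have h1 := (prim_of_contDiff (H := H) (χ := fun _ => 1) contDiff_const).ibp h.hH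
      (IsModes.prim h hm hn)
    simp only [one_mul, (hm.eigen n hn).bot, (hm.eigen n hn).top, deriv_const', zero_mul,
      integral_zero, sub_zero] at h1
    rw [h1]; ring
  have hsymm : ∀ m n, ∫ z, gMode H ρeq c f m z * gMode H ρeq c f n z * ρeq z ∂(vertMeasure H)
      = ∫ z, gMode H ρeq c f n z * gMode H ρeq c f m z * ρeq z ∂(vertMeasure H) := fun m n =>
    integral_congr_ae (.of_forall fun z => by ring)
  rcases Nat.eq_zero_or_pos m with rfl | hm0
  · rcases Nat.eq_zero_or_pos n with rfl | hn0
    · rw [integral_gMode_zero h]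
      simp_rw [gMode_zero]
      rw [integral_const_mul, ← mul_assoc, ← Real.rpow_add h.integral_inv_pos]
      norm_num
      rw [Real.rpow_neg_one, inv_mul_cancel₀ h.integral_inv_pos.ne']
    · rw [hsymm, integral_gMode_zero h, key0 n hn0, mul_zero, if_neg (by omega)]
  · rcases Nat.eq_zero_or_pos n with rfl | hn0
    · rw [integral_gMode_zero h, key0 m hm0, mul_zero, if_neg (by omega)]
    · rw [IsModes.integral_gMode hm hn0]
      have h2 : ∫ z, gMode H ρeq c f m z * flux H ρeq f n z ∂(vertMeasure H)
          = c m * ∫ z, flux H ρeq f n z * derivWithin (f m) (Icc (-H) 0) z ∂(vertMeasure H) := by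
        rw [← integral_const_mul]
        refine integral_congr_ae ?_
        filter_upwards [hm.gMode_eq hm0] with z hz
        rw [hz]; ring
      have h1 := (hm.prim_flux hn0).ibp h.hH (IsModes.prim h hm hm0)
      rw [(hm.eigen m hm0).bot, (hm.eigen m hm0).top] at h1
      have h3 : ∫ z, -(ρeq z * bruntSq g ρeq z / c n ^ 2 * f n z) * f m z ∂(vertMeasure H)
          = -(c n ^ 2)⁻¹ * if m = n then 1 else 0 := by
        rw [← IsModes.orthonormal h hm hn0 hm0, ← integral_const_mul]
        refine integral_congr_ae (.of_forall fun z => ?_)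
        simp only
        ring
      rw [h2, h1, h3]
      have := (hm.pos n hn0).ne'
      split_ifs with hmn
      · subst hmn; field_simp; ring
      · ring

/-- The orthonormal functions `ρ_eq^{1/2} g_n` of `L²(-H, 0)`. -/
def gBasisFun (H : ℝ) (ρeq : ℝ → ℝ) (c : ℕ → ℝ) (f : ℕ → ℝ → ℝ) (n : ℕ) (z : ℝ) : ℝ :=
  √(ρeq z) * gMode H ρeq c f n z

theorem IsStratified.bdd_sqrt (h : IsStratified H g ρeq) : BddVert H fun z => √(ρeq z) :=
  bddVert_of_continuousOn (Real.continuous_sqrt.comp_continuousOn h.continuousOn)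

theorem IsStratified.bdd_inv_sqrt (h : IsStratified H g ρeq) : BddVert H fun z => (√(ρeq z))⁻¹ :=
  bddVert_of_continuousOn ((Real.continuous_sqrt.comp_continuousOn h.continuousOn).inv₀
    fun _ hz => (Real.sqrt_pos.2 (h.pos' hz)).ne')

theorem IsModes.bdd_gBasisFun (h : IsStratified H g ρeq) (hm : IsModes H g ρeq c f) (n : ℕ) :
    BddVert H (gBasisFun H ρeq c f n) := h.bdd_sqrt.mul (IsModes.bdd_gMode h hm n)

/-- Multiplication by `√ρ_eq` is an isometry from `L²(ρ_eq dz)` to `L²(dz)`; the right-hand side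
undoes it, so that it is a coefficient on `g_n`. -/
theorem IsModes.inner_gBasisFun (h : IsStratified H g ρeq) (hm : IsModes H g ρeq c f) (n : ℕ)
    (a : Lp ℝ 2 (vertMeasure H)) :
    inner ℝ ((IsModes.bdd_gBasisFun h hm n).memLp.toLp _) a
      = ∫ z, (a z * (√(ρeq z))⁻¹) * gMode H ρeq c f n z * ρeq z ∂(vertMeasure H) := by
  rw [L2.inner_def]
  refine integral_congr_ae ?_
  filter_upwards [(IsModes.bdd_gBasisFun h hm n).memLp.coeFn_toLp, h.ae_pos] with z h1 h2
  rw [h1, gBasisFun]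
  have h3 := Real.sq_sqrt h2.le
  have h4 := (Real.sqrt_pos.2 h2).ne'
  simp only [RCLike.inner_apply, conj_trivial]
  generalize √(ρeq z) = r at *
  rw [← h3]
  field_simp

/-- Completeness comes from that of `(f_n)`. If `A` is orthogonal to `g_0` it has zero mean, so its
primitive vanishes at both ends; orthogonality to `g_n`, integrated by parts, says that this
primitive is orthogonal to `f_n` for the weight `ρ_eq N²`. The primitive is therefore zero, and so
is its derivative `A`. -/
theorem IsModes.exists_basis (h : IsStratified H g ρeq) (hm : IsModes H g ρeq c f) :
    ∃ b : HilbertBasis ℕ ℝ (Lp ℝ 2 (vertMeasure H)), ∀ n a,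
      inner ℝ (b n) a
        = ∫ z, (a z * (√(ρeq z))⁻¹) * gMode H ρeq c f n z * ρeq z ∂(vertMeasure H) := by
  set v : ℕ → Lp ℝ 2 (vertMeasure H) := fun n => (IsModes.bdd_gBasisFun h hm n).memLp.toLp _
    with hv
  have ho : Orthonormal ℝ v := by
    rw [orthonormal_iff_ite]
    intro m n
    rw [← IsModes.gMode_orthonormal h hm m n, real_inner_comm, IsModes.inner_gBasisFun h hm n]
    refine integral_congr_ae ?_
    filter_upwards [(IsModes.bdd_gBasisFun h hm m).memLp.coeFn_toLp, h.ae_pos] with z h1 h2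
    rw [h1, gBasisFun]
    have h4 := (Real.sqrt_pos.2 h2).ne'
    field_simp
  have hbot : (Submodule.span ℝ (Set.range v))ᗮ = ⊥ := by
    rw [Submodule.eq_bot_iff]
    intro a ha
    have h0 : ∀ n, inner ℝ (v n) a = 0 := fun n =>
      (Submodule.mem_orthogonal _ _).1 ha _ (Submodule.subset_span ⟨n, rfl⟩)
    set A : ℝ → ℝ := fun z => a z * (√(ρeq z))⁻¹ with hA
    have hAi : Integrable A (vertMeasure H) :=
      integrable_of_memLp_two (h.bdd_inv_sqrt.memLp_mul (Lp.memLp a))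
    have hA0 : ∫ z, A z ∂(vertMeasure H) = 0 := by
      have h1 := h0 0
      rw [hv, IsModes.inner_gBasisFun h hm 0, integral_gMode_zero h] at h1
      exact (mul_eq_zero.1 h1).resolve_left (Real.rpow_pos_of_pos h.integral_inv_pos _).ne'
    have hP := prim_integral h.hH hAi 0
    simp only [zero_add] at hP
    have hz := IsModes.eq_zero_of_forall h hm (hP.bddVert h.hH) fun n hn => by
      have h1 := h0 n
      rw [hv, IsModes.inner_gBasisFun h hm n, IsModes.integral_gMode hm hn,
        IsModes.integral_mul_flux h hm hn hAi hA0] at h1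
      have h2 := (hm.pos n hn).ne'
      simpa [h2] using h1
    -- The primitive is continuous, so vanishing almost everywhere upgrades to vanishing everywhere
    -- on the open interval, and it can be differentiated.
    have hz' : ∀ z ∈ Ioo (-H) 0, ∫ y in (-H)..z, A y = 0 := by
      have := Measure.eqOn_open_of_ae_eq (μ := volume) (U := Ioo (-H) 0) hz isOpen_Ioo
        ((hP.continuousOn h.hH).mono Ioo_subset_Icc_self) continuousOn_const
      exact fun z hz => this hz
    have hAz : A =ᵐ[vertMeasure H] 0 := by
      filter_upwards [hP.deriv, ae_vert_mem H] with z h1 h2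
      have h3 : (fun z => ∫ y in (-H)..z, A y) =ᶠ[𝓝 z] fun _ => 0 := by
        filter_upwards [isOpen_Ioo.mem_nhds h2] with y hy using hz' y hy
      exact h1.unique ((hasDerivAt_const z 0).congr_of_eventuallyEq h3)
    rw [Lp.eq_zero_iff_ae_eq_zero]
    filter_upwards [hAz, h.ae_pos] with z h1 h2
    exact (mul_eq_zero.1 h1).resolve_right (inv_pos.2 (Real.sqrt_pos.2 h2)).ne'
  refine ⟨HilbertBasis.mkOfOrthogonalEqBot ho hbot, fun n a => ?_⟩
  rw [HilbertBasis.coe_mkOfOrthogonalEqBot]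
  exact IsModes.inner_gBasisFun h hm n a

/-- Parseval's identity for the basis `(g_n)` of `L²(ρ_eq dz)`. -/
theorem IsModes.hasSum_gMode (h : IsStratified H g ρeq) (hm : IsModes H g ρeq c f)
    {β : ℝ → ℝ} (hβ : BddVert H β) : ∃ C, 0 ≤ C ∧ ∀ A, MemLp A 2 (vertMeasure H) →
      HasSum (fun n => (∫ z, A z * gMode H ρeq c f n z * ρeq z ∂(vertMeasure H)) *
        ∫ z, β z * gMode H ρeq c f n z ∂(vertMeasure H)) (∫ z, A z * β z ∂(vertMeasure H)) ∧
      ∀ s : Finset ℕ, ∑ n ∈ s, |(∫ z, A z * gMode H ρeq c f n z * ρeq z ∂(vertMeasure H)) *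
        ∫ z, β z * gMode H ρeq c f n z ∂(vertMeasure H)|
          ≤ C * ((eLpNorm A 2 (vertMeasure H)).toReal ^ 2 + 1) := by
  obtain ⟨b, hb⟩ := IsModes.exists_basis h hm
  have hβ' : MemLp (fun z => β z * (√(ρeq z))⁻¹) 2 (vertMeasure H) :=
    (hβ.mul h.bdd_inv_sqrt).memLp
  obtain ⟨D, hD⟩ := h.bdd_sqrt.2
  set N := ‖hβ'.toLp _‖ ^ 2 with hN
  -- `D` bounds `√ρ_eq` and `N` is the squared norm of `β / √ρ_eq`. With `|xy| ≤ x² + y²` and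
  -- Bessel's inequality the sum is at most `D² ‖A‖² + N`. The constant does not depend on `A`,
  -- which is what summation uniformly in time requires.
  refine ⟨D ^ 2 + N, by positivity, fun A hA => ?_⟩
  have hA' : MemLp (fun z => A z * √(ρeq z)) 2 (vertMeasure H) := h.bdd_sqrt.memLp_mul hA
  have e1 : ∀ n, inner ℝ (b n) (hA'.toLp _)
      = ∫ z, A z * gMode H ρeq c f n z * ρeq z ∂(vertMeasure H) := by
    intro n
    rw [hb]
    refine integral_congr_ae ?_
    filter_upwards [hA'.coeFn_toLp, h.ae_pos] with z h1 h2
    rw [h1]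
    have h4 := (Real.sqrt_pos.2 h2).ne'
    field_simp
  have e2 : ∀ n, inner ℝ (b n) (hβ'.toLp _)
      = ∫ z, β z * gMode H ρeq c f n z ∂(vertMeasure H) := by
    intro n
    rw [hb]
    refine integral_congr_ae ?_
    filter_upwards [hβ'.coeFn_toLp, h.ae_pos] with z h1 h2
    rw [h1]
    have h3 := Real.sq_sqrt h2.le
    have h4 := (Real.sqrt_pos.2 h2).ne'
    generalize √(ρeq z) = r at *
    rw [← h3]
    field_simp
  have e3 : inner ℝ (hA'.toLp _) (hβ'.toLp _) = ∫ z, A z * β z ∂(vertMeasure H) := by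
    rw [L2.inner_def]
    refine integral_congr_ae ?_
    filter_upwards [hA'.coeFn_toLp, hβ'.coeFn_toLp, h.ae_pos] with z h1 h2 h3
    rw [h1, h2]
    have h4 := (Real.sqrt_pos.2 h3).ne'
    simp only [RCLike.inner_apply, conj_trivial]
    field_simp
  simp_rw [← e1, ← e2, ← e3]
  constructor
  · have := b.hasSum_inner_mul_inner (hA'.toLp _) (hβ'.toLp _)
    simpa only [real_inner_comm] using this
  · intro s
    have hA2 : ‖hA'.toLp _‖ ≤ D * (eLpNorm A 2 (vertMeasure H)).toReal := by
      rw [← Lp.norm_toLp A hA]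
      refine Lp.norm_le_mul_norm_of_ae_le_mul ?_
      filter_upwards [hA'.coeFn_toLp, hA.coeFn_toLp, hD] with z h1 h2 h3
      rw [h1, h2, norm_mul, mul_comm]
      exact mul_le_mul_of_nonneg_right h3 (norm_nonneg _)
    have hA3 := pow_le_pow_left₀ (norm_nonneg _) hA2 2
    have hs1 := b.orthonormal.sum_inner_products_le (hA'.toLp _) (s := s)
    have hs2 := b.orthonormal.sum_inner_products_le (hβ'.toLp _) (s := s)
    have hs3 : ∑ n ∈ s, |inner ℝ (b n) (hA'.toLp _) * inner ℝ (b n) (hβ'.toLp _)|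
        ≤ ∑ n ∈ s, (‖inner ℝ (b n) (hA'.toLp _)‖ ^ 2 + ‖inner ℝ (b n) (hβ'.toLp _)‖ ^ 2) := by
      refine Finset.sum_le_sum fun n _ => ?_
      rw [abs_mul]
      simp only [Real.norm_eq_abs]
      nlinarith [sq_nonneg (|inner ℝ (b n) (hA'.toLp _)| - |inner ℝ (b n) (hβ'.toLp _)|),
        sq_nonneg (|inner ℝ (b n) (hA'.toLp _)|), sq_nonneg (|inner ℝ (b n) (hβ'.toLp _)|)]
    rw [Finset.sum_add_distrib] at hs3
    have hN0 : 0 ≤ N := by positivity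
    nlinarith [sq_nonneg (eLpNorm A 2 (vertMeasure H)).toReal, sq_nonneg D,
      mul_nonneg hN0 (sq_nonneg (eLpNorm A 2 (vertMeasure H)).toReal)]

/-- The modal coefficients of the primitive of a function. -/
theorem IsModes.integral_primitive (h : IsStratified H g ρeq) (hm : IsModes H g ρeq c f)
    (hn : 1 ≤ n) {A B : ℝ → ℝ} (hA : Integrable A (vertMeasure H))
    (hB : B =ᵐ[vertMeasure H] fun z => ∫ y in (-H)..z, A y)
    (hA0 : ∫ z, A z ∂(vertMeasure H) = 0) :
    ∫ z, B z * f n z * (ρeq z * bruntSq g ρeq z) ∂(vertMeasure H)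
      = c n * ∫ z, A z * gMode H ρeq c f n z * ρeq z ∂(vertMeasure H) := by
  rw [IsModes.integral_gMode hm hn, IsModes.integral_mul_flux h hm hn hA hA0]
  have := (hm.pos n hn).ne'
  have h1 : ∫ z, B z * f n z * (ρeq z * bruntSq g ρeq z) ∂(vertMeasure H)
    = ∫ z, (∫ y in (-H)..z, A y) * f n z * (ρeq z * bruntSq g ρeq z) ∂(vertMeasure H) := by
    refine integral_congr_ae ?_
    filter_upwards [hB] with z hz
    rw [hz]
  rw [h1]
  field_simp

/-- The expansion of the primitive of a function converges in `L²(ρ_eq dz)`. -/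
theorem IsModes.hasSum_interaction (h : IsStratified H g ρeq) (hm : IsModes H g ρeq c f)
    (hn : 1 ≤ n) : ∃ C, 0 ≤ C ∧ ∀ A B, MemLp A 2 (vertMeasure H) →
      (B =ᵐ[vertMeasure H] fun z => ∫ y in (-H)..z, A y) → ∫ z, A z ∂(vertMeasure H) = 0 →
      HasSum (fun m => interaction H ρeq f (m + 1) n *
        ∫ z, B z * f (m + 1) z * (ρeq z * bruntSq g ρeq z) ∂(vertMeasure H))
        (∫ z, B z * f n z * ρeq z ∂(vertMeasure H)) ∧
      ∀ s : Finset ℕ, ∑ m ∈ s, |interaction H ρeq f (m + 1) n *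
        ∫ z, B z * f (m + 1) z * (ρeq z * bruntSq g ρeq z) ∂(vertMeasure H)|
          ≤ C * ((eLpNorm A 2 (vertMeasure H)).toReal ^ 2 + 1) := by
  have hG : Prim H _ _ := prim_integral h.hH ((IsModes.bdd h hm hn).mul h.bdd).integrable 0
  -- Pairing `B` with `f_n ρ_eq` is, by parts, minus the pairing of `A` with this primitive `G`.
  -- Parseval then applies in `L²(ρ_eq dz)`, where no division by `N²` occurs.
  set G : ℝ → ℝ := fun z => 0 + ∫ y in (-H)..z, f n y * ρeq y with hGdef
  obtain ⟨C, hC0, hC⟩ := IsModes.hasSum_gMode h hm (hG.bddVert h.hH)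
  refine ⟨C, hC0, fun A B hA hB hA0 => ?_⟩
  have hAi := integrable_of_memLp_two hA
  obtain ⟨hS, hF⟩ := hC A hA
  have hterm : ∀ m, interaction H ρeq f (m + 1) n *
      ∫ z, B z * f (m + 1) z * (ρeq z * bruntSq g ρeq z) ∂(vertMeasure H)
      = -((∫ z, A z * gMode H ρeq c f (m + 1) z * ρeq z ∂(vertMeasure H)) *
        ∫ z, G z * gMode H ρeq c f (m + 1) z ∂(vertMeasure H)) := by
    intro m
    -- By parts again, the coefficients of `G` on the modes produce the interaction coefficients.
    have h1 : ∫ z, G z * gMode H ρeq c f (m + 1) z ∂(vertMeasure H)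
        = -(c (m + 1) * interaction H ρeq f (m + 1) n) := by
      have h2 := hG.ibp h.hH (IsModes.prim h hm (n := m + 1) (by omega))
      rw [(hm.eigen (m + 1) (by omega)).bot, (hm.eigen (m + 1) (by omega)).top] at h2
      have h3 : ∫ z, G z * gMode H ρeq c f (m + 1) z ∂(vertMeasure H) = c (m + 1) *
          ∫ z, G z * derivWithin (f (m + 1)) (Icc (-H) 0) z ∂(vertMeasure H) := by
        rw [← integral_const_mul]
        refine integral_congr_ae ?_
        filter_upwards [hm.gMode_eq (n := m + 1) (by omega)] with z hz
        rw [hz]; ring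
      have h4 : ∫ z, f n z * ρeq z * f (m + 1) z ∂(vertMeasure H)
          = interaction H ρeq f (m + 1) n :=
        integral_congr_ae (.of_forall fun z => by ring)
      rw [h3, h2, h4]; ring
    rw [h1, IsModes.integral_primitive h hm (by omega) hAi hB hA0]; ring
  constructor
  · simp_rw [hterm]
    have h5 : ∫ z, B z * f n z * ρeq z ∂(vertMeasure H) = -∫ z, A z * G z ∂(vertMeasure H) := by
      have hP := prim_integral h.hH hAi 0
      have h6 := hP.ibp h.hH hG
      rw [integral_vert h.hH] at hA0
      simp only [zero_add, hA0, intervalIntegral.integral_same, zero_mul, sub_zero] at h6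
      rw [zero_sub] at h6
      rw [← h6]
      refine integral_congr_ae ?_
      filter_upwards [hB] with z hz
      rw [hz]; ring
    rw [h5]
    refine HasSum.neg ?_
    -- The Parseval sum starts at `0`; its first term vanishes since `A` has zero mean, so shifting
    -- the index loses nothing.
    rw [hasSum_nat_add_iff (f := fun n => (∫ z, A z * gMode H ρeq c f n z * ρeq z
      ∂(vertMeasure H)) * ∫ z, G z * gMode H ρeq c f n z ∂(vertMeasure H)) 1]
    simpa [integral_gMode_zero h, hA0] using hS
  · intro s
    have h7 := hF (s.map ⟨fun m => m + 1, add_left_injective 1⟩)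
    rw [Finset.sum_map] at h7
    refine le_trans (le_of_eq (Finset.sum_congr rfl fun m _ => ?_)) h7
    rw [hterm, abs_neg]
    rfl

end stratified

end Strat

end

noncomputable section

namespace Strat

/-! ### Bessel potentials of square integrable functions -/

section bessel

open SchwartzMap FourierTransform TemperedDistribution

variable {d : ℕ}

theorem memLp_ofReal_iff {α : Type*} [MeasurableSpace α] {μ : Measure α} {u : α → ℝ} {p : ℝ≥0∞} :
    MemLp (fun x => (u x : ℂ)) p μ ↔ MemLp u p μ :=
  ⟨fun h => by simpa using h.re, fun h => h.ofReal⟩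

theorem memLp_complex {α : Type*} [MeasurableSpace α] {μ : Measure α} {u : α → ℝ} {p : ℝ≥0∞}
    (hu : MemLp u p μ) : MemLp (fun x => (u x : ℂ)) p μ := memLp_ofReal_iff.2 hu

theorem eLpNorm_ofReal {α : Type*} [MeasurableSpace α] {μ : Measure α} (u : α → ℝ) (p : ℝ≥0∞) :
    eLpNorm (fun x => (u x : ℂ)) p μ = eLpNorm u p μ :=
  eLpNorm_congr_norm_ae (.of_forall fun x => by simp)

/-- The operator `(1 + |D|²)^{s/2}` on Schwartz functions. -/
def besselTest (s : ℝ) (ψ : 𝓢(Hor d, ℂ)) : 𝓢(Hor d, ℂ) :=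
  𝓕 (SchwartzMap.smulLeftCLM ℂ (fun x : Hor d => (((1 + ‖x‖ ^ 2) ^ (s / 2) : ℝ) : ℂ)) (𝓕⁻ ψ))

/-- The Bessel potential of a tempered distribution acts by duality on Schwartz functions. In this
form the operator falls on the test function, and Fubini can be applied. -/
theorem isBessel_iff {s : ℝ} {u v : Hor d → ℝ} : IsBessel s u v ↔
    MemLp u 2 volume ∧ MemLp v 2 volume ∧ ∀ ψ : 𝓢(Hor d, ℂ),
      ∫ x, besselTest s ψ x * (u x : ℂ) = ∫ x, ψ x * (v x : ℂ) := by
  have key : ∀ {w : Hor d → ℝ} (hw : MemLp (fun X => (w X : ℂ)) 2 volume) (ψ : 𝓢(Hor d, ℂ)),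
      Lp.toTemperedDistribution (hw.toLp (fun X => (w X : ℂ))) ψ = ∫ x, ψ x * (w x : ℂ) := by
    intro w hw ψ
    rw [Lp.toTemperedDistribution_apply]
    refine integral_congr_ae ?_
    filter_upwards [hw.coeFn_toLp] with x hx
    rw [hx, smul_eq_mul]
  constructor
  · rintro ⟨hu, hv, h⟩
    refine ⟨memLp_ofReal_iff.1 hu, memLp_ofReal_iff.1 hv, fun ψ => ?_⟩
    rw [← key hv, ← h, ← key hu]
    rfl
  · rintro ⟨hu, hv, h⟩
    refine ⟨memLp_complex hu, memLp_complex hv, ?_⟩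
    ext ψ
    rw [key (memLp_complex hv), ← h ψ, ← key (memLp_complex hu)]
    rfl

theorem IsBessel.sub {s : ℝ} {u v u' v' : Hor d → ℝ} (h : IsBessel s u v)
    (h' : IsBessel s u' v') : IsBessel s (u - u') (v - v') := by
  rw [isBessel_iff] at *
  refine ⟨h.1.sub h'.1, h.2.1.sub h'.2.1, fun ψ => ?_⟩
  have hi : ∀ {w : Hor d → ℝ} (_ : MemLp w 2 volume) (ψ : 𝓢(Hor d, ℂ)),
      Integrable (fun x => ψ x * (w x : ℂ)) :=
    fun hw ψ => (ψ.memLp 2 volume).integrable_mul (memLp_complex hw)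
  simp only [Pi.sub_apply, Complex.ofReal_sub, mul_sub]
  rw [integral_sub (hi h.1 _) (hi h'.1 _), integral_sub (hi h.2.1 _) (hi h'.2.1 _), h.2.2, h'.2.2]

/-- If two locally integrable functions agree as distributions, they are equal. -/
theorem ae_eq_of_forall_schwartz {a b : Hor d → ℂ} (ha : LocallyIntegrable a volume)
    (hb : LocallyIntegrable b volume)
    (h : ∀ ψ : 𝓢(Hor d, ℂ), ∫ x, ψ x * a x = ∫ x, ψ x * b x) : ∀ᵐ x, a x = b x := by
  refine ae_eq_of_integral_contDiff_smul_eq ha hb fun χ h1 h2 => ?_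
  have hc : HasCompactSupport (Complex.ofRealCLM ∘ χ) := h2.comp_left rfl
  have hs : ContDiff ℝ ∞ (Complex.ofRealCLM ∘ χ) := by fun_prop
  simpa using h (hc.toSchwartzMap hs)

/-- On the Fourier side `v` is `u` multiplied by `(1 + |x|²)^{s/2}`, which is at least one as `s ≥
0`; Plancherel concludes. -/
theorem IsBessel.eLpNorm_le {s : ℝ} (hs : 0 ≤ s) {u v : Hor d → ℝ} (h : IsBessel s u v) :
    eLpNorm u 2 volume ≤ eLpNorm v 2 volume := by
  obtain ⟨hu, hv, h⟩ := h
  have h1 := congrArg (fun f => 𝓕 f) h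
  simp only [fourier_besselPotential_eq_smulLeftCLM_fourier_apply,
    Lp.fourier_toTemperedDistribution_eq] at h1
  have hm : Function.HasTemperateGrowth
      (fun x : Hor d => (((1 + ‖x‖ ^ 2) ^ (s / 2) : ℝ) : ℂ)) := by fun_prop
  have h2 : ∀ᵐ x, (((1 + ‖x‖ ^ 2) ^ (s / 2) : ℝ) : ℂ) * (𝓕 (hu.toLp _) : Lp ℂ 2 volume) x
      = (𝓕 (hv.toLp _) : Lp ℂ 2 volume) x := by
    refine ae_eq_of_forall_schwartz ?_ ?_ fun ψ => ?_
    · refine LocallyIntegrable.continuous_mul ?_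
        ((Lp.memLp _).locallyIntegrable (by norm_num))
      exact hm.1.continuous
    · exact (Lp.memLp _).locallyIntegrable (by norm_num)
    · have h3 := congrArg (fun f => f ψ) h1
      simp only [TemperedDistribution.smulLeftCLM_apply_apply, Lp.toTemperedDistribution_apply, smul_eq_mul,
        SchwartzMap.smulLeftCLM_apply_apply hm] at h3
      rw [← h3]
      exact integral_congr_ae (.of_forall fun x => by simp only; ring)
  have h4 : ‖(𝓕 (hu.toLp _) : Lp ℂ 2 (volume : Measure (Hor d)))‖
      ≤ ‖(𝓕 (hv.toLp _) : Lp ℂ 2 (volume : Measure (Hor d)))‖ := by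
    refine Lp.norm_le_norm_of_ae_le ?_
    filter_upwards [h2] with x hx
    rw [← hx, norm_mul]
    refine le_mul_of_one_le_left (norm_nonneg _) ?_
    rw [Complex.norm_real, Real.norm_of_nonneg (by positivity)]
    exact Real.one_le_rpow (by nlinarith [norm_nonneg x]) (by positivity)
  rw [Lp.norm_fourier_eq, Lp.norm_fourier_eq, Lp.norm_toLp, Lp.norm_toLp,
    eLpNorm_ofReal, eLpNorm_ofReal] at h4
  exact (ENNReal.toReal_le_toReal (memLp_ofReal_iff.1 hu).2.ne (memLp_ofReal_iff.1 hv).2.ne).1 h4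

/-- The operator acts on `X` only, so by Fubini it goes through the integral in `z`. -/
theorem IsBessel.pint {ν : Measure ℝ} [SFinite ν] {s : ℝ} {u v : Hor d × ℝ → ℝ} {k : ℝ → ℝ}
    (hu : MemLp u 2 (volume.prod ν)) (hv : MemLp v 2 (volume.prod ν)) (hk : MemLp k 2 ν)
    (h : ∀ᵐ z ∂ν, IsBessel s (fun X => u (X, z)) (fun X => v (X, z))) :
    IsBessel s (pint ν k u) (pint ν k v) := by
  refine isBessel_iff.2 ⟨memLp_pint hu hk, memLp_pint hv hk, fun ψ => ?_⟩
  have key : ∀ {w : Hor d × ℝ → ℝ} (_ : MemLp w 2 (volume.prod ν)) (ψ : 𝓢(Hor d, ℂ)),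
      ∫ x, ψ x * (Strat.pint ν k w x : ℂ) = ∫ z, (k z : ℂ) * (∫ x, ψ x * (w (x, z) : ℂ)) ∂ν := by
    intro w hw ψ
    have hψ : MemLp (fun x => ‖ψ x‖) 2 volume := (ψ.memLp 2 volume).norm
    have hint : Integrable (fun p : Hor d × ℝ => ψ p.1 * ((w p : ℂ) * (k p.2 : ℂ)))
        (volume.prod ν) := by
      refine (integrable_mul_mul hw hψ hk).mono ?_ (.of_forall fun p => ?_)
      · exact ((ψ.memLp 2 volume).1.comp_fst).mul
          ((memLp_complex hw).1.mul (memLp_complex hk).1.comp_snd)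
      · simp only [norm_mul, Complex.norm_real, norm_norm]
        exact le_of_eq (by ring)
    calc ∫ x, ψ x * (Strat.pint ν k w x : ℂ)
        = ∫ x, (∫ z, ψ x * ((w (x, z) : ℂ) * (k z : ℂ)) ∂ν) := by
          refine integral_congr_ae (.of_forall fun x => ?_)
          simp only [Strat.pint]
          rw [integral_const_mul]
          refine congrArg (ψ x * ·) ?_
          rw [← integral_complex_ofReal]
          exact integral_congr_ae (.of_forall fun z => by simp)
      _ = ∫ z, (∫ x, ψ x * ((w (x, z) : ℂ) * (k z : ℂ))) ∂ν := integral_integral_swap hint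
      _ = _ := by
          refine integral_congr_ae (.of_forall fun z => ?_)
          simp only
          rw [← integral_const_mul]
          exact integral_congr_ae (.of_forall fun x => by simp only; ring)
  rw [key hu, key hv]
  refine integral_congr_ae ?_
  filter_upwards [h] with z hz
  rw [(isBessel_iff.1 hz).2.2]

theorem eLpNorm_le_of_slices {ν : Measure ℝ} [SFinite ν] {u v : Hor d × ℝ → ℝ}
    (hu : AEStronglyMeasurable u (volume.prod ν)) (hv : AEStronglyMeasurable v (volume.prod ν))
    (h : ∀ᵐ z ∂ν, eLpNorm (fun X => u (X, z)) 2 volume ≤ eLpNorm (fun X => v (X, z)) 2 volume) :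
    eLpNorm u 2 (volume.prod ν) ≤ eLpNorm v 2 (volume.prod ν) := by
  have h2 : ∀ a b : ℝ≥0∞, a ^ 2 ≤ b ^ 2 → a ≤ b := fun a b h =>
    (ENNReal.pow_right_strictMono (n := 2) (by norm_num)).le_iff_le.1 h
  apply h2
  rw [eLpNorm_two_sq, eLpNorm_two_sq, lintegral_prod_symm _ (by fun_prop),
    lintegral_prod_symm _ (by fun_prop)]
  refine lintegral_mono_ae ?_
  filter_upwards [h] with z hz
  rw [← eLpNorm_two_sq, ← eLpNorm_two_sq]
  exact pow_le_pow_left₀ (by simp) hz 2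

/-- For almost every `z` the increment of `v` is the Bessel potential of the increment of `u`, so it
dominates it in `L²(ℝ^d)`. -/
theorem ContHs0.contL2 {T H s : ℝ} (hs : 0 ≤ s) {u : ℝ → Hor d × ℝ → ℝ}
    (hu : ContHs0 T H s u) : ContL2 T (volume.prod (vertMeasure H)) u := by
  obtain ⟨v, hv1, hv2⟩ := hu
  rw [stripMeasure_eq] at *
  refine ⟨fun t ht => (hv1 t ht).1, fun t₀ ht₀ => ?_⟩
  refine tendsto_of_tendsto_of_tendsto_of_le_of_le' tendsto_const_nhds (hv2 t₀ ht₀)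
    (.of_forall fun _ => by simp) ?_
  filter_upwards [self_mem_nhdsWithin] with t ht
  refine eLpNorm_le_of_slices ((hv1 t ht).1.1.sub (hv1 t₀ ht₀).1.1)
    ((hv1 t ht).2.1.1.sub (hv1 t₀ ht₀).2.1.1) ?_
  filter_upwards [(hv1 t ht).2.2, (hv1 t₀ ht₀).2.2] with z h1 h2
  exact (h1.sub h2).eLpNorm_le hs

theorem ContHs0.contHs_pint {T H s : ℝ} {u : ℝ → Hor d × ℝ → ℝ} (hu : ContHs0 T H s u)
    {k : ℝ → ℝ} (hk : MemLp k 2 (vertMeasure H)) :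
    ContHs T s (fun t => Strat.pint (vertMeasure H) k (u t)) := by
  obtain ⟨v, hv1, hv2⟩ := hu
  rw [stripMeasure_eq] at *
  have hv : ContL2 T (volume.prod (vertMeasure H)) v := ⟨fun t ht => (hv1 t ht).2.1, hv2⟩
  exact ⟨fun t => Strat.pint (vertMeasure H) k (v t),
    fun t ht => IsBessel.pint (hv1 t ht).1 (hv1 t ht).2.1 hk (hv1 t ht).2.2, (hv.pint hk).2⟩

/-! ### First order equations with constant coefficients for square integrable functions -/

/-- The cutoff `x ↦ β(x / (n + 1))`. -/
theorem tendsto_integral_cutoff {u φ : Hor d → ℝ} (hu : MemLp u 2 volume) (hφ : ContDiff ℝ ∞ φ)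
    (v : Hor d) (hφ2 : MemLp φ 2 volume) (hφ3 : MemLp (pd v φ) 2 volume)
    (β : ContDiffBump (0 : Hor d)) :
    Tendsto (fun n : ℕ => ∫ x, u x * pd v (fun x => β (((n : ℝ) + 1)⁻¹ • x) * φ x) x)
      atTop (𝓝 (∫ x, u x * pd v φ x)) := by
  have hβd : ∀ x, HasFDerivAt β (fderiv ℝ β x) x := fun x =>
    ((β.contDiff (n := ⊤)).differentiable (by simp) x).hasFDerivAt
  have hφd : ∀ x, HasFDerivAt φ (fderiv ℝ φ x) x := fun x =>
    (hφ.differentiable (by simp) x).hasFDerivAt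
  -- The term where the cutoff is differentiated carries a factor `1 / (n + 1)` and disappears in
  -- the limit.
  have hder : ∀ (n : ℕ) x, pd v (fun x => β (((n : ℝ) + 1)⁻¹ • x) * φ x) x
      = β (((n : ℝ) + 1)⁻¹ • x) * pd v φ x
        + φ x * (((n : ℝ) + 1)⁻¹ * pd v β (((n : ℝ) + 1)⁻¹ • x)) := by
    intro n x
    have h1 : HasFDerivAt (fun x : Hor d => ((n : ℝ) + 1)⁻¹ • x)
        (((n : ℝ) + 1)⁻¹ • ContinuousLinearMap.id ℝ (Hor d)) x :=
      (((n : ℝ) + 1)⁻¹ • ContinuousLinearMap.id ℝ (Hor d)).hasFDerivAt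
    have h2 := ((hβd (((n : ℝ) + 1)⁻¹ • x)).comp x h1).mul (hφd x)
    unfold pd
    have h3 : fderiv ℝ (fun x => β (((n : ℝ) + 1)⁻¹ • x) * φ x) x = _ := h2.fderiv
    rw [h3]
    simp
  have hcont : Continuous (pd v β) := by
    unfold pd
    exact ((β.contDiff (n := ⊤)).continuous_fderiv (by simp)).clm_apply continuous_const
  obtain ⟨M, hM⟩ : ∃ M, ∀ x, ‖pd v β x‖ ≤ M := by
    refine HasCompactSupport.exists_bound_of_continuous ?_ hcont
    exact (β.hasCompactSupport.fderiv (𝕜 := ℝ)).comp_left (g := fun L => L v) rfl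
  simp_rw [hder]
  have hn : Tendsto (fun n : ℕ => ((n : ℝ) + 1)⁻¹) atTop (𝓝 0) := by
    simpa using tendsto_one_div_add_atTop_nhds_zero_nat (𝕜 := ℝ)
  refine tendsto_integral_of_dominated_convergence
    (fun x => |u x| * |pd v φ x| + |u x| * |φ x| * M) (fun n => ?_) ?_ (fun n => ?_) ?_
  · have hc1 : Continuous fun x : Hor d => β (((n : ℝ) + 1)⁻¹ • x) :=
      β.continuous.comp (by fun_prop)
    have hc2 : Continuous fun x : Hor d => pd v β (((n : ℝ) + 1)⁻¹ • x) :=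
      hcont.comp (by fun_prop)
    exact hu.1.mul ((hc1.aestronglyMeasurable.mul hφ3.1).add
      (hφ2.1.mul (hc2.aestronglyMeasurable.const_mul _)))
  · exact (hu.abs.integrable_mul hφ3.abs).add ((hu.abs.integrable_mul hφ2.abs).mul_const M)
  · refine .of_forall fun x => ?_
    have h1 : |β (((n : ℝ) + 1)⁻¹ • x)| ≤ 1 := by
      rw [abs_of_nonneg β.nonneg]; exact β.le_one
    have h2 : |((n : ℝ) + 1)⁻¹ * pd v β (((n : ℝ) + 1)⁻¹ • x)| ≤ M := by
      rw [abs_mul, abs_of_nonneg (by positivity)]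
      have h3 : ((n : ℝ) + 1)⁻¹ ≤ 1 := inv_le_one_of_one_le₀ (by linarith [n.cast_nonneg (α := ℝ)])
      exact (mul_le_of_le_one_left (abs_nonneg _) h3).trans (hM _)
    rw [Real.norm_eq_abs, abs_mul, mul_assoc, ← mul_add]
    refine mul_le_mul_of_nonneg_left ((abs_add_le _ _).trans (add_le_add ?_ ?_)) (abs_nonneg _)
    · rw [abs_mul]; exact mul_le_of_le_one_left (abs_nonneg _) h1
    · rw [abs_mul]; exact mul_le_mul_of_nonneg_left h2 (abs_nonneg _)
  · refine .of_forall fun x => ?_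
    have hx : Tendsto (fun n : ℕ => ((n : ℝ) + 1)⁻¹ • x) atTop (𝓝 0) := by
      simpa using hn.smul_const x
    have h1 : Tendsto (fun n : ℕ => β (((n : ℝ) + 1)⁻¹ • x)) atTop (𝓝 1) := by
      have := (β.continuous.tendsto 0).comp hx
      rwa [β.one_of_mem_closedBall (by simpa using β.rIn_pos.le)] at this
    have h2 : Tendsto (fun n : ℕ => pd v β (((n : ℝ) + 1)⁻¹ • x)) atTop (𝓝 (pd v β 0)) :=
      (hcont.tendsto 0).comp hx
    have h3 := ((h1.mul_const (pd v φ x)).add ((hn.mul h2).const_mul (φ x))).const_mul (u x)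
    simpa using h3

variable {ι : Type*} [Fintype ι]

/-- The Fourier transform of a real square integrable function. -/
def fhat {u : Hor d → ℝ} (hu : MemLp u 2 volume) : Lp ℂ 2 (volume : Measure (Hor d)) :=
  𝓕 ((memLp_complex hu).toLp fun x => (u x : ℂ))

/-- A first order equation valid against test functions is valid against all functions of `H^1`. -/
theorem sum_integral_pd_eq_zero {U : ι → Hor d → ℝ} (hU : ∀ k, MemLp (U k) 2 volume)
    (v : ι → Hor d)
    (h : ∀ φ : Hor d → ℝ, IsTest univ φ → ∑ k, ∫ x, U k x * pd (v k) φ x = 0)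
    {φ : Hor d → ℝ} (hφ : ContDiff ℝ ∞ φ) (hφ2 : MemLp φ 2 volume)
    (hφ3 : ∀ k, MemLp (pd (v k) φ) 2 volume) : ∑ k, ∫ x, U k x * pd (v k) φ x = 0 := by
  let β : ContDiffBump (0 : Hor d) := ⟨1, 2, by norm_num, by norm_num⟩
  have h1 := tendsto_finsetSum Finset.univ fun k _ =>
    tendsto_integral_cutoff (hU k) hφ (v k) hφ2 (hφ3 k) β
  refine tendsto_nhds_unique h1 ?_
  refine tendsto_const_nhds.congr fun n => (h _ ⟨?_, ?_, subset_univ _⟩).symm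
  · exact (β.contDiff.comp (contDiff_const_smul _)).mul hφ
  · refine HasCompactSupport.mul_right ?_
    exact β.hasCompactSupport.comp_smul (by positivity)

theorem sum_tempered_apply (S : ι → 𝓢'(Hor d, ℂ)) (ψ : 𝓢(Hor d, ℂ)) :
    (∑ k, S k) ψ = ∑ k, S k ψ :=
  map_sum (PointwiseConvergenceCLM.evalCLM (RingHom.id ℂ) ℂ ψ) _ _

theorem smul_tempered_apply (a : ℂ) (S : 𝓢'(Hor d, ℂ)) (ψ : 𝓢(Hor d, ℂ)) :
    (a • S) ψ = a * S ψ := rfl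

theorem smulLeft_fhat_apply {m : Hor d → ℂ} (hm : m.HasTemperateGrowth) {u : Hor d → ℝ}
    (hu : MemLp u 2 volume) (ψ : 𝓢(Hor d, ℂ)) :
    TemperedDistribution.smulLeftCLM ℂ m (Lp.toTemperedDistribution (fhat hu)) ψ
      = ∫ x, ψ x * (m x * fhat hu x) := by
  rw [TemperedDistribution.smulLeftCLM_apply_apply, Lp.toTemperedDistribution_apply]
  refine integral_congr_ae (.of_forall fun x => ?_)
  simp only [SchwartzMap.smulLeftCLM_apply_apply hm, smul_eq_mul]
  ring

open LineDeriv in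
/-- The Fourier transform of a first order equation with constant coefficients. -/
theorem sum_inner_mul_fourier_eq_zero {U : ι → Hor d → ℝ} (hU : ∀ k, MemLp (U k) 2 volume)
    (v : ι → Hor d)
    (h : ∀ φ : Hor d → ℝ, IsTest univ φ → ∑ k, ∫ x, U k x * pd (v k) φ x = 0) :
    ∀ᵐ x : Hor d, ∑ k, ((inner ℝ x (v k) : ℝ) : ℂ) *
      fhat (hU k) x = 0 := by
  -- In terms of distributions, the sum of the derivatives of the `U k` along the `v k` is zero.
  have hT : ∑ k, ∂_{v k} (Lp.toTemperedDistribution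
      ((memLp_complex (hU k)).toLp fun x => (U k x : ℂ)) : 𝓢'(Hor d, ℂ)) = 0 := by
    ext ψ
    -- The hypothesis concerns real functions; `L` is the real or the imaginary part, applied to the
    -- complex function `ψ`.
    have hre : ∀ L : ℂ →L[ℝ] ℝ, ∑ k, ∫ x, U k x * L ((∂_{v k} ψ : 𝓢(Hor d, ℂ)) x) = 0 := by
      intro L
      have hpd : ∀ k, pd (v k) (fun x => L (ψ x)) = fun x => L ((∂_{v k} ψ : 𝓢(Hor d, ℂ)) x) := by
        intro k
        funext x
        have h1 := L.hasFDerivAt.comp x (ψ.differentiableAt (x := x)).hasFDerivAt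
        have h2 : fderiv ℝ (fun x => L (ψ x)) x = _ := h1.fderiv
        rw [pd, h2, SchwartzMap.lineDerivOp_apply_eq_fderiv]
        rfl
      have h3 := sum_integral_pd_eq_zero hU v h (φ := fun x => L (ψ x))
        (L.contDiff.comp (ψ.smooth ⊤)) (L.comp_memLp' (ψ.memLp 2 volume))
        (fun k => by rw [hpd]; exact L.comp_memLp' ((∂_{v k} ψ : 𝓢(Hor d, ℂ)).memLp 2 volume))
      simpa only [hpd] using h3
    have hterm : ∀ k, (∂_{v k} (Lp.toTemperedDistribution
        ((memLp_complex (hU k)).toLp fun x => (U k x : ℂ)) : 𝓢'(Hor d, ℂ))) ψ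
        = -∫ x, (U k x : ℂ) * (∂_{v k} ψ : 𝓢(Hor d, ℂ)) x := by
      intro k
      rw [TemperedDistribution.lineDerivOp_apply_apply, Lp.toTemperedDistribution_apply,
        ← integral_neg]
      refine integral_congr_ae ?_
      filter_upwards [(memLp_complex (hU k)).coeFn_toLp] with x hx
      rw [hx]
      simp [mul_comm]
    have hint : ∀ k, Integrable (fun x => (U k x : ℂ) * (∂_{v k} ψ : 𝓢(Hor d, ℂ)) x) := fun k =>
      (memLp_complex (hU k)).integrable_mul ((∂_{v k} ψ : 𝓢(Hor d, ℂ)).memLp 2 volume)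
    have hsum : (∑ k, ∂_{v k} (Lp.toTemperedDistribution
        ((memLp_complex (hU k)).toLp fun x => (U k x : ℂ)) : 𝓢'(Hor d, ℂ))) ψ
        = ∑ k, -∫ x, (U k x : ℂ) * (∂_{v k} ψ : 𝓢(Hor d, ℂ)) x := by
      simp_rw [← hterm]
      exact sum_tempered_apply _ ψ
    rw [hsum]
    have h4 : ∀ L : ℂ →L[ℝ] ℝ, (∀ (a : ℝ) (z : ℂ), L (a * z) = a * L z) →
        L (∑ k, -∫ x, (U k x : ℂ) * (∂_{v k} ψ : 𝓢(Hor d, ℂ)) x) = 0 := by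
      intro L hL
      rw [map_sum, ← neg_eq_zero, ← Finset.sum_neg_distrib, ← hre L]
      refine Finset.sum_congr rfl fun k _ => ?_
      rw [map_neg, neg_neg, ← L.integral_comp_comm (hint k)]
      exact integral_congr_ae (.of_forall fun x => hL _ _)
    refine Complex.ext ?_ ?_
    · exact h4 Complex.reCLM fun a z => by simp
    · exact h4 Complex.imCLM fun a z => by simp
  -- Fourier transform turns the derivative along `v k` into multiplication by `2πi ⟨x, v k⟩`; the
  -- nonzero factor `2πi` is removed at the end.
  have hF : ∑ k, (2 * Real.pi * Complex.I) • TemperedDistribution.smulLeftCLM ℂ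
      (fun x => ((inner ℝ x (v k) : ℝ) : ℂ)) (Lp.toTemperedDistribution
        (fhat (hU k))) = 0 := by
    have h5 := map_sum (fourierCLM ℂ 𝓢'(Hor d, ℂ)) (fun k => ∂_{v k} (Lp.toTemperedDistribution
      ((memLp_complex (hU k)).toLp fun x => (U k x : ℂ)) : 𝓢'(Hor d, ℂ))) Finset.univ
    rw [hT, map_zero] at h5
    rw [h5]
    refine Finset.sum_congr rfl fun k _ => ?_
    rw [fhat, ← Lp.fourier_toTemperedDistribution_eq, fourierCLM_apply,
      TemperedDistribution.fourier_lineDerivOp_eq]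
  have hg : ∀ k, Function.HasTemperateGrowth
      (fun x : Hor d => ((inner ℝ x (v k) : ℝ) : ℂ)) := fun k => by fun_prop
  have hloc : ∀ k, LocallyIntegrable (fun x : Hor d => ((inner ℝ x (v k) : ℝ) : ℂ) *
      fhat (hU k) x) volume := fun k =>
    LocallyIntegrable.continuous_mul (hg k).1.continuous
      ((Lp.memLp _).locallyIntegrable (by norm_num))
  refine ae_eq_of_forall_schwartz (a := fun x => ∑ k, ((inner ℝ x (v k) : ℝ) : ℂ) *
      fhat (hU k) x) (b := fun _ => 0)
      ?_ (locallyIntegrable_const 0) fun ψ => ?_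
  · exact locallyIntegrable_finsetSum _ fun k _ => hloc k
  · simp_rw [Finset.mul_sum]
    have hint : ∀ k, Integrable (fun x : Hor d => ψ x * (((inner ℝ x (v k) : ℝ) : ℂ) *
        fhat (hU k) x)) := by
      intro k
      have := ((SchwartzMap.smulLeftCLM ℂ (fun x : Hor d => ((inner ℝ x (v k) : ℝ) : ℂ)) ψ).memLp 2
        volume).integrable_mul (Lp.memLp (fhat (hU k)))
      refine this.congr (.of_forall fun x => ?_)
      simp only [Pi.mul_apply, SchwartzMap.smulLeftCLM_apply_apply (hg k), smul_eq_mul]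
      ring
    rw [integral_finsetSum _ fun k _ => hint k]
    have h6 : (∑ k, (2 * Real.pi * Complex.I) • TemperedDistribution.smulLeftCLM ℂ
      (fun x => ((inner ℝ x (v k) : ℝ) : ℂ)) (Lp.toTemperedDistribution
        (fhat (hU k)))) ψ
        = (2 * Real.pi * Complex.I) * ∑ k, ∫ x : Hor d, ψ x * (((inner ℝ x (v k) : ℝ) : ℂ) *
        fhat (hU k) x) := by
      rw [sum_tempered_apply, Finset.mul_sum]
      exact Finset.sum_congr rfl fun k _ =>
        (smul_tempered_apply _ _ _).trans (congrArg _ (smulLeft_fhat_apply (hg k) (hU k) ψ))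
    rw [hF] at h6
    simp only [mul_zero, integral_zero]
    have h7 : (2 * Real.pi * Complex.I : ℂ) ≠ 0 := Complex.two_pi_I_ne_zero
    exact (mul_eq_zero.1 h6.symm).resolve_left h7

/-- A square integrable vector field on `ℝ^d`, `d ≥ 1`, without divergence and without curl
vanishes. -/
theorem eq_zero_of_div_curl (hd : 0 < d) {U : Fin d → Hor d → ℝ}
    (hU : ∀ i, MemLp (U i) 2 volume)
    (hdiv : ∀ φ : Hor d → ℝ, IsTest univ φ → ∑ i, ∫ x, U i x * pd (e i) φ x = 0)
    (hcurl : ∀ φ : Hor d → ℝ, IsTest univ φ → ∀ i j,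
      ∫ x, U j x * pd (e i) φ x = ∫ x, U i x * pd (e j) φ x) (i : Fin d) :
    U i =ᵐ[volume] 0 := by
  have hneg : ∀ j, MemLp (fun x => -U j x) 2 volume := fun j => (hU j).neg
  have h1 := sum_inner_mul_fourier_eq_zero hU (fun i => e i) hdiv
  have h2 : ∀ j, ∀ᵐ x : Hor d,
      (x i : ℂ) * fhat (hU j) x
        = (x j : ℂ) * fhat (hU i) x := by
    intro j
    -- The curl relation is read as a first order equation with two terms, for `U j` along `e i` and
    -- `-U i` along `e j`.
    have h3 := sum_inner_mul_fourier_eq_zero (ι := Fin 2)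
      (U := fun k => if k = 0 then U j else fun x => -U i x)
      (fun k => by split_ifs; exacts [hU j, hneg i]) (fun k => if k = 0 then e i else e j)
      (fun φ hφ => by
        simp only [Fin.sum_univ_two, if_true, Fin.isValue, one_ne_zero, if_false, neg_mul,
          integral_neg, hcurl φ hφ i j, add_neg_cancel])
    have h4 : fhat (hneg i) = -fhat (hU i) := by
      have h6 := map_neg (Lp.fourierTransformₗᵢ (Hor d) ℂ)
        ((memLp_complex (hU i)).toLp fun x => (U i x : ℂ))
      refine Eq.trans (congrArg (Lp.fourierTransformₗᵢ (Hor d) ℂ) ?_) h6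
      rw [← MemLp.toLp_neg]
      refine MemLp.toLp_congr _ _ (.of_forall fun x => ?_)
      simp
    have h5 := Lp.coeFn_neg (fhat (hU i))
    filter_upwards [h3, h5] with x hx hx5
    simp only [Fin.sum_univ_two, if_true, Fin.isValue, one_ne_zero, if_false] at hx
    rw [h4, hx5] at hx
    simp only [e, EuclideanSpace.inner_single_right, Pi.neg_apply, one_mul, conj_trivial] at hx
    linear_combination hx
  have h6 : fhat (hU i) = 0 := by
    rw [Lp.eq_zero_iff_ae_eq_zero]
    have : Nontrivial (Hor d) := by
      have : Nonempty (Fin d) := ⟨⟨0, hd⟩⟩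
      infer_instance
    -- As `d > 0`, the origin is a null set; there the symbol `|x|²` is not invertible.
    have h0 : ∀ᵐ x : Hor d, x ≠ 0 := by
      rw [ae_iff]; simp
    filter_upwards [h1, ae_all_iff.2 h2, h0] with x h1 h2 h0
    -- The divergence relation is multiplied by `x i`, and the curl relation replaces each `x i`
    -- times the transform of `U j` by `x j` times that of `U i`; this leaves `|x|²` times the
    -- latter.
    have h7 : (∑ j, (x j : ℂ) ^ 2) * fhat (hU i) x = 0 := by
      simp only [e, EuclideanSpace.inner_single_right, one_mul, conj_trivial] at h1
      have h8 := congrArg (fun w => (x i : ℂ) * w) h1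
      simp only [mul_zero, Finset.mul_sum] at h8
      rw [Finset.sum_mul, ← h8]
      refine Finset.sum_congr rfl fun j _ => ?_
      linear_combination -(x j : ℂ) * h2 j
    refine (mul_eq_zero.1 h7).resolve_left ?_
    have h9 := EuclideanSpace.norm_sq_eq x
    have h10 : (∑ j, (x j : ℂ) ^ 2) = ((‖x‖ ^ 2 : ℝ) : ℂ) := by
      rw [h9]; simp
    rw [h10]
    simpa using h0
  have h11 : (memLp_complex (hU i)).toLp (fun x => (U i x : ℂ)) = 0 := by
    rw [← norm_eq_zero, ← Lp.norm_fourier_eq]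
    exact norm_eq_zero.2 h6
  have h12 := (memLp_complex (hU i)).coeFn_toLp
  rw [h11] at h12
  filter_upwards [h12, Lp.coeFn_zero ℂ 2 (volume : Measure (Hor d))] with x h13 h14
  rw [h14] at h13
  simpa using h13.symm

end bessel

end Strat

end

noncomputable section

namespace Strat

/-! ### Test functions -/

section tests

variable {E F G : Type*} [NormedAddCommGroup E] [NormedSpace ℝ E] [NormedAddCommGroup F]
  [NormedSpace ℝ F] [NormedAddCommGroup G] [NormedSpace ℝ G]

theorem IsTest.pd {O : Set F} {φ : F → ℝ} (h : IsTest O φ) (v : F) : IsTest O (pd v φ) := by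
  refine ⟨(h.1.fderiv_right (m := ∞) (by simp)).clm_apply contDiff_const, ?_, ?_⟩
  · exact (h.2.1.fderiv (𝕜 := ℝ)).comp_left (g := fun L => L v) rfl
  · refine Subset.trans ?_ ((tsupport_fderiv_subset ℝ).trans h.2.2)
    exact closure_mono fun x hx hx' => hx (by simp [Strat.pd, hx'])

theorem IsTest.mono {O O' : Set F} {φ : F → ℝ} (h : IsTest O φ) (hO : O ⊆ O') : IsTest O' φ :=
  ⟨h.1, h.2.1, h.2.2.trans hO⟩

theorem pd_comm {φ : F → ℝ} (h : ContDiff ℝ ∞ φ) (v w : F) : pd v (pd w φ) = pd w (pd v φ) := by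
  have hd : Differentiable ℝ (fderiv ℝ φ) :=
    (h.fderiv_right (m := ∞) (by simp)).differentiable (by simp)
  have key : ∀ v w x, pd v (pd w φ) x = fderiv ℝ (fderiv ℝ φ) x v w := by
    intro v w x
    have h1 := (hd x).hasFDerivAt.clm_apply (hasFDerivAt_const w x)
    have h2 : fderiv ℝ (pd w φ) x = _ := h1.fderiv
    rw [pd, h2]
    simp
  funext x
  rw [key, key]
  refine (ContDiffAt.isSymmSndFDerivAt (n := ∞) h.contDiffAt ?_).eq v w
  simp only [minSmoothness_of_isRCLikeNormedField]
  exact ENat.LEInfty.out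

/-- The tensor product of two functions. -/
def tens (η : E → ℝ) (χ : F → ℝ) : E × F → ℝ := fun p => η p.1 * χ p.2

theorem IsTest.tens {A : Set E} {B : Set F} {η : E → ℝ} {χ : F → ℝ} (hη : IsTest A η)
    (hχ : IsTest B χ) : IsTest (A ×ˢ B) (tens η χ) := by
  have hts : tsupport (Strat.tens η χ) ⊆ tsupport η ×ˢ tsupport χ := by
    refine closure_minimal (fun p hp => ⟨subset_tsupport _ ?_, subset_tsupport _ ?_⟩)
      ((isClosed_tsupport η).prod (isClosed_tsupport χ))
    · exact left_ne_zero_of_mul hp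
    · exact right_ne_zero_of_mul hp
  refine ⟨(hη.1.comp contDiff_fst).mul (hχ.1.comp contDiff_snd), ?_, ?_⟩
  · exact HasCompactSupport.of_support_subset_isCompact (hη.2.1.isCompact.prod hχ.2.1.isCompact)
      ((subset_tsupport _).trans hts)
  · exact hts.trans (prod_mono hη.2.2 hχ.2.2)

theorem pd_tens {η : E → ℝ} {χ : F → ℝ} (hη : Differentiable ℝ η) (hχ : Differentiable ℝ χ)
    (a : E) (b : F) (p : E × F) :
    pd (a, b) (tens η χ) p = pd a η p.1 * χ p.2 + η p.1 * pd b χ p.2 := by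
  have h1 := ((hη p.1).hasFDerivAt.comp p hasFDerivAt_fst).mul
    ((hχ p.2).hasFDerivAt.comp p hasFDerivAt_snd)
  have h2 : fderiv ℝ (tens η χ) p = _ := h1.fderiv
  rw [pd, h2]
  simp [pd]
  ring

theorem pd_comp_equiv (L : E ≃L[ℝ] F) (φ : F → ℝ) (v : E) (p : E) :
    pd v (φ ∘ L) p = pd (L v) φ (L p) := by
  rw [pd, L.comp_right_fderiv]
  rfl

theorem IsTest.comp_equiv {O : Set F} {φ : F → ℝ} (h : IsTest O φ) (L : E ≃L[ℝ] F) :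
    IsTest (L ⁻¹' O) (φ ∘ L) := by
  refine ⟨h.1.comp L.contDiff, h.2.1.comp_homeomorph L.toHomeomorph, ?_⟩
  have h1 : tsupport (φ ∘ L) ⊆ L ⁻¹' (tsupport φ) :=
    closure_minimal (fun x hx => subset_tsupport _ hx)
      ((isClosed_tsupport φ).preimage L.continuous)
  exact h1.trans (preimage_mono h.2.2)

theorem pd_real (χ : ℝ → ℝ) (b z : ℝ) : pd b χ z = deriv χ z * b := by
  rw [pd, ← fderiv_apply_one_eq_deriv]
  have : b = b • (1 : ℝ) := by simp
  rw [this, map_smul]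
  simp [mul_comm]

end tests

/-! ### Test functions of `(t, X)`, and the pressure paired with them. -/

section horizontal

variable {d : ℕ} {T H : ℝ}

/-- The product of a function of `(t, X)` and of a function of `z`. -/
def tens3 (Φ : ℝ × Hor d → ℝ) (χ : ℝ → ℝ) : ℝ × (Hor d × ℝ) → ℝ :=
  fun p => Φ (p.1, p.2.1) * χ p.2.2

theorem tens3_eq (Φ : ℝ × Hor d → ℝ) (χ : ℝ → ℝ) :
    tens3 Φ χ = tens Φ χ ∘ (ContinuousLinearEquiv.prodAssoc ℝ ℝ (Hor d) ℝ).symm := rfl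

theorem IsTest.tens3 {Φ : ℝ × Hor d → ℝ} {χ : ℝ → ℝ} (hΦ : IsTest (Ioo 0 T ×ˢ univ) Φ)
    (hχ : IsTest (Ioo (-H) 0) χ) :
    IsTest (Ioo 0 T ×ˢ (univ ×ˢ Ioo (-H) 0)) (tens3 Φ χ) := by
  rw [tens3_eq]
  refine ((hΦ.tens hχ).comp_equiv _).mono fun p hp => ?_
  exact ⟨hp.1.1, mem_univ _, hp.2⟩

theorem pd_tens3 {Φ : ℝ × Hor d → ℝ} {χ : ℝ → ℝ} (hΦ : ContDiff ℝ ∞ Φ) (hχ : ContDiff ℝ ∞ χ)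
    (a : ℝ) (b : Hor d) (s : ℝ) (p : ℝ × (Hor d × ℝ)) :
    pd (a, (b, s)) (tens3 Φ χ) p
      = pd (a, b) Φ (p.1, p.2.1) * χ p.2.2 + Φ (p.1, p.2.1) * (deriv χ p.2.2 * s) := by
  rw [tens3_eq, pd_comp_equiv]
  have h := pd_tens (hΦ.differentiable (by simp)) (hχ.differentiable (by simp)) (a, b) s
    ((p.1, p.2.1), p.2.2)
  rw [pd_real] at h
  exact h

theorem IsTest.slice {O : Set ℝ} {Φ : ℝ × Hor d → ℝ} (h : IsTest (O ×ˢ univ) Φ) (t : ℝ) :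
    IsTest univ (fun X => Φ (t, X)) := by
  refine ⟨h.1.comp (contDiff_prodMk_right t), ?_, subset_univ _⟩
  refine HasCompactSupport.of_support_subset_isCompact (h.2.1.isCompact.image continuous_snd)
    fun X hX => ⟨(t, X), subset_tsupport _ hX, rfl⟩

theorem pd_slice {Φ : ℝ × Hor d → ℝ} (h : ContDiff ℝ ∞ Φ) (v : Hor d) (t : ℝ) (X : Hor d) :
    pd v (fun X => Φ (t, X)) X = pd (dirX v) Φ (t, X) := by
  have h1 : HasFDerivAt (fun X : Hor d => (t, X)) (ContinuousLinearMap.inr ℝ ℝ (Hor d)) X :=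
    hasFDerivAt_prodMk_right t X
  have h2 := ((h.differentiable (by simp) (t, X)).hasFDerivAt).comp X h1
  have h3 : fderiv ℝ (fun X => Φ (t, X)) X = _ := h2.fderiv
  rw [pd, h3]
  rfl

theorem IsTest.memLp {O : Set (Hor d)} {η : Hor d → ℝ} (h : IsTest O η) : MemLp η 2 volume :=
  h.1.continuous.memLp_of_hasCompactSupport h.2.1

/-- The time slices of a test function form a dominated family. -/
theorem IsTest.exists_testFamily {O : Set (ℝ × Hor d)} {Φ : ℝ × Hor d → ℝ} (h : IsTest O Φ) :
    ∃ G : Hor d → ℝ, TestFamily volume (fun t X => Φ (t, X)) G := by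
  obtain ⟨M, hM⟩ := h.2.1.exists_bound_of_continuous h.1.continuous
  have hK : IsCompact (Prod.snd '' tsupport Φ) := h.2.1.isCompact.image continuous_snd
  -- The majorant is a constant on the horizontal projection of the support, which is compact and
  -- does not depend on `t`.
  refine ⟨(Prod.snd '' tsupport Φ).indicator fun _ => M, ?_, fun t => ?_, fun t X => ?_,
    fun X => h.1.continuous.comp (by fun_prop)⟩
  · exact memLp_indicator_const 2 hK.measurableSet M (Or.inr hK.measure_lt_top.ne)
  · exact (h.1.continuous.comp (by fun_prop)).aestronglyMeasurable
  · by_cases hX : X ∈ Prod.snd '' tsupport Φ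
    · rw [indicator_of_mem hX]; exact hM _
    · rw [indicator_of_notMem hX, image_eq_zero_of_notMem_tsupport (f := Φ), abs_zero]
      exact fun hm => hX ⟨_, hm, rfl⟩

/-! ### The pressure -/

variable {P : ℝ → Hor d × ℝ → ℝ}

/-- The hypothesis on the pressure in `IsLinearSolution`. -/
def PressureIntegrable (T H : ℝ) (P : ℝ → Hor d × ℝ → ℝ) : Prop :=
  LocallyIntegrableOn (fun q : ℝ × (Hor d × ℝ) => P q.1 q.2)
    (Ioo 0 T ×ˢ (univ ×ˢ Icc (-H) 0)) volume

/-- Local integrability holds up to `z = -H` and `z = 0`, so `K` times the closed interval is an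
admissible compact set. This allows vertical factors that do not vanish at the boundary. -/
theorem PressureIntegrable.integrableOn (hP : PressureIntegrable T H P) {K : Set (ℝ × Hor d)}
    (hK : IsCompact K) (hKT : K ⊆ Ioo 0 T ×ˢ univ) :
    IntegrableOn (fun p : (ℝ × Hor d) × ℝ => P p.1.1 (p.1.2, p.2)) (K ×ˢ Ioo (-H) 0)
      (volume.prod volume) := by
  have hc : IsCompact (K ×ˢ Icc (-H) 0) := hK.prod isCompact_Icc
  have hc' := hc.image (ContinuousLinearEquiv.prodAssoc ℝ ℝ (Hor d) ℝ).continuous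
  have h1 := LocallyIntegrableOn.integrableOn_compact_subset hP (by
    rintro _ ⟨p, hp, rfl⟩
    exact ⟨(hKT hp.1).1, mem_univ _, hp.2⟩) hc'
  have h2 : MeasurePreserving (MeasurableEquiv.prodAssoc : (ℝ × Hor d) × ℝ ≃ᵐ ℝ × (Hor d × ℝ))
      ((volume.prod volume).prod volume) (volume.prod (volume.prod volume)) :=
    measurePreserving_prodAssoc volume volume volume
  have h3 := (h2.integrableOn_image MeasurableEquiv.prodAssoc.measurableEmbedding
    (f := fun q : ℝ × (Hor d × ℝ) => P q.1 q.2) (s := K ×ˢ Icc (-H) 0)).1 h1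
  exact h3.mono_set (prod_mono_right Ioo_subset_Icc_self)

/-- The measure `dt dX` on `(0, T) × ℝ^d`. -/
def timeHor (d : ℕ) (T : ℝ) : Measure (ℝ × Hor d) := (volume.restrict (Ioo 0 T)).prod volume

instance : SFinite (timeHor d T) := by unfold timeHor; infer_instance

theorem timeHor_eq : timeHor d T = volume.restrict (Ioo 0 T ×ˢ univ) := by
  rw [timeHor, Measure.volume_eq_prod, ← Measure.prod_restrict, Measure.restrict_univ]

theorem PressureIntegrable.integrable_mul (hP : PressureIntegrable T H P) {Φ : ℝ × Hor d → ℝ}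
    (hΦ : IsTest (Ioo 0 T ×ˢ univ) Φ) {k : ℝ → ℝ} (hk : BddVert H k) :
    Integrable (fun p : (ℝ × Hor d) × ℝ => P p.1.1 (p.1.2, p.2) * (Φ p.1 * k p.2))
      ((timeHor d T).prod (vertMeasure H)) := by
  have h1 := hP.integrableOn hΦ.2.1.isCompact hΦ.2.2
  obtain ⟨M, hM⟩ := hΦ.2.1.exists_bound_of_continuous hΦ.1.continuous
  have h2 : Integrable (fun p : (ℝ × Hor d) × ℝ => P p.1.1 (p.1.2, p.2) * Φ p.1)
      ((timeHor d T).prod (vertMeasure H)) := by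
    have h3 : IntegrableOn (fun p : (ℝ × Hor d) × ℝ => P p.1.1 (p.1.2, p.2) * Φ p.1)
        (tsupport Φ ×ˢ Ioo (-H) 0) (volume.prod volume) :=
      h1.mul_bdd (c := M) (hΦ.1.continuous.comp continuous_fst).aestronglyMeasurable
        (.of_forall fun p => hM p.1)
    have h4 : (timeHor d T).prod (vertMeasure H)
        = (volume.prod volume).restrict ((Ioo 0 T ×ˢ univ) ×ˢ Ioo (-H) 0) := by
      rw [timeHor_eq, vertMeasure, Measure.prod_restrict]
    rw [h4]
    refine IntegrableOn.of_forall_sdiff_eq_zero h3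
      ((measurableSet_Ioo.prod .univ).prod measurableSet_Ioo) fun p hp => ?_
    rw [image_eq_zero_of_notMem_tsupport (f := Φ), mul_zero]
    exact fun hp' => hp.2 ⟨hp', hp.1.2⟩
  obtain ⟨hk1, C, hC⟩ := hk
  have h5 : ∀ᵐ p ∂((timeHor d T).prod (vertMeasure H)), ‖k p.2‖ ≤ C :=
    Measure.quasiMeasurePreserving_snd.ae hC
  refine (h2.mul_bdd (c := C) hk1.comp_snd h5).congr (.of_forall fun p => ?_)
  simp only
  ring

/-- Integrated in time and in the horizontal variable against a test function, the pressure is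
represented by an integrable function of the vertical variable. -/
theorem PressureIntegrable.exists_repr (hP : PressureIntegrable T H P) {Φ : ℝ × Hor d → ℝ}
    (hΦ : IsTest (Ioo 0 T ×ˢ univ) Φ) : ∃ Q : ℝ → ℝ, Integrable Q (vertMeasure H) ∧
      ∀ k, BddVert H k →
        pair T (stripMeasure d H) P (tens3 Φ k) = ∫ z, Q z * k z ∂(vertMeasure H) ∧
        pair T volume (fun t => pint (vertMeasure H) k (P t)) Φ
          = ∫ z, Q z * k z ∂(vertMeasure H) := by
  set u : (ℝ × Hor d) × ℝ → ℝ := fun p => P p.1.1 (p.1.2, p.2) with hu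
  have h1 : BddVert H fun _ => (1 : ℝ) := bddVert_of_continuousOn continuousOn_const
  -- The pressure is only integrable, so duality in `L²` is not available; `Q` is the integral over
  -- time and `X` jointly.
  refine ⟨Strat.slice (timeHor d T) Φ u, ?_, fun k hk => ?_⟩
  · have := (hP.integrable_mul hΦ h1).integral_prod_right
    exact this.congr (.of_forall fun z => by simp [Strat.slice, hu])
  · have hi := hP.integrable_mul hΦ hk
    rw [integral_slice_mul hi]
    constructor
    · rw [pair, stripMeasure_eq]
      have h2 : MeasurePreserving
          (MeasurableEquiv.prodAssoc : (ℝ × Hor d) × ℝ ≃ᵐ ℝ × (Hor d × ℝ))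
          ((timeHor d T).prod (vertMeasure H))
          ((volume.restrict (Ioo 0 T)).prod (volume.prod (vertMeasure H))) :=
        measurePreserving_prodAssoc _ _ _
      refine Eq.trans ?_ (h2.integral_comp MeasurableEquiv.prodAssoc.measurableEmbedding
        (fun q : ℝ × (Hor d × ℝ) => P q.1 q.2 * (Φ (q.1, q.2.1) * k q.2.2))).symm
      have h3 := (h2.integrable_comp_emb MeasurableEquiv.prodAssoc.measurableEmbedding
        (g := fun q : ℝ × (Hor d × ℝ) => P q.1 q.2 * (Φ (q.1, q.2.1) * k q.2.2))).1 hi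
      rw [integral_prod _ h3]
      rfl
    · rw [← integral_pint_mul hi, timeHor, integral_prod]
      · rfl
      · have := hi.integral_prod_left
        refine this.congr (.of_forall fun q => ?_)
        simp only [pint]
        rw [← integral_mul_const]
        exact integral_congr_ae (.of_forall fun y => by simp only; ring)

end horizontal

end Strat

end

noncomputable section

namespace Strat

/-! ### The equations satisfied by the modal coefficients -/

section slices

variable {d : ℕ} {T H : ℝ}

theorem integral_pint_eq_slice {u : Hor d × ℝ → ℝ} (hu : MemLp u 2 (volume.prod (vertMeasure H)))
    {η : Hor d → ℝ} (hη : MemLp η 2 volume) {k : ℝ → ℝ} (hk : MemLp k 2 (vertMeasure H)) :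
    ∫ X, pint (vertMeasure H) k u X * η X = ∫ z, slice volume η u z * k z ∂(vertMeasure H) := by
  have hi := integrable_mul_mul hu hη hk
  rw [integral_pint_mul hi, integral_slice_mul hi]

theorem eLpNorm_slice_le {u : Hor d × ℝ → ℝ} (hu : MemLp u 2 (volume.prod (vertMeasure H)))
    {η : Hor d → ℝ} (hη : MemLp η 2 volume) :
    eLpNorm (slice volume η u) 2 (vertMeasure H)
      ≤ eLpNorm u 2 (volume.prod (vertMeasure H)) * eLpNorm η 2 volume := by
  have h1 : eLpNorm u 2 (volume.prod (vertMeasure H))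
      = eLpNorm (u ∘ Prod.swap) 2 ((vertMeasure H).prod volume) :=
    (eLpNorm_comp_measurePreserving hu.1 Measure.measurePreserving_swap).symm
  rw [slice_eq_pint_swap, h1]
  exact eLpNorm_pint_le (memLp_swap hu).1 hη.1

theorem ContL2.exists_repr_test {u : ℝ → Hor d × ℝ → ℝ}
    (hu : ContL2 T (volume.prod (vertMeasure H)) u) {O : Set (ℝ × Hor d)} {Φ : ℝ × Hor d → ℝ}
    (hΦ : IsTest O Φ) : ∃ r : ℝ → ℝ, MemLp r 2 (vertMeasure H) ∧
      ∀ k, BddVert H k →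
        pair T (stripMeasure d H) u (tens3 Φ k) = ∫ z, r z * k z ∂(vertMeasure H) ∧
        pair T volume (fun t => Strat.pint (vertMeasure H) k (u t)) Φ
          = ∫ z, r z * k z ∂(vertMeasure H) := by
  obtain ⟨G, hG⟩ := hΦ.exists_testFamily
  obtain ⟨r, hr, h⟩ := hu.exists_repr hG
  refine ⟨r, hr, fun k hk => ?_⟩
  rw [pair, stripMeasure_eq]
  exact h k hk.memLp

/-- It lets factors such as `ρ_eq` or `g` pass from the field to the test function. -/
theorem pair_congr {F : Type*} [MeasurableSpace F] {μ : Measure F} {u u' : ℝ → F → ℝ}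
    {ψ ψ' : ℝ × F → ℝ} (h : ∀ t x, u t x * ψ (t, x) = u' t x * ψ' (t, x)) :
    pair T μ u ψ = pair T μ u' ψ' := by
  unfold pair
  simp_rw [h]

theorem pd_dirT_tens3 {Φ : ℝ × Hor d → ℝ} {χ : ℝ → ℝ} (hΦ : ContDiff ℝ ∞ Φ)
    (hχ : ContDiff ℝ ∞ χ) : pd dirT (tens3 Φ χ) = tens3 (pd dirT Φ) χ := by
  funext p
  have h := pd_tens3 hΦ hχ 1 0 0 p
  rw [mul_zero, mul_zero, add_zero] at h
  exact h

theorem pd_dirX_tens3 {Φ : ℝ × Hor d → ℝ} {χ : ℝ → ℝ} (hΦ : ContDiff ℝ ∞ Φ)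
    (hχ : ContDiff ℝ ∞ χ) (v : Hor d) :
    pd (dirX (v, 0)) (tens3 Φ χ) = tens3 (pd (dirX v) Φ) χ := by
  funext p
  have h := pd_tens3 hΦ hχ 0 v 0 p
  rw [mul_zero, mul_zero, add_zero] at h
  exact h

theorem pd_dirZ_tens3 {Φ : ℝ × Hor d → ℝ} {χ : ℝ → ℝ} (hΦ : ContDiff ℝ ∞ Φ)
    (hχ : ContDiff ℝ ∞ χ) : pd (dirX (0, 1)) (tens3 Φ χ) = tens3 Φ (deriv χ) := by
  funext p
  have h := pd_tens3 hΦ hχ 0 0 1 p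
  have h0 : pd ((0 : ℝ), (0 : Hor d)) Φ (p.1, p.2.1) = 0 := by
    rw [pd, ← Prod.zero_eq_mk, map_zero]
  rw [mul_one, h0, zero_mul, zero_add] at h
  exact h

theorem IsTest.bddVert {O : Set ℝ} {χ : ℝ → ℝ} (h : IsTest O χ) : BddVert H χ :=
  bddVert_of_continuousOn h.1.continuous.continuousOn

theorem IsTest.bddVert_deriv {O : Set ℝ} {χ : ℝ → ℝ} (h : IsTest O χ) : BddVert H (deriv χ) :=
  bddVert_of_continuousOn (h.1.continuous_deriv (by simp)).continuousOn

end slices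

/-! ### The Euler equations integrated against bounded functions of `z`. -/

section equations

variable {d : ℕ} {T H g : ℝ} {ρeq : ℝ → ℝ} {c : ℕ → ℝ} {f : ℕ → ℝ → ℝ}
  {V : ℝ → Fin d → Hor d × ℝ → ℝ} {w ρ P : ℝ → Hor d × ℝ → ℝ}

theorem velCoeff_eq (n : ℕ) (v : Hor d × ℝ → ℝ) : velCoeff H ρeq c f n v
    = pint (vertMeasure H) (fun z => gMode H ρeq c f n z * ρeq z) v := by
  funext X
  exact integral_congr_ae (.of_forall fun z => by ring)

theorem vertCoeff_eq (n : ℕ) (v : Hor d × ℝ → ℝ) : vertCoeff H g ρeq f n v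
    = pint (vertMeasure H) (fun z => f n z * (ρeq z * bruntSq g ρeq z)) v := by
  funext X
  exact integral_congr_ae (.of_forall fun z => by ring)

theorem densCoeff_eq (n : ℕ) (v : Hor d × ℝ → ℝ) : densCoeff H g f n v
    = pint (vertMeasure H) (fun z => g * f n z) v := by
  funext X
  exact integral_congr_ae (.of_forall fun z => by ring)

theorem presCoeff_eq (n : ℕ) (v : Hor d × ℝ → ℝ) : presCoeff H ρeq c f n v
    = pint (vertMeasure H) (gMode H ρeq c f n) v := rfl

theorem IsModes.bdd_vel (h : IsStratified H g ρeq) (hm : IsModes H g ρeq c f) (n : ℕ) :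
    BddVert H fun z => gMode H ρeq c f n z * ρeq z := (IsModes.bdd_gMode h hm n).mul h.bdd

theorem IsModes.bdd_vert (h : IsStratified H g ρeq) (hm : IsModes H g ρeq c f) {n : ℕ}
    (hn : 1 ≤ n) : BddVert H fun z => f n z * (ρeq z * bruntSq g ρeq z) :=
  (IsModes.bdd h hm hn).mul h.bdd_weight

theorem IsModes.bdd_dens (h : IsStratified H g ρeq) (hm : IsModes H g ρeq c f) {n : ℕ}
    (hn : 1 ≤ n) : BddVert H fun z => g * f n z := (IsModes.bdd h hm hn).const_mul g

/-- The horizontal divergence of `V(t)`, tested against `η`. -/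
def divSlice (V : ℝ → Fin d → Hor d × ℝ → ℝ) (η : Hor d → ℝ) (t z : ℝ) : ℝ :=
  ∑ i, slice volume (pd (e i) η) (V t i) z

theorem memLp_divSlice (hV : ∀ i, ContL2 T (volume.prod (vertMeasure H)) (fun t => V t i))
    {η : Hor d → ℝ} (hη : IsTest univ η) {t : ℝ} (ht : t ∈ Icc 0 T) :
    MemLp (divSlice V η t) 2 (vertMeasure H) :=
  memLp_finsetSum _ fun i _ => memLp_slice ((hV i).1 t ht) (hη.pd (e i)).memLp

theorem integral_divSlice_mul
    (hV : ∀ i, ContL2 T (volume.prod (vertMeasure H)) (fun t => V t i))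
    {η : Hor d → ℝ} (hη : IsTest univ η) {t : ℝ} (ht : t ∈ Icc 0 T) {k : ℝ → ℝ}
    (hk : BddVert H k) : ∫ z, divSlice V η t z * k z ∂(vertMeasure H)
      = ∑ i, ∫ X, pint (vertMeasure H) k (V t i) X * pd (e i) η X := by
  simp_rw [divSlice, Finset.sum_mul]
  rw [integral_finsetSum]
  · exact Finset.sum_congr rfl fun i _ =>
      (integral_pint_eq_slice ((hV i).1 t ht) (hη.pd (e i)).memLp hk.memLp).symm
  · exact fun i _ => hk.integrable_mul
      (integrable_of_memLp_two (memLp_slice ((hV i).1 t ht) (hη.pd (e i)).memLp))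

/-- Incompressibility: `w` is the primitive of `-∇·V`. -/
theorem IsLinearSolution.slice_eq (hsol : IsLinearSolution T H g ρeq V w ρ P) (hH : 0 < H)
    (hV : ∀ i, ContL2 T (volume.prod (vertMeasure H)) (fun t => V t i))
    (hw : ContL2 T (volume.prod (vertMeasure H)) w)
    {η : Hor d → ℝ} (hη : IsTest univ η) {t : ℝ} (ht : t ∈ Icc 0 T) :
    (slice volume η (w t) =ᵐ[vertMeasure H] fun z => ∫ y in (-H)..z, divSlice V η t y) ∧
      ∫ z, divSlice V η t z ∂(vertMeasure H) = 0 := by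
  have hA := integrable_of_memLp_two (memLp_divSlice hV hη ht)
  have hB := integrable_of_memLp_two (memLp_slice (hw.1 t ht) hη.memLp)
  -- In the divergence equation `χ` may be arbitrary at the boundary; this encodes `w = 0` at both
  -- ends.
  refine eq_primitive_of_weak_deriv_boundary hH hA hB fun χ hχ1 hχ2 => ?_
  have hχ : IsTest univ χ := ⟨hχ1, hχ2, subset_univ _⟩
  have h1 := hsol.div t ht (tens η χ) ((hη.tens hχ).mono (subset_univ _))
  have hdη := hη.1.differentiable (by simp)
  have hdχ := hχ.1.differentiable (by simp)
  have e1 : ∀ (i : Fin d) (x : Hor d × ℝ),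
      pd (e i, 0) (tens η χ) x = pd (e i) η x.1 * χ x.2 := by
    intro i x
    rw [pd_tens hdη hdχ, pd_real, mul_zero, mul_zero, add_zero]
  have e2 : ∀ x : Hor d × ℝ, pd (0, 1) (tens η χ) x = η x.1 * deriv χ x.2 := by
    intro x
    rw [pd_tens hdη hdχ, pd_real, mul_one]
    simp [pd]
  simp_rw [e1, e2] at h1
  have hiV : ∀ i, Integrable (fun x : Hor d × ℝ => V t i x * (pd (e i) η x.1 * χ x.2))
      (volume.prod (vertMeasure H)) := fun i =>
    integrable_mul_mul ((hV i).1 t ht) (hη.pd (e i)).memLp hχ.bddVert.memLp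
  have hiw : Integrable (fun x : Hor d × ℝ => w t x * (η x.1 * deriv χ x.2))
      (volume.prod (vertMeasure H)) :=
    integrable_mul_mul (hw.1 t ht) hη.memLp hχ.bddVert_deriv.memLp
  rw [stripMeasure_eq, integral_add (integrable_finsetSum _ fun i _ => hiV i) hiw,
    integral_finsetSum _ fun i _ => hiV i, ← integral_slice_mul hiw] at h1
  rw [← h1, integral_divSlice_mul hV hη ht hχ.bddVert]
  congr 1
  exact Finset.sum_congr rfl fun i _ => integral_pint_mul (hiV i)

/-- The hypothesis only allows vertical factors supported inside `(-H, 0)`. These suffice to give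
the identity for almost every `z`, after which any bounded `k` is admissible. -/
theorem ZeroVerticalVorticity.pint (hcurl : ZeroVerticalVorticity T H V)
    (hV : ∀ i, ContL2 T (volume.prod (vertMeasure H)) (fun t => V t i))
    {η : Hor d → ℝ} (hη : IsTest univ η) {t : ℝ} (ht : t ∈ Icc 0 T) {k : ℝ → ℝ}
    (hk : BddVert H k) (i j : Fin d) :
    ∫ X, pint (vertMeasure H) k (V t j) X * pd (e i) η X
      = ∫ X, pint (vertMeasure H) k (V t i) X * pd (e j) η X := by
  have hL : ∀ i j, MemLp (slice volume (pd (e i) η) (V t j)) 2 (vertMeasure H) := fun i j =>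
    memLp_slice ((hV j).1 t ht) (hη.pd (e i)).memLp
  have h0 : (fun z => slice volume (pd (e i) η) (V t j) z
      - slice volume (pd (e j) η) (V t i) z) =ᵐ[vertMeasure H] 0 := by
    refine ae_eq_zero_of_forall_test ((integrable_of_memLp_two (hL i j)).sub
      (integrable_of_memLp_two (hL j i))) fun χ hχ => ?_
    have h1 := hcurl t ht (tens η χ) (hη.tens hχ) i j
    have hdη := hη.1.differentiable (by simp)
    have hdχ := hχ.1.differentiable (by simp)
    have e1 : ∀ (i : Fin d) (x : Hor d × ℝ),
        pd (e i, 0) (tens η χ) x = pd (e i) η x.1 * χ x.2 := by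
      intro i x
      rw [pd_tens hdη hdχ, pd_real, mul_zero, mul_zero, add_zero]
    simp_rw [e1] at h1
    have hi : ∀ i j, Integrable (fun x : Hor d × ℝ => V t j x * (pd (e i) η x.1 * χ x.2))
        (volume.prod (vertMeasure H)) := fun i j =>
      integrable_mul_mul ((hV j).1 t ht) (hη.pd (e i)).memLp hχ.bddVert.memLp
    rw [stripMeasure_eq, integral_sub (hi i j) (hi j i), ← integral_slice_mul (hi i j),
      ← integral_slice_mul (hi j i)] at h1
    simp_rw [sub_mul]
    rw [integral_sub (hχ.bddVert.integrable_mul (integrable_of_memLp_two (hL i j)))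
      (hχ.bddVert.integrable_mul (integrable_of_memLp_two (hL j i)))]
    exact h1
  rw [integral_pint_eq_slice ((hV j).1 t ht) (hη.pd (e i)).memLp hk.memLp,
    integral_pint_eq_slice ((hV i).1 t ht) (hη.pd (e j)).memLp hk.memLp]
  refine integral_congr_ae ?_
  filter_upwards [h0] with z hz
  rw [sub_eq_zero.1 hz]

/-- `w_n = - c_n ∇·V_n`. -/
theorem IsLinearSolution.vertCoeff_eq_div (hsol : IsLinearSolution T H g ρeq V w ρ P)
    (h : IsStratified H g ρeq) (hm : IsModes H g ρeq c f)
    (hV : ∀ i, ContL2 T (volume.prod (vertMeasure H)) (fun t => V t i))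
    (hw : ContL2 T (volume.prod (vertMeasure H)) w) {n : ℕ} (hn : 1 ≤ n)
    {η : Hor d → ℝ} (hη : IsTest univ η) {t : ℝ} (ht : t ∈ Icc 0 T) :
    ∫ X, vertCoeff H g ρeq f n (w t) X * η X
      = c n * ∑ i, ∫ X, velCoeff H ρeq c f n (V t i) X * pd (e i) η X := by
  obtain ⟨h1, h2⟩ := hsol.slice_eq h.hH hV hw hη ht
  have h3 := IsModes.integral_primitive h hm hn
    (integrable_of_memLp_two (memLp_divSlice hV hη ht)) h1 h2
  simp_rw [vertCoeff_eq, velCoeff_eq]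
  rw [integral_pint_eq_slice (hw.1 t ht) hη.memLp (IsModes.bdd_vert h hm hn).memLp,
    ← integral_divSlice_mul hV hη ht (IsModes.bdd_vel h hm n)]
  simp_rw [← mul_assoc] at h3 ⊢
  exact h3

/-- Smooth compactly supported vertical factors show that `r ρ_eq + Q = 0` almost everywhere, where
`r` and `Q` represent `V` and `P`. The identity is then integrated against `k`. -/
theorem IsLinearSolution.horizontal_pint (hsol : IsLinearSolution T H g ρeq V w ρ P)
    (h : IsStratified H g ρeq)
    (hV : ∀ i, ContL2 T (volume.prod (vertMeasure H)) (fun t => V t i))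
    {Φ : ℝ × Hor d → ℝ} (hΦ : IsTest (Ioo 0 T ×ˢ univ) Φ) (i : Fin d) {k : ℝ → ℝ}
    (hk : BddVert H k) :
    -pair T volume (fun t => pint (vertMeasure H) (fun z => k z * ρeq z) (V t i)) (pd dirT Φ)
      - pair T volume (fun t => pint (vertMeasure H) k (P t)) (pd (dirX (e i)) Φ) = 0 := by
  obtain ⟨r, hr, hr'⟩ := (hV i).exists_repr_test (hΦ.pd dirT)
  obtain ⟨Q, hQ, hQ'⟩ := PressureIntegrable.exists_repr hsol.pressure_integrable
    (hΦ.pd (dirX (e i)))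
  have hri : Integrable (fun z => r z * ρeq z) (vertMeasure H) :=
    h.bdd.integrable_mul (integrable_of_memLp_two hr)
  have h0 : (fun z => r z * ρeq z + Q z) =ᵐ[vertMeasure H] 0 := by
    refine ae_eq_zero_of_forall_test (hri.add hQ) fun χ hχ => ?_
    have h1 := hsol.horizontal _ (hΦ.tens3 hχ) i
    rw [pd_dirT_tens3 hΦ.1 hχ.1, pd_dirX_tens3 hΦ.1 hχ.1, (hQ' χ hχ.bddVert).1,
      pair_congr (u' := fun t => V t i) (ψ' := tens3 (pd dirT Φ) fun z => χ z * ρeq z)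
        (fun t x => by simp only [tens3]; ring), (hr' _ (hχ.bddVert.mul h.bdd)).1] at h1
    simp_rw [add_mul]
    rw [integral_add (hχ.bddVert.integrable_mul hri) (hχ.bddVert.integrable_mul hQ),
      integral_congr_ae (g := fun z => r z * (χ z * ρeq z)) (.of_forall fun z => by ring)]
    linarith
  rw [(hr' _ (hk.mul h.bdd)).2, (hQ' k hk).2, ← integral_neg, ← integral_sub]
  · refine integral_eq_zero_of_ae ?_
    filter_upwards [h0] with z hz
    simp only [Pi.zero_apply] at hz ⊢
    linear_combination -(k z) * hz
  · exact ((hk.mul h.bdd).integrable_mul (integrable_of_memLp_two hr)).neg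
  · exact hk.integrable_mul hQ

/-- As for the horizontal momentum, the equation is first turned into an identity almost everywhere
in `z`. -/
theorem IsLinearSolution.density_pint (hsol : IsLinearSolution T H g ρeq V w ρ P)
    (h : IsStratified H g ρeq) (hw : ContL2 T (volume.prod (vertMeasure H)) w)
    (hρ : ContL2 T (volume.prod (vertMeasure H)) ρ)
    {Φ : ℝ × Hor d → ℝ} (hΦ : IsTest (Ioo 0 T ×ˢ univ) Φ) {k : ℝ → ℝ} (hk : BddVert H k) :
    -pair T volume (fun t => pint (vertMeasure H) k (ρ t)) (pd dirT Φ)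
      + pair T volume (fun t => pint (vertMeasure H) (fun z => k z * deriv ρeq z) (w t)) Φ
      = 0 := by
  obtain ⟨r, hr, hr'⟩ := hρ.exists_repr_test (hΦ.pd dirT)
  obtain ⟨q, hq, hq'⟩ := hw.exists_repr_test hΦ
  have hqi : Integrable (fun z => q z * deriv ρeq z) (vertMeasure H) :=
    h.bdd_deriv.integrable_mul (integrable_of_memLp_two hq)
  have hri := integrable_of_memLp_two hr
  have h0 : (fun z => -r z + q z * deriv ρeq z) =ᵐ[vertMeasure H] 0 := by
    refine ae_eq_zero_of_forall_test (hri.neg.add hqi) fun χ hχ => ?_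
    have h1 := hsol.density _ (hΦ.tens3 hχ)
    rw [pd_dirT_tens3 hΦ.1 hχ.1, (hr' χ hχ.bddVert).1,
      pair_congr (u' := w) (ψ' := tens3 Φ fun z => χ z * deriv ρeq z)
        (fun t x => by simp only [tens3]; ring), (hq' _ (hχ.bddVert.mul h.bdd_deriv)).1] at h1
    simp_rw [add_mul, neg_mul]
    have hneg : Integrable (fun z => -(r z * χ z)) (vertMeasure H) :=
      (hχ.bddVert.integrable_mul hri).neg
    rw [integral_add hneg (hχ.bddVert.integrable_mul hqi), integral_neg, integral_congr_ae (f := fun z => q z * deriv ρeq z * χ z)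
        (g := fun z => q z * (χ z * deriv ρeq z)) (.of_forall fun z => by ring)]
    exact h1
  rw [(hr' k hk).2, (hq' _ (hk.mul h.bdd_deriv)).2, ← integral_neg, ← integral_add]
  · refine integral_eq_zero_of_ae ?_
    filter_upwards [h0] with z hz
    simp only [Pi.zero_apply] at hz ⊢
    linear_combination k z * hz
  · exact (hk.integrable_mul hri).neg
  · exact (hk.mul h.bdd_deriv).integrable_mul (integrable_of_memLp_two hq)

/-- The vertical momentum equation, projected on a mode. -/
theorem IsLinearSolution.vertical_pint (hsol : IsLinearSolution T H g ρeq V w ρ P)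
    (h : IsStratified H g ρeq) (hm : IsModes H g ρeq c f)
    (hw : ContL2 T (volume.prod (vertMeasure H)) w)
    (hρ : ContL2 T (volume.prod (vertMeasure H)) ρ) {n : ℕ} (hn : 1 ≤ n)
    {Φ : ℝ × Hor d → ℝ} (hΦ : IsTest (Ioo 0 T ×ˢ univ) Φ) :
    pair T volume (fun t => presCoeff H ρeq c f n (P t)) Φ
      = c n * pair T volume (fun t => densCoeff H g f n (ρ t)) Φ + c n *
        -pair T volume (fun t => pint (vertMeasure H) (fun z => f n z * ρeq z) (w t))
          (pd dirT Φ) := by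
  obtain ⟨r, hr, hr'⟩ := hw.exists_repr_test (hΦ.pd dirT)
  obtain ⟨q, hq, hq'⟩ := hρ.exists_repr_test hΦ
  obtain ⟨Q, hQ, hQ'⟩ := PressureIntegrable.exists_repr hsol.pressure_integrable hΦ
  have hri : Integrable (fun z => r z * ρeq z) (vertMeasure H) :=
    h.bdd.integrable_mul (integrable_of_memLp_two hr)
  have hqi : Integrable (fun z => g * q z) (vertMeasure H) :=
    (integrable_of_memLp_two hq).const_mul g
  have hA : Integrable (fun z => r z * ρeq z - g * q z) (vertMeasure H) := hri.sub hqi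
  -- The vertical momentum equation identifies the weak derivative of `Q`, which is thus absolutely
  -- continuous.
  obtain ⟨C, hC⟩ := eq_primitive_of_weak_deriv h.hH hA hQ fun χ hχ => by
    have h1 := hsol.vertical _ (hΦ.tens3 hχ)
    rw [pd_dirT_tens3 hΦ.1 hχ.1, pd_dirZ_tens3 hΦ.1 hχ.1, (hQ' _ hχ.bddVert_deriv).1,
      pair_congr (u' := w) (ψ' := tens3 (pd dirT Φ) fun z => χ z * ρeq z)
        (fun t x => by simp only [tens3]; ring), (hr' _ (hχ.bddVert.mul h.bdd)).1,
      pair_congr (u := fun t x => ρ t x * g) (u' := ρ) (ψ' := tens3 Φ fun z => g * χ z)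
        (fun t x => by simp only [tens3]; ring), (hq' _ (hχ.bddVert.const_mul g)).1] at h1
    simp_rw [sub_mul]
    rw [integral_sub (hχ.bddVert.integrable_mul hri) (hχ.bddVert.integrable_mul hqi),
      integral_congr_ae (f := fun z => r z * ρeq z * χ z)
        (g := fun z => r z * (χ z * ρeq z)) (.of_forall fun z => by ring),
      integral_congr_ae (f := fun z => g * q z * χ z)
        (g := fun z => q z * (g * χ z)) (.of_forall fun z => by ring)]
    linarith
  have h2 := (prim_integral h.hH hA C).ibp h.hH (IsModes.prim h hm hn)
  -- The boundary terms vanish through `f n`, so the unknown constant `C` plays no role.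
  rw [(hm.eigen n hn).bot, (hm.eigen n hn).top] at h2
  have h3 : ∫ z, Q z * gMode H ρeq c f n z ∂(vertMeasure H)
      = c n * ∫ z, (C + ∫ y in (-H)..z, (r y * ρeq y - g * q y)) *
        derivWithin (f n) (Icc (-H) 0) z ∂(vertMeasure H) := by
    rw [← integral_const_mul]
    refine integral_congr_ae ?_
    filter_upwards [hC, hm.gMode_eq hn] with z h4 h5
    rw [h5, h4]; ring
  have hb := IsModes.bdd h hm hn
  have h4 : ∫ z, (r z * ρeq z - g * q z) * f n z ∂(vertMeasure H)
      = ∫ z, r z * (f n z * ρeq z) ∂(vertMeasure H)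
        - ∫ z, q z * (g * f n z) ∂(vertMeasure H) := by
    rw [← integral_sub ((hb.mul h.bdd).integrable_mul (integrable_of_memLp_two hr))
      ((hb.const_mul g).integrable_mul (integrable_of_memLp_two hq))]
    exact integral_congr_ae (.of_forall fun z => by ring)
  simp_rw [presCoeff_eq, densCoeff_eq]
  rw [(hQ' _ (IsModes.bdd_gMode h hm n)).2, (hq' _ (hb.const_mul g)).2,
    (hr' _ (hb.mul h.bdd)).2, h3, h2, h4]
  ring

/-- The expansion of `∫ w f_n ρ_eq dz` in terms of the coefficients `w_m`. -/
theorem IsLinearSolution.hasSum_pair (hsol : IsLinearSolution T H g ρeq V w ρ P)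
    (h : IsStratified H g ρeq) (hm : IsModes H g ρeq c f)
    (hV : ∀ i, ContL2 T (volume.prod (vertMeasure H)) (fun t => V t i))
    (hw : ContL2 T (volume.prod (vertMeasure H)) w) {n : ℕ} (hn : 1 ≤ n)
    {Φ : ℝ × Hor d → ℝ} (hΦ : IsTest (Ioo 0 T ×ˢ univ) Φ) :
    HasSum (fun m => interaction H ρeq f (m + 1) n *
        pair T volume (fun t => vertCoeff H g ρeq f (m + 1) (w t)) Φ)
      (pair T volume (fun t => pint (vertMeasure H) (fun z => f n z * ρeq z) (w t)) Φ) := by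
  obtain ⟨C, hC0, hC⟩ := IsModes.hasSum_interaction h hm hn
  obtain ⟨G, hG⟩ := hΦ.exists_testFamily
  choose Gi hGi using fun i : Fin d => (hΦ.pd (dirX (e i))).exists_testFamily
  choose M hM0 hM using fun i => (hV i).exists_bound
  -- A bound, uniform in time, of the vertical `L²` norm of the tested divergence. It makes the
  -- partial sums of absolute values bounded independently of `t`.
  set D : ℝ := ∑ i, M i * (eLpNorm (Gi i) 2 volume).toReal with hD
  have hD0 : 0 ≤ D := Finset.sum_nonneg fun i _ => mul_nonneg (hM0 i) ENNReal.toReal_nonneg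
  have hbound : ∀ t ∈ Icc 0 T,
      (eLpNorm (divSlice V (fun X => Φ (t, X)) t) 2 (vertMeasure H)).toReal ≤ D := by
    intro t ht
    have hη := hΦ.slice t
    have hmem : ∀ i, MemLp (slice volume (pd (e i) fun X => Φ (t, X)) (V t i)) 2
        (vertMeasure H) := fun i => memLp_slice ((hV i).1 t ht) (hη.pd (e i)).memLp
    have h1 : eLpNorm (divSlice V (fun X => Φ (t, X)) t) 2 (vertMeasure H)
        ≤ ∑ i, eLpNorm (slice volume (pd (e i) fun X => Φ (t, X)) (V t i)) 2
          (vertMeasure H) := by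
      have := eLpNorm_sum_le (s := Finset.univ) (fun i _ => (hmem i).1) (p := 2) (by norm_num)
      refine le_trans (le_of_eq (congrArg (fun u => eLpNorm u 2 (vertMeasure H)) ?_)) this
      funext z
      rw [divSlice, Finset.sum_apply]
    refine (ENNReal.toReal_mono (ENNReal.sum_ne_top.2 fun i _ => (hmem i).2.ne) h1).trans ?_
    rw [ENNReal.toReal_sum fun i _ => (hmem i).2.ne]
    refine Finset.sum_le_sum fun i _ => ?_
    have h2 := eLpNorm_slice_le ((hV i).1 t ht) (hη.pd (e i)).memLp
    have h3 : (pd (e i) fun X => Φ (t, X)) = fun X => pd (dirX (e i)) Φ (t, X) :=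
      funext fun X => pd_slice hΦ.1 (e i) t X
    refine (ENNReal.toReal_mono (ENNReal.mul_ne_top ((hV i).1 t ht).2.ne
      (hη.pd (e i)).memLp.2.ne) h2).trans ?_
    rw [ENNReal.toReal_mul]
    refine mul_le_mul (hM i t ht) ?_ ENNReal.toReal_nonneg (hM0 i)
    rw [h3]
    exact ENNReal.toReal_mono (hGi i).memLp.2.ne ((hGi i).eLpNorm_le t)
  have hk : ∀ m, BddVert H fun z => f (m + 1) z * (ρeq z * bruntSq g ρeq z) := fun m =>
    IsModes.bdd_vert h hm (by omega)
  have hpt : ∀ t ∈ Icc 0 T,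
      HasSum (fun m => interaction H ρeq f (m + 1) n *
        ∫ X, vertCoeff H g ρeq f (m + 1) (w t) X * Φ (t, X))
        (∫ X, pint (vertMeasure H) (fun z => f n z * ρeq z) (w t) X * Φ (t, X)) ∧
      ∀ s : Finset ℕ, ∑ m ∈ s, |interaction H ρeq f (m + 1) n *
        ∫ X, vertCoeff H g ρeq f (m + 1) (w t) X * Φ (t, X)| ≤ C * (D ^ 2 + 1) := by
    intro t ht
    have hη := hΦ.slice t
    obtain ⟨h1, h2⟩ := hsol.slice_eq h.hH hV hw hη ht
    obtain ⟨h3, h4⟩ := hC _ _ (memLp_divSlice hV hη ht) h1 h2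
    have e1 : ∀ m, ∫ X, vertCoeff H g ρeq f (m + 1) (w t) X * Φ (t, X)
        = ∫ z, slice volume (fun X => Φ (t, X)) (w t) z * f (m + 1) z *
          (ρeq z * bruntSq g ρeq z) ∂(vertMeasure H) := by
      intro m
      rw [vertCoeff_eq, integral_pint_eq_slice (hw.1 t ht) hη.memLp (hk m).memLp]
      exact integral_congr_ae (.of_forall fun z => by ring)
    have e2 : ∫ X, pint (vertMeasure H) (fun z => f n z * ρeq z) (w t) X * Φ (t, X)
        = ∫ z, slice volume (fun X => Φ (t, X)) (w t) z * f n z * ρeq z ∂(vertMeasure H) := by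
      rw [integral_pint_eq_slice (hw.1 t ht) hη.memLp ((IsModes.bdd h hm hn).mul h.bdd).memLp]
      exact integral_congr_ae (.of_forall fun z => by ring)
    simp_rw [e1, e2]
    refine ⟨h3, fun s => (h4 s).trans ?_⟩
    have := hbound t ht
    gcongr
  set F : ℕ → ℝ → ℝ := fun m t => interaction H ρeq f (m + 1) n *
    ∫ X, vertCoeff H g ρeq f (m + 1) (w t) X * Φ (t, X) with hF
  have hFi : ∀ m, Integrable (F m) (volume.restrict (Ioo 0 T)) := by
    intro m
    simp only [hF, vertCoeff_eq]
    exact ((hw.pint (hk m).memLp).integrableOn_integral hG).const_mul _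
  have hsum : Summable fun m => ∫ t in Ioo 0 T, ‖F m t‖ := by
    refine summable_of_sum_le (c := ∫ _ in Ioo 0 T, C * (D ^ 2 + 1))
      (fun m => integral_nonneg fun t => norm_nonneg _) fun s => ?_
    rw [← integral_finsetSum _ fun m _ => (hFi m).norm]
    refine setIntegral_mono_on (integrable_finsetSum _ fun m _ => (hFi m).norm)
      (integrable_const _) measurableSet_Ioo fun t ht => ?_
    exact (hpt t (Ioo_subset_Icc_self ht)).2 s
  -- Bounded partial sums of the integrated absolute values justify exchanging the series with the
  -- time integral.
  have hfin := hasSum_integral_of_summable_integral_norm hFi hsum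
  have e3 : ∫ t in Ioo 0 T, ∑' m, F m t
      = pair T volume (fun t => pint (vertMeasure H) (fun z => f n z * ρeq z) (w t)) Φ :=
    setIntegral_congr_fun measurableSet_Ioo fun t ht =>
      (hpt t (Ioo_subset_Icc_self ht)).1.tsum_eq
  rw [e3] at hfin
  have e4 : ∀ m, ∫ t in Ioo 0 T, F m t = interaction H ρeq f (m + 1) n *
      pair T volume (fun t => vertCoeff H g ρeq f (m + 1) (w t)) Φ := fun m =>
    integral_const_mul _ _
  simpa only [e4] using hfin

end equations

end Strat

end

noncomputable section

namespace Strat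

/-! ### The modal equations -/

section sums

variable {d : ℕ} {T : ℝ}

theorem pd_finsetSum {ι F : Type*} [NormedAddCommGroup F] [NormedSpace ℝ F] (s : Finset ι)
    {φ : ι → F → ℝ} (h : ∀ i ∈ s, ContDiff ℝ ∞ (φ i)) (v : F) (x : F) :
    pd v (fun y => ∑ i ∈ s, φ i y) x = ∑ i ∈ s, pd v (φ i) x := by
  simp only [pd]
  rw [fderiv_fun_sum fun i hi => (h i hi).differentiable (by simp) x]
  simp

theorem ContL2.pair_finsetSum {u : ℝ → Hor d → ℝ} (hu : ContL2 T volume u) {ι : Type*}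
    (s : Finset ι) {O : Set (ℝ × Hor d)} {ψ : ι → ℝ × Hor d → ℝ} (hψ : ∀ i, IsTest O (ψ i)) :
    pair T volume u (fun p => ∑ i ∈ s, ψ i p) = ∑ i ∈ s, pair T volume u (ψ i) := by
  choose G hG using fun i => (hψ i).exists_testFamily
  simp only [pair]
  rw [← integral_finsetSum _ fun i _ => hu.integrableOn_integral (hG i)]
  refine setIntegral_congr_fun measurableSet_Ioo fun t ht => ?_
  simp only [Finset.mul_sum]
  exact integral_finsetSum _ fun i _ =>
    (hu.1 t (Ioo_subset_Icc_self ht)).integrable_mul ((hG i).memLp' t)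

end sums

section equations

variable {d : ℕ} {T H g : ℝ} {ρeq : ℝ → ℝ} {c : ℕ → ℝ} {f : ℕ → ℝ → ℝ}
  {V : ℝ → Fin d → Hor d × ℝ → ℝ} {w ρ P : ℝ → Hor d × ℝ → ℝ}

theorem contL2_velCoeff (h : IsStratified H g ρeq) (hm : IsModes H g ρeq c f)
    (hV : ∀ i, ContL2 T (volume.prod (vertMeasure H)) (fun t => V t i)) (n : ℕ) (i : Fin d) :
    ContL2 T volume fun t => velCoeff H ρeq c f n (V t i) := by
  simp_rw [velCoeff_eq]
  exact (hV i).pint (IsModes.bdd_vel h hm n).memLp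

theorem pint_congr_ae {u v : Hor d × ℝ → ℝ} (h : u =ᵐ[stripMeasure d H] v) (k : ℝ → ℝ) :
    pint (vertMeasure H) k u =ᵐ[volume] pint (vertMeasure H) k v := by
  rw [stripMeasure_eq] at h
  filter_upwards [Measure.ae_ae_of_ae_prod h] with X hX
  refine integral_congr_ae ?_
  filter_upwards [hX] with z hz
  rw [hz]

theorem IsLinearSolution.pair_vertCoeff (hsol : IsLinearSolution T H g ρeq V w ρ P)
    (h : IsStratified H g ρeq) (hm : IsModes H g ρeq c f)
    (hV : ∀ i, ContL2 T (volume.prod (vertMeasure H)) (fun t => V t i))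
    (hw : ContL2 T (volume.prod (vertMeasure H)) w) {n : ℕ} (hn : 1 ≤ n)
    {Φ : ℝ × Hor d → ℝ} (hΦ : IsTest (Ioo 0 T ×ˢ univ) Φ) :
    pair T volume (fun t => vertCoeff H g ρeq f n (w t)) Φ
      = c n * ∑ i, pair T volume (fun t => velCoeff H ρeq c f n (V t i))
        (pd (dirX (e i)) Φ) := by
  choose G hG using fun i : Fin d => (hΦ.pd (dirX (e i))).exists_testFamily
  simp only [pair]
  rw [← integral_finsetSum _ fun i _ =>
    (contL2_velCoeff h hm hV n i).integrableOn_integral (hG i), ← integral_const_mul]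
  refine setIntegral_congr_fun measurableSet_Ioo fun t ht => ?_
  have := hsol.vertCoeff_eq_div h hm hV hw hn (hΦ.slice t) (Ioo_subset_Icc_self ht)
  simp_rw [pd_slice hΦ.1] at this
  exact this

/-- Irrotationality allows to exchange the roles of the components of `V_n`. -/
theorem ZeroVerticalVorticity.pair_velCoeff (hcurl : ZeroVerticalVorticity T H V)
    (h : IsStratified H g ρeq) (hm : IsModes H g ρeq c f)
    (hV : ∀ i, ContL2 T (volume.prod (vertMeasure H)) (fun t => V t i)) (n : ℕ)
    {Φ : ℝ × Hor d → ℝ} (hΦ : IsTest (Ioo 0 T ×ˢ univ) Φ) (i j : Fin d) :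
    pair T volume (fun t => velCoeff H ρeq c f n (V t j)) (pd (dirX (e i)) Φ)
      = pair T volume (fun t => velCoeff H ρeq c f n (V t i)) (pd (dirX (e j)) Φ) := by
  refine setIntegral_congr_fun measurableSet_Ioo fun t ht => ?_
  have := hcurl.pint hV (hΦ.slice t) (Ioo_subset_Icc_self ht) (IsModes.bdd_vel h hm n) i j
  simp_rw [pd_slice hΦ.1] at this
  simp only [velCoeff_eq]
  exact this

/-- `∂_i w_n = - c_n Δ V_{n,i}`, differentiated in time. -/
theorem IsLinearSolution.pair_vertCoeff_grad (hsol : IsLinearSolution T H g ρeq V w ρ P)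
    (h : IsStratified H g ρeq) (hm : IsModes H g ρeq c f)
    (hV : ∀ i, ContL2 T (volume.prod (vertMeasure H)) (fun t => V t i))
    (hw : ContL2 T (volume.prod (vertMeasure H)) w) (hcurl : ZeroVerticalVorticity T H V)
    {n : ℕ} (hn : 1 ≤ n) {φ : ℝ × Hor d → ℝ} (hφ : IsTest (Ioo 0 T ×ˢ univ) φ) (i : Fin d) :
    pair T volume (fun t => vertCoeff H g ρeq f n (w t)) (pd dirT (pd (dirX (e i)) φ))
      = c n * pair T volume (fun t => velCoeff H ρeq c f n (V t i)) (pd dirT (lapX φ)) := by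
  have e0 : pd dirT (lapX φ)
      = fun p => ∑ j : Fin d, pd (dirX (e j)) (pd (dirX (e j)) (pd dirT φ)) p := by
    funext p
    unfold lapX
    rw [pd_finsetSum _ fun j _ => ((hφ.pd _).pd _).1]
    refine Finset.sum_congr rfl fun j _ => ?_
    rw [pd_comm (hφ.pd _).1, pd_comm hφ.1]
  rw [hsol.pair_vertCoeff h hm hV hw hn ((hφ.pd _).pd _), e0,
    (contL2_velCoeff h hm hV n i).pair_finsetSum _ fun j =>
      ((hφ.pd dirT).pd (dirX (e j))).pd (dirX (e j))]
  congr 1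
  refine Finset.sum_congr rfl fun j _ => ?_
  -- Here the curl condition trades `∂_i V_j` for `∂_j V_i`, turning the gradient of the divergence
  -- into a Laplacian.
  rw [← hcurl.pair_velCoeff h hm hV n ((hφ.pd dirT).pd (dirX (e j))) i j, pd_comm hφ.1,
    pd_comm (hφ.pd _).1]

/-- Since `g ρ_eq' = -ρ_eq N²`, weighting the density equation by `g f_n` gives `∂_t ρ_n = w_n`; it
remains to replace `w_n` by `-c_n ∇·V_n`. -/
theorem IsLinearSolution.density_modal (hsol : IsLinearSolution T H g ρeq V w ρ P)
    (h : IsStratified H g ρeq) (hm : IsModes H g ρeq c f)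
    (hV : ∀ i, ContL2 T (volume.prod (vertMeasure H)) (fun t => V t i))
    (hw : ContL2 T (volume.prod (vertMeasure H)) w)
    (hρ : ContL2 T (volume.prod (vertMeasure H)) ρ) {n : ℕ} (hn : 1 ≤ n)
    {φ : ℝ × Hor d → ℝ} (hφ : IsTest (Ioo 0 T ×ˢ univ) φ) :
    -pair T volume (fun t => densCoeff H g f n (ρ t)) (pd dirT φ)
      + c n * ∑ i : Fin d, -pair T volume (fun t => velCoeff H ρeq c f n (V t i))
        (pd (dirX (e i)) φ) = 0 := by
  have h1 := hsol.density_pint h hw hρ hφ (IsModes.bdd_dens h hm hn)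
  have h2 : ∀ t, pint (vertMeasure H) (fun z => g * f n z * deriv ρeq z) (w t)
      = fun X => -vertCoeff H g ρeq f n (w t) X := by
    intro t
    funext X
    rw [vertCoeff_eq, pint, pint, ← integral_neg]
    refine integral_congr_ae ?_
    filter_upwards [h.weight_eq] with z hz
    rw [hz]; ring
  have h3 : pair T volume (fun t X => -vertCoeff H g ρeq f n (w t) X) φ
      = -pair T volume (fun t => vertCoeff H g ρeq f n (w t)) φ := by
    simp only [pair, neg_mul, integral_neg]
  simp_rw [h2] at h1
  rw [h3, hsol.pair_vertCoeff h hm hV hw hn hφ] at h1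
  simp_rw [densCoeff_eq, Finset.sum_neg_distrib]
  rw [← h1]; ring

theorem IsLinearSolution.pressure_modal (hsol : IsLinearSolution T H g ρeq V w ρ P)
    (h : IsStratified H g ρeq) (hm : IsModes H g ρeq c f)
    (hV : ∀ i, ContL2 T (volume.prod (vertMeasure H)) (fun t => V t i))
    (hw : ContL2 T (volume.prod (vertMeasure H)) w)
    (hρ : ContL2 T (volume.prod (vertMeasure H)) ρ) {n : ℕ} (hn : 1 ≤ n)
    {φ : ℝ × Hor d → ℝ} (hφ : IsTest (Ioo 0 T ×ˢ univ) φ) :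
    ∃ S : ℝ, HasSum (fun m : ℕ => interaction H ρeq f (m + 1) n *
        -pair T volume (fun t => vertCoeff H g ρeq f (m + 1) (w t)) (pd dirT φ)) S ∧
      pair T volume (fun t => presCoeff H ρeq c f n (P t)) φ
        = c n * pair T volume (fun t => densCoeff H g f n (ρ t)) φ + c n * S := by
  refine ⟨_, ?_, hsol.vertical_pint h hm hw hρ hn hφ⟩
  simpa only [mul_neg] using (hsol.hasSum_pair h hm hV hw hn (hφ.pd dirT)).neg

/-- Elimination of the pressure: the formula for `P_n`, tested with `∂_i φ`, is inserted in the
projected horizontal momentum equation, and `∂_i w_m` is replaced by `-c_m ΔV_m`. -/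
theorem IsLinearSolution.velocity_modal (hsol : IsLinearSolution T H g ρeq V w ρ P)
    (h : IsStratified H g ρeq) (hm : IsModes H g ρeq c f)
    (hV : ∀ i, ContL2 T (volume.prod (vertMeasure H)) (fun t => V t i))
    (hw : ContL2 T (volume.prod (vertMeasure H)) w)
    (hρ : ContL2 T (volume.prod (vertMeasure H)) ρ) (hcurl : ZeroVerticalVorticity T H V)
    {n : ℕ} (hn : 1 ≤ n) {φ : ℝ × Hor d → ℝ} (hφ : IsTest (Ioo 0 T ×ˢ univ) φ) (i : Fin d) :
    ∃ S : ℝ, HasSum (fun m : ℕ => c (m + 1) * c n * interaction H ρeq f (m + 1) n *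
        -pair T volume (fun t => velCoeff H ρeq c f (m + 1) (V t i)) (pd dirT (lapX φ))) S ∧
      -pair T volume (fun t => velCoeff H ρeq c f n (V t i)) (pd dirT φ) - S
        + c n * -pair T volume (fun t => densCoeff H g f n (ρ t)) (pd (dirX (e i)) φ) = 0 := by
  obtain ⟨S, hS, hP⟩ := hsol.pressure_modal h hm hV hw hρ hn (hφ.pd (dirX (e i)))
  refine ⟨c n * S, (hS.mul_left (c n)).congr_fun fun m => ?_, ?_⟩
  · rw [hsol.pair_vertCoeff_grad h hm hV hw hcurl (by omega) hφ i]
    ring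
  · have h1 := hsol.horizontal_pint h hV hφ i (IsModes.bdd_gMode h hm n)
    simp_rw [presCoeff_eq] at hP
    simp_rw [velCoeff_eq]
    rw [hP] at h1
    linarith

/-- The mode zero of the divergence is a multiple of its mean in `z`, which vanishes because `w`
vanishes at both ends; the curl vanishes by hypothesis. -/
theorem IsLinearSolution.velCoeff_zero (hsol : IsLinearSolution T H g ρeq V w ρ P)
    (h : IsStratified H g ρeq) (hm : IsModes H g ρeq c f) (hd : 0 < d)
    (hV : ∀ i, ContL2 T (volume.prod (vertMeasure H)) (fun t => V t i))
    (hw : ContL2 T (volume.prod (vertMeasure H)) w) (hcurl : ZeroVerticalVorticity T H V)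
    {t : ℝ} (ht : t ∈ Icc 0 T) (i : Fin d) : velCoeff H ρeq c f 0 (V t i) =ᵐ[volume] 0 := by
  refine eq_zero_of_div_curl hd (U := fun i => velCoeff H ρeq c f 0 (V t i))
    (fun i => (contL2_velCoeff h hm hV 0 i).1 t ht) (fun φ hφ => ?_) (fun φ hφ i j => ?_) i
  · simp_rw [velCoeff_eq]
    rw [← integral_divSlice_mul hV hφ ht (IsModes.bdd_vel h hm 0)]
    have h1 := Strat.integral_gMode_zero h (c := c) (f := f) (divSlice V φ t)
    rw [(hsol.slice_eq h.hH hV hw hφ ht).2, mul_zero] at h1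
    simpa only [mul_assoc] using h1
  · simp_rw [velCoeff_eq]
    exact hcurl.pint hV hφ ht (IsModes.bdd_vel h hm 0) i j

end equations

end Strat

end

noncomputable section

namespace Strat

/-! ### Distributions that do not depend on the horizontal variable -/

section horizontallyConstant

variable {d : ℕ} {T : ℝ}

instance isAddHaarMeasure_volume_prod :
    (volume : Measure (ℝ × Hor d)).IsAddHaarMeasure :=
  Measure.prod.instIsAddHaarMeasure volume volume

theorem ContDiffBump.isTest {E : Type*} [NormedAddCommGroup E] [NormedSpace ℝ E]
    [HasContDiffBump E] [FiniteDimensional ℝ E] {a : E} (b : ContDiffBump a) {O : Set E}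
    (h : Metric.closedBall a b.rOut ⊆ O) : IsTest O b :=
  ⟨b.contDiff, b.hasCompactSupport, b.tsupport_eq ▸ h⟩

variable {p : ℝ × Hor d → ℝ}

/-- The factor `χ` removes the possible singularities at `t = 0` and `t = T`, so that the product
can be mollified on the whole space. -/
theorem locallyIntegrable_cutoff
    (hp : ∀ Φ, IsTest (Ioo 0 T ×ˢ univ) Φ → Integrable (fun q => p q * Φ q) volume)
    {χ : ℝ → ℝ} (hχ : IsTest (Ioo 0 T) χ) :
    LocallyIntegrable (fun q : ℝ × Hor d => χ q.1 * p q) volume := by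
  refine locallyIntegrable_iff.2 fun K hK => ?_
  obtain ⟨R, hR⟩ := (hK.image continuous_snd).isBounded.subset_closedBall (0 : Hor d)
  set b : ContDiffBump (0 : Hor d) := ⟨max R 1, max R 1 + 1, by positivity, by linarith⟩ with hb
  have h1 := hp _ (hχ.tens (ContDiffBump.isTest b (subset_univ _)))
  refine (h1.integrableOn (s := K)).congr_fun_ae ?_
  filter_upwards [ae_restrict_mem hK.measurableSet] with q hq
  have h2 : b q.2 = 1 := b.one_of_mem_closedBall
    (Metric.closedBall_subset_closedBall (le_max_left _ _) (hR ⟨q, hq, rfl⟩))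
  simp only [tens, h2]
  ring

/-- The horizontal derivative of the convolution falls on `θ`. Up to sign it is `p` integrated
against a horizontal derivative of the test function `χ(t') θ(q - ·)`, because `χ` does not depend
on the horizontal variable. -/
theorem convolution_horizontally_constant
    (hp : ∀ Φ, IsTest (Ioo 0 T ×ˢ univ) Φ → Integrable (fun q => p q * Φ q) volume)
    (h0 : ∀ Φ, IsTest (Ioo 0 T ×ˢ univ) Φ → ∀ i : Fin d,
      ∫ q, p q * pd (dirX (e i)) Φ q = 0)
    {χ : ℝ → ℝ} (hχ : IsTest (Ioo 0 T) χ) {θ : ℝ × Hor d → ℝ} (hθ : IsTest univ θ)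
    (t : ℝ) (X Y : Hor d) :
    convolution θ (fun q => χ q.1 * p q) (ContinuousLinearMap.lsmul ℝ ℝ) volume (t, X)
      = convolution θ (fun q => χ q.1 * p q) (ContinuousLinearMap.lsmul ℝ ℝ) volume (t, Y) := by
  rw [← convolution_flip]
  set L := (ContinuousLinearMap.lsmul ℝ ℝ : ℝ →L[ℝ] ℝ →L[ℝ] ℝ).flip with hL
  set P : ℝ × Hor d → ℝ := fun q => χ q.1 * p q with hP
  have hPl : LocallyIntegrable P volume := locallyIntegrable_cutoff hp hχ
  have hd : ∀ q, HasFDerivAt (convolution P θ L volume)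
      (convolution P (fderiv ℝ θ) (L.precompR (ℝ × Hor d)) volume q) q := fun q =>
    hθ.2.1.hasFDerivAt_convolution_right L hPl (hθ.1.of_le (by simp)) q
  have hz : ∀ q (i : Fin d),
      convolution P (fderiv ℝ θ) (L.precompR (ℝ × Hor d)) volume q (dirX (e i)) = 0 := by
    intro q i
    rw [convolution_precompR_apply L hPl (hθ.2.1.fderiv (𝕜 := ℝ))
      (hθ.1.continuous_fderiv (by simp))]
    have hθd := hθ.1.differentiable (by simp)
    have hχd := hχ.1.differentiable (by simp)
    have hr : IsTest univ fun q' => θ (q - q') := by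
      refine ⟨hθ.1.comp (contDiff_const.sub contDiff_id), ?_, subset_univ _⟩
      exact hθ.2.1.comp_homeomorph (Homeomorph.subLeft q)
    have hχ1 : ContDiff ℝ ∞ fun q' : ℝ × Hor d => χ q'.1 := hχ.1.comp contDiff_fst
    have hΦ : IsTest (Ioo 0 T ×ˢ univ) fun q' : ℝ × Hor d => χ q'.1 * θ (q - q') := by
      refine ⟨hχ1.mul hr.1, hr.2.1.mul_left, fun q' hq' => ⟨hχ.2.2 ?_, mem_univ _⟩⟩
      have h1 : tsupport (fun q' : ℝ × Hor d => χ q'.1 * θ (q - q'))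
          ⊆ Prod.fst ⁻¹' tsupport χ :=
        closure_minimal (fun x hx => subset_tsupport _ (left_ne_zero_of_mul hx))
          ((isClosed_tsupport χ).preimage continuous_fst)
      exact h1 hq'
    have h2 := h0 _ hΦ i
    have h3 : ∀ q', pd (dirX (e i)) (fun q' : ℝ × Hor d => χ q'.1 * θ (q - q')) q'
        = -(χ q'.1 * fderiv ℝ θ (q - q') (dirX (e i))) := by
      intro q'
      have h4 : HasFDerivAt (fun q' : ℝ × Hor d => q - q')
          (-ContinuousLinearMap.id ℝ (ℝ × Hor d)) q' := (hasFDerivAt_id q').const_sub q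
      have h5 := ((hχd q'.1).hasFDerivAt.comp q' hasFDerivAt_fst).mul
        ((hθd (q - q')).hasFDerivAt.comp q' h4)
      have h6 : fderiv ℝ (fun q' : ℝ × Hor d => χ q'.1 * θ (q - q')) q' = _ := h5.fderiv
      rw [pd, h6]
      simp [dirX]
    simp_rw [h3] at h2
    rw [← neg_eq_zero, ← h2, convolution, ← integral_neg]
    refine integral_congr_ae (.of_forall fun q' => ?_)
    simp [hL, hP]
    ring
  have hs : ∀ Z, HasFDerivAt (fun Z => convolution P θ L volume (t, Z)) (0 : Hor d →L[ℝ] ℝ) Z := by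
    intro Z
    have h1 : HasFDerivAt (fun Z : Hor d => (t, Z)) (ContinuousLinearMap.inr ℝ ℝ (Hor d)) Z :=
      hasFDerivAt_prodMk_right t Z
    have h2 := (hd (t, Z)).comp Z h1
    have h3 : (convolution P (fderiv ℝ θ) (L.precompR (ℝ × Hor d)) volume (t, Z)).comp
        (ContinuousLinearMap.inr ℝ ℝ (Hor d)) = 0 := by
      refine ContinuousLinearMap.coe_injective
        ((EuclideanSpace.basisFun (Fin d) ℝ).toBasis.ext fun i => ?_)
      have := hz (t, Z) i
      simp only [OrthonormalBasis.coe_toBasis, EuclideanSpace.basisFun_apply]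
      exact this
    rw [h3] at h2
    exact h2
  exact is_const_of_fderiv_eq_zero (fun Z => (hs Z).differentiableAt)
    (fun Z => (hs Z).fderiv) X Y

/-- A locally integrable function on `(0, T) × ℝ^d` with zero horizontal gradient depends on
time only. -/
theorem exists_eq_time_function
    (hp : ∀ Φ, IsTest (Ioo 0 T ×ˢ univ) Φ → Integrable (fun q => p q * Φ q) volume)
    (h0 : ∀ Φ, IsTest (Ioo 0 T ×ˢ univ) Φ → ∀ i : Fin d,
      ∫ q, p q * pd (dirX (e i)) Φ q = 0) :
    ∃ l : ℝ → ℝ, ∀ᵐ t ∂(volume.restrict (Ioo 0 T)), ∀ᵐ X : Hor d, p (t, X) = l t := by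
  rcases le_or_gt T 0 with hT | hT
  · exact ⟨0, by simp [Ioo_eq_empty_of_le hT]⟩
  have hloc : ∀ χ, IsTest (Ioo 0 T) χ →
      ∀ᵐ t : ℝ, ∃ y, ∀ᵐ X : Hor d, χ t * p (t, X) = y := by
    intro χ hχ
    -- The ratio two between outer and inner radii is the bound required for almost everywhere
    -- convergence of the mollifications.
    set b : ℕ → ContDiffBump (0 : ℝ × Hor d) := fun k =>
      ⟨1 / ((k : ℝ) + 1), 2 * (1 / ((k : ℝ) + 1)), by positivity,
        by have : (0 : ℝ) < 1 / ((k : ℝ) + 1) := by positivity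
           linarith⟩ with hb
    have hb0 : Tendsto (fun k => (b k).rOut) atTop (𝓝 0) := by
      have := (tendsto_one_div_add_atTop_nhds_zero_nat (𝕜 := ℝ)).const_mul 2
      simpa [hb] using this
    have h1 := ContDiffBump.ae_convolution_tendsto_right_of_locallyIntegrable (K := 2) hb0
      (.of_forall fun k => le_rfl) (locallyIntegrable_cutoff hp hχ)
    rw [Measure.volume_eq_prod] at h1
    filter_upwards [Measure.ae_ae_of_ae_prod h1] with t ht
    have hθ : ∀ k, IsTest univ ((b k).normed (volume : Measure (ℝ × Hor d))) := fun k =>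
      ⟨(b k).contDiff_normed, (b k).hasCompactSupport_normed, subset_univ _⟩
    obtain ⟨X₀, hX₀⟩ := ht.exists
    refine ⟨χ t * p (t, X₀), ?_⟩
    filter_upwards [ht] with X hX
    refine tendsto_nhds_unique hX (hX₀.congr fun k => ?_)
    exact convolution_horizontally_constant hp h0 hχ (hθ k) t X₀ X
  -- The radii tend to `T / 2` from below, so the balls on which the cutoffs `χ k` are positive
  -- exhaust `(0, T)` while their supports stay inside.
  set r : ℕ → ℝ := fun k => T / 2 * (1 - 1 / ((k : ℝ) + 2)) with hr
  have hr1 : ∀ k, 0 < r k ∧ r k < T / 2 := by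
    intro k
    have h1 : 1 / ((k : ℝ) + 2) < 1 := by
      rw [div_lt_one (by positivity)]
      have : (0 : ℝ) ≤ k := k.cast_nonneg
      linarith
    have h2 : 0 < 1 / ((k : ℝ) + 2) := by positivity
    constructor
    · exact mul_pos (by linarith) (by linarith)
    · simp only [hr]; nlinarith
  have hrlim : Tendsto r atTop (𝓝 (T / 2)) := by
    have h1 : Tendsto (fun k : ℕ => 1 / ((k : ℝ) + 2)) atTop (𝓝 0) := by
      have := (tendsto_add_atTop_iff_nat 1).2 (tendsto_one_div_add_atTop_nhds_zero_nat (𝕜 := ℝ))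
      refine this.congr fun k => ?_
      push_cast
      ring
    have := (h1.const_sub 1).const_mul (T / 2)
    simpa [hr] using this
  set χ : ℕ → ContDiffBump (T / 2) := fun k =>
    ⟨r k / 2, r k, by have := (hr1 k).1; linarith, by have := (hr1 k).1; linarith⟩ with hχ
  have hχT : ∀ k, IsTest (Ioo 0 T) (χ k) := by
    intro k
    refine ContDiffBump.isTest (χ k) fun t ht => ?_
    rw [Metric.mem_closedBall, Real.dist_eq, abs_le] at ht
    have h2 : (χ k).rOut = r k := rfl
    have := hr1 k
    constructor <;> linarith [ht.1, ht.2]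
  have hall : ∀ᵐ t ∂(volume.restrict (Ioo 0 T)), ∃ y, ∀ᵐ X : Hor d, p (t, X) = y := by
    have h1 : ∀ᵐ t : ℝ, ∀ k, ∃ y, ∀ᵐ X : Hor d, χ k t * p (t, X) = y :=
      ae_all_iff.2 fun k => hloc _ (hχT k)
    filter_upwards [ae_restrict_of_ae h1, ae_restrict_mem measurableSet_Ioo] with t ht htT
    have h2 : |t - T / 2| < T / 2 := by
      rw [abs_lt]
      constructor <;> linarith [htT.1, htT.2]
    obtain ⟨k, hk⟩ := (hrlim.eventually_const_lt h2).exists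
    obtain ⟨y, hy⟩ := ht k
    have h3 : 0 < χ k t := (χ k).pos_of_mem_ball (by rwa [Metric.mem_ball, Real.dist_eq])
    refine ⟨y / χ k t, ?_⟩
    filter_upwards [hy] with X hX
    rw [← hX, mul_div_cancel_left₀ _ h3.ne']
  choose! l hl using fun t (ht : ∃ y, ∀ᵐ X : Hor d, p (t, X) = y) => ht
  exact ⟨l, hall.mono fun t ht => hl t ht⟩

end horizontallyConstant

end Strat

end

noncomputable section

namespace Strat

/-! ### The mode zero of the pressure -/

section pressure

variable {d : ℕ} {T H g : ℝ} {ρeq : ℝ → ℝ} {c : ℕ → ℝ} {f : ℕ → ℝ → ℝ}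
  {V : ℝ → Fin d → Hor d × ℝ → ℝ} {w ρ P : ℝ → Hor d × ℝ → ℝ}

theorem PressureIntegrable.integrable_pint_mul (hP : PressureIntegrable T H P)
    {Φ : ℝ × Hor d → ℝ} (hΦ : IsTest (Ioo 0 T ×ˢ univ) Φ) {k : ℝ → ℝ} (hk : BddVert H k) :
    Integrable (fun q : ℝ × Hor d => pint (vertMeasure H) k (P q.1) q.2 * Φ q) volume := by
  have h1 : Integrable (fun q : ℝ × Hor d => pint (vertMeasure H) k (P q.1) q.2 * Φ q)
      (timeHor d T) := by
    refine (hP.integrable_mul hΦ hk).integral_prod_left.congr (.of_forall fun q => ?_)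
    simp only [pint]
    rw [← integral_mul_const]
    exact integral_congr_ae (.of_forall fun y => by simp only; ring)
  rw [timeHor_eq] at h1
  exact (integrableOn_iff_integrable_of_support_subset fun q hq =>
    hΦ.2.2 (subset_tsupport _ (right_ne_zero_of_mul hq))).1 h1

theorem PressureIntegrable.integral_pint_mul_eq_pair (hP : PressureIntegrable T H P)
    {Φ : ℝ × Hor d → ℝ} (hΦ : IsTest (Ioo 0 T ×ˢ univ) Φ) {k : ℝ → ℝ} (hk : BddVert H k) :
    ∫ q : ℝ × Hor d, pint (vertMeasure H) k (P q.1) q.2 * Φ q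
      = pair T volume (fun t => pint (vertMeasure H) k (P t)) Φ := by
  rw [← setIntegral_eq_integral_of_forall_compl_eq_zero (s := Ioo 0 T ×ˢ univ) fun q hq => by
    rw [image_eq_zero_of_notMem_tsupport fun hq' => hq (hΦ.2.2 hq'), mul_zero], ← timeHor_eq]
  have h1 := (hP.integrable_pint_mul hΦ hk).integrableOn (s := Ioo 0 T ×ˢ univ)
  rw [IntegrableOn, ← timeHor_eq] at h1
  exact integral_prod _ h1

/-- As `V_0 = 0`, the horizontal momentum equation weighted by `g_0` reduces to `∇P_0 = 0`. -/
theorem IsLinearSolution.presCoeff_zero (hsol : IsLinearSolution T H g ρeq V w ρ P)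
    (h : IsStratified H g ρeq) (hm : IsModes H g ρeq c f) (hd : 0 < d)
    (hV : ∀ i, ContL2 T (volume.prod (vertMeasure H)) (fun t => V t i))
    (hw : ContL2 T (volume.prod (vertMeasure H)) w) (hcurl : ZeroVerticalVorticity T H V) :
    ∃ l : ℝ → ℝ, ∀ᵐ t ∂(volume.restrict (Ioo 0 T)),
      presCoeff H ρeq c f 0 (P t) =ᵐ[volume] fun _ => l t := by
  have hP : PressureIntegrable T H P := hsol.pressure_integrable
  have hk := IsModes.bdd_gMode h hm 0
  refine exists_eq_time_function (fun Φ hΦ => hP.integrable_pint_mul hΦ hk) fun Φ hΦ i => ?_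
  have h1 := hsol.horizontal_pint h hV hΦ i hk
  have h2 : pair T volume (fun t => pint (vertMeasure H)
      (fun z => gMode H ρeq c f 0 z * ρeq z) (V t i)) (pd dirT Φ) = 0 := by
    simp_rw [← velCoeff_eq]
    refine setIntegral_eq_zero_of_forall_eq_zero fun t ht => integral_eq_zero_of_ae ?_
    filter_upwards [hsol.velCoeff_zero h hm hd hV hw hcurl (Ioo_subset_Icc_self ht) i] with X hX
    simp [hX]
  rw [h2] at h1
  have h3 := hP.integral_pint_mul_eq_pair (hΦ.pd (dirX (e i))) hk
  refine h3.trans ?_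
  linarith

/-- For `d > 0` the space has infinite measure, so zero is the only square integrable constant. -/
theorem eq_zero_of_ae_eq_const (hd : 0 < d) {u : Hor d → ℝ} (hu : MemLp u 2 volume) {a : ℝ}
    (h : u =ᵐ[volume] fun _ => a) : u =ᵐ[volume] 0 := by
  have : Nonempty (Fin d) := ⟨⟨0, hd⟩⟩
  rcases (memLp_const_iff (by norm_num) (by norm_num)).1 ((memLp_congr_ae h).1 hu) with h1 | h1
  · exact h.trans (.of_forall fun _ => h1)
  · exact absurd h1 (by simp)

end pressure

end Strat

end

/-! ### The theorem. -/

open Strat in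
theorem mainTheorem4
    (d : ℕ) (hd : d = 1 ∨ d = 2)
    (H g T s : ℝ) (hH : 0 < H) (hg : 0 < g) (hT : 0 < T) (hs : 0 ≤ s)
    -- the stratification: `ρ_eq ∈ W^{1,∞}(-H, 0)`, bounded from below by a positive constant,
    -- with strictly positive `N²`
    (ρeq : ℝ → ℝ) (hLip : ∃ K, LipschitzOnWith K ρeq (Icc (-H) 0))
    (hρpos : ∃ ρmin > 0, ∀ z ∈ Icc (-H) 0, ρmin ≤ ρeq z)
    (hN : ∀ᵐ z ∂(vertMeasure H), 0 < bruntSq g ρeq z)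
    -- the Sturm-Liouville basis
    (c : ℕ → ℝ) (f : ℕ → ℝ → ℝ) (hmodes : IsModes H g ρeq c f)
    -- the solution, and its initial data
    (V : ℝ → Fin d → Hor d × ℝ → ℝ) (w ρ P : ℝ → Hor d × ℝ → ℝ)
    (hV : ∀ i, ContHs0 T H s (fun t => V t i)) (hw : ContHs0 T H s w) (hρ : ContHs0 T H s ρ)
    (hsol : IsLinearSolution T H g ρeq V w ρ P)
    (hcurl : ZeroVerticalVorticity T H V)
    (Vinit : Fin d → Hor d × ℝ → ℝ) (ρinit : Hor d × ℝ → ℝ)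
    (hVinit : ∀ i, V 0 i =ᵐ[stripMeasure d H] Vinit i)
    (hρinit : ρ 0 =ᵐ[stripMeasure d H] ρinit)
    -- the modal coefficients
    (Vc : ℕ → Fin d → ℝ → Hor d → ℝ) (wc ρc Pc : ℕ → ℝ → Hor d → ℝ)
    (hVc : Vc = fun n i t => velCoeff H ρeq c f n (V t i))
    (hwc : wc = fun n t => vertCoeff H g ρeq f n (w t))
    (hρc : ρc = fun n t => densCoeff H g f n (ρ t))
    (hPc : Pc = fun n t => presCoeff H ρeq c f n (P t)) :
    (∀ n : ℕ, 1 ≤ n →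
      -- the coefficients are continuous in time with values in `H^s(ℝ^d)`
      (∀ i, ContHs T s (Vc n i)) ∧ ContHs T s (wc n) ∧ ContHs T s (ρc n) ∧
      -- initial data
      (∀ i, Vc n i 0 =ᵐ[volume] velCoeff H ρeq c f n (Vinit i)) ∧
      ρc n 0 =ᵐ[volume] densCoeff H g f n ρinit ∧
      -- `∂_t V_n - ∑_{m ≥ 1} c_m c_n α_{mn} Δ ∂_t V_m + c_n ∇ρ_n = 0`
      (∀ i, ∀ φ : ℝ × Hor d → ℝ, IsTest (Ioo 0 T ×ˢ univ) φ →
        ∃ S : ℝ,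
          HasSum (fun m : ℕ => c (m + 1) * c n * interaction H ρeq f (m + 1) n *
            -pair T volume (Vc (m + 1) i) (pd dirT (lapX φ))) S ∧
          -pair T volume (Vc n i) (pd dirT φ) - S
            + c n * -pair T volume (ρc n) (pd (dirX (e i)) φ) = 0) ∧
      -- `∂_t ρ_n + c_n ∇·V_n = 0`
      (∀ φ : ℝ × Hor d → ℝ, IsTest (Ioo 0 T ×ˢ univ) φ →
        -pair T volume (ρc n) (pd dirT φ)
          + c n * ∑ i : Fin d, -pair T volume (Vc n i) (pd (dirX (e i)) φ) = 0) ∧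
      -- `w_n = - c_n ∇·V_n`
      (∀ t ∈ Icc 0 T, ∀ φ : Hor d → ℝ, IsTest univ φ →
        ∫ X, wc n t X * φ X = -c n * ∑ i : Fin d, -∫ X, Vc n i t X * pd (e i) φ X) ∧
      -- `P_n = c_n ρ_n + c_n ∑_{m ≥ 1} α_{mn} ∂_t w_m`
      (∀ φ : ℝ × Hor d → ℝ, IsTest (Ioo 0 T ×ˢ univ) φ →
        ∃ S : ℝ,
          HasSum (fun m : ℕ => interaction H ρeq f (m + 1) n *
            -pair T volume (wc (m + 1)) (pd dirT φ)) S ∧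
          pair T volume (Pc n) φ = c n * pair T volume (ρc n) φ + c n * S)) ∧
    -- the mode `n = 0`: `V_0 = 0`, and `P_0` is a function of time only, which vanishes if the
    -- pressure is normalized by `P(t) ∈ L²(S)`
    (∀ t ∈ Icc 0 T, ∀ i, Vc 0 i t =ᵐ[volume] 0) ∧
    (∃ p : ℝ → ℝ, ∀ᵐ t ∂(volume.restrict (Ioo 0 T)), Pc 0 t =ᵐ[volume] fun _ => p t) ∧
    ((∀ᵐ t ∂(volume.restrict (Ioo 0 T)), MemLp (P t) 2 (stripMeasure d H)) →
      ∀ᵐ t ∂(volume.restrict (Ioo 0 T)), Pc 0 t =ᵐ[volume] 0) := by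
  have hd0 : 0 < d := by omega
  have h : IsStratified H g ρeq := ⟨hH, hg, hLip, hρpos, hN⟩
  have hV' : ∀ i, ContL2 T (volume.prod (vertMeasure H)) (fun t => V t i) := fun i =>
    (hV i).contL2 hs
  have hw' := hw.contL2 hs
  have hρ' := hρ.contL2 hs
  subst hVc hwc hρc hPc
  refine ⟨fun n hn => ⟨fun i => ?_, ?_, ?_, fun i => ?_, ?_, fun i φ hφ => ?_, fun φ hφ => ?_,
    fun t ht φ hφ => ?_, fun φ hφ => ?_⟩, fun t ht i => ?_, ?_, fun hP => ?_⟩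
  · simp_rw [velCoeff_eq]
    exact (hV i).contHs_pint (IsModes.bdd_vel h hmodes n).memLp
  · simp_rw [vertCoeff_eq]
    exact hw.contHs_pint (IsModes.bdd_vert h hmodes hn).memLp
  · simp_rw [densCoeff_eq]
    exact hρ.contHs_pint (IsModes.bdd_dens h hmodes hn).memLp
  · simp_rw [velCoeff_eq]
    exact pint_congr_ae (hVinit i) _
  · simp_rw [densCoeff_eq]
    exact pint_congr_ae hρinit _
  · exact hsol.velocity_modal h hmodes hV' hw' hρ' hcurl hn hφ i
  · exact hsol.density_modal h hmodes hV' hw' hρ' hn hφ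
  · rw [hsol.vertCoeff_eq_div h hmodes hV' hw' hn hφ ht, Finset.sum_neg_distrib, neg_mul_neg]
  · exact hsol.pressure_modal h hmodes hV' hw' hρ' hn hφ
  · exact hsol.velCoeff_zero h hmodes hd0 hV' hw' hcurl ht i
  · exact hsol.presCoeff_zero h hmodes hd0 hV' hw' hcurl
  · obtain ⟨l, hl⟩ := hsol.presCoeff_zero h hmodes hd0 hV' hw' hcurl
    filter_upwards [hl, hP] with t ht hPt
    rw [stripMeasure_eq] at hPt
    -- Integration against the bounded function `g_0` sends `L²` of the strip into `L²(ℝ^d)`, so the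
    -- constant in `X` is square integrable.
    exact eq_zero_of_ae_eq_const hd0 (memLp_pint hPt (IsModes.bdd_gMode h hmodes 0).memLp) ht
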